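/- **Model.** A randomized logspace algorithm is a probabilistic random-access Turing machine which, on every binary input $x$ and for all values of its random bits, uses $O(\log |x|)$ cells of read-write working space and $\operatorname{poly}(|x|)$ time and outputs one bit; it has random access to $x$ and read-once access to a uniformly random bit string $r_{ro}$. A multiple access randomized logspace algorithm may in addition access, as often as desired and by address, the bits of an independent uniformly random string $r_{ma}$. It uses at most $B$ multiple access random bits on an input if there it only ever reads the first $B$ bits of $r_{ma}$. **Problem.** ${\sf G}(n,1/2)$ is the random graph on $n$ vertices in which each pair is an edge independently with probability $1/2$. ${\sf G}(n,1/2,k)$ is obtained by choosing a uniformly random set $K$ of $k$ vertices, making all pairs inside $K$ edges, and making each other pair an edge independently with probability $1/2$. For sequences $n=(n_i)$ and $k=(k_i)$, an algorithm $\mathcal A$ with random bits $r$ solves the planted clique detection problem ${\sf PC_D}(n,k)$ if $$\Pr_{G\sim {\sf G}(n,1/2),\,r}\big(\mathcal A(\{n,k,G\},r)=0\big)+\Pr_{G\sim {\sf G}(n,1/2,k),\,r}\big(\mathcal A(\{n,k,G\},r)=1\big)=1+\Omega(1),$$ where the input is the triple of $n$, $k$ and the adjacency matrix of $G$ (with $n$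 and $k$ encoded in unary, which changes the input length at most polynomially), and the asymptotics are in the index $i\to\infty$. **Conjecture (PC-Conj-Space).** For every randomized logspace algorithm $\mathcal A$ and all non-decreasing sequences $n=\omega(1)$ and $k$ of positive integers with $k=O(n^{1/2-\delta})$ for some constant $\delta>0$, the above sum equals $1+o(1)$. **Lemma.** Let $n=\omega(1)$, $k$ and $m=o(n/k)$ be non-decreasing sequences of positive integers with $k=O(n^{1/2-\delta})$ for some constant $\delta>0$. Assume that a deterministic logspace algorithm computes $m$ from $n$ and $k$ (in $O(\log n)$ space). Then $\binom n2-\binom{n-m}2=o(n^2/k)$, and if PC-Conj-Space is true, then no multiple access randomized logspace algorithm that uses at most $\binom n2-\binom{n-m}2$ multiple access random bits on the instances of ${\sf PC_D}(n-m,k)$ (for all sufficiently large indices) solves ${\sf PC_D}(n-m,k)$. No bound is assumed on the number of read-once random bits beyond the one implied by the resource bounds. -/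

import Mathlib

/-! ### Random-access Turing machines -/

/-- Head movements on a work tape. -/
inductive Move where
  | left
  | stay
  | right

/-- The displacement of the head. -/
def Move.shift : Move → ℤ
  | .left => -1
  | .stay => 0
  | .right => 1

/-- The action performed by a machine with `t` work tapes and state set `Q` in one step
(`q` is always the next state). -/
inductive Instr (t : ℕ) (Q : Type) where
  /-- On every work tape, write a symbol and then move the head. -/
  | work (write : Fin t → Option Bool) (move : Fin t → Move) (q : Q)
  /-- Append a bit to the (write-only) address tape. -/
  | address (b : Bool) (q : Q)
  /-- Fetch the input bit at the address on the address tape, and erase the address tape. -/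
  | readInput (q : Q)
  /-- Fetch the bit of the multiple access random string at the address on the address tape,
  and erase the address tape. -/
  | readRandom (q : Q)
  /-- Fetch the next bit of the read-once random string. -/
  | flip (q : Q)
  /-- Append a bit to the (write-only) output tape. -/
  | emit (b : Bool) (q : Q)
  /-- Terminate. -/
  | halt

/-- A probabilistic random-access Turing machine: a finite control with finitely many read-write
work tapes over the alphabet blank, `0`, `1` (that is, `Option Bool`), a write-only address tape
through which single bits of the input and of the multiple access random string are fetched, and a
write-only output tape.  The next action depends on the state, on the scanned work symbols, and on
the bit fetched last (`none` before the first fetch, or if an input address was out of range). -/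
structure RATM where
  tapes : ℕ
  State : Type
  finite_state : Finite State
  start : State
  δ : State → (Fin tapes → Option Bool) → Option Bool → Instr tapes State

/-- The number with the given binary digits, most significant digit first. -/
def bitsVal (l : List Bool) : ℕ := l.foldl (fun a b => 2 * a + b.toNat) 0

namespace RATM

/-- A configuration.  `coins` counts the read-once random bits consumed so far, i.e. it is the
position on the read-once random tape. -/
structure Config (M : RATM) where
  state : M.State
  cells : Fin M.tapes → ℤ → Option Bool
  head : Fin M.tapes → ℤ
  addr : List Bool
  fetched : Option Bool
  coins : ℕ
  out : List Bool

variable (M : RATM)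

/-- The initial configuration: all tapes are blank. -/
def init : M.Config where
  state := M.start
  cells := fun _ _ => none
  head := fun _ => 0
  addr := []
  fetched := none
  coins := 0
  out := []

/-- The action to be performed in a configuration. -/
def instr (c : M.Config) : Instr M.tapes M.State :=
  M.δ c.state (fun i => c.cells i (c.head i)) c.fetched

/-- One step of the machine on input `x`, read-once random bits `ro` and multiple access random
bits `ma`.  A halted configuration does not change. -/
def step (x : List Bool) (ro ma : ℕ → Bool) (c : M.Config) : M.Config :=
  match M.instr c with
  | .work w mv q =>
      { c with
        state := q
        cells := fun i => Function.update (c.cells i) (c.head i) (w i)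
        head := fun i => c.head i + (mv i).shift }
  | .address b q => { c with state := q, addr := c.addr ++ [b] }
  | .readInput q => { c with state := q, fetched := x[bitsVal c.addr]?, addr := [] }
  | .readRandom q => { c with state := q, fetched := some (ma (bitsVal c.addr)), addr := [] }
  | .flip q => { c with state := q, fetched := some (ro c.coins), coins := c.coins + 1 }
  | .emit b q => { c with state := q, out := c.out ++ [b] }
  | .halt => c

/-- The configuration after `j` steps. -/
def conf (x : List Bool) (ro ma : ℕ → Bool) (j : ℕ) : M.Config :=
  (M.step x ro ma)^[j] M.init

/-- The machine terminates with the string `l` on its output tape. -/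
def Outputs (x : List Bool) (ro ma : ℕ → Bool) (l : List Bool) : Prop :=
  ∃ j, M.instr (M.conf x ro ma j) = .halt ∧ (M.conf x ro ma j).out = l

/-- Polynomial time and logarithmic space, on every input and for all outcomes of the random
bits.  The space counted is that of the work tapes (through the excursions of their heads from the
origin) and of the address tape. -/
def RunsInLogspace : Prop :=
  ∃ C : ℕ, ∀ (x : List Bool) (ro ma : ℕ → Bool),
    M.instr (M.conf x ro ma (C * (x.length ^ C + 1))) = .halt ∧
    ∀ j, (∀ i, ((M.conf x ro ma j).head i).natAbs ≤ C * (Nat.log 2 x.length + 1)) ∧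
      (M.conf x ro ma j).addr.length ≤ C * (Nat.log 2 x.length + 1)

/-- The output always is a single bit. -/
def OutputsBit : Prop :=
  ∀ (x : List Bool) (ro ma : ℕ → Bool), ∃ b : Bool, M.Outputs x ro ma [b]

/-- The machine has no access to a multiple access random string. -/
def NoMultipleAccess : Prop := ∀ q s a q', M.δ q s a ≠ .readRandom q'

/-- The machine uses no randomness at all. -/
def IsDeterministic : Prop :=
  M.NoMultipleAccess ∧ ∀ q s a q', M.δ q s a ≠ .flip q'

/-- Multiple access randomized logspace algorithms. -/
def IsMultipleAccessRandomizedLogspace : Prop := M.RunsInLogspace ∧ M.OutputsBit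

/-- Randomized logspace algorithms: all the randomness is read-once. -/
def IsRandomizedLogspace : Prop := M.NoMultipleAccess ∧ M.RunsInLogspace ∧ M.OutputsBit

/-- On input `x`, at most `B` multiple access random bits are used: only the first `B` bits of the
multiple access random string are ever read, so that it may be taken to have length `B`. -/
def UsesAtMostRandomBits (x : List Bool) (B : ℕ) : Prop :=
  ∀ (ro ma : ℕ → Bool) (j : ℕ) (q : M.State),
    M.instr (M.conf x ro ma j) = .readRandom q → bitsVal (M.conf x ro ma j).addr < B

end RATM

/-- The law of an infinite sequence of independent fair bits (a machine halting within `T` steps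
reads at most `T` of them). -/
noncomputable def coinMeasure : MeasureTheory.Measure (ℕ → Bool) :=
  MeasureTheory.Measure.infinitePi fun _ => (PMF.uniformOfFintype Bool).toMeasure

/-- The probability, over the read-once and the multiple access random bits, that the output on
the fixed input `x` is the bit `b`. -/
noncomputable def RATM.outProb (M : RATM) (x : List Bool) (b : Bool) : ℝ :=
  (coinMeasure.prod coinMeasure).real {r | M.Outputs x r.1 r.2 [b]}

/-- The probability, over an input drawn from `P` and over the random bits, that the output is
the bit `b`. -/
noncomputable def RATM.outProbOn (M : RATM) (P : PMF (List Bool)) (b : Bool) : ℝ :=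
  ∑' x, (P x).toReal * M.outProb x b

/-! ### Hypothesis testing problems -/

/-- A sequence of pairs of (null and alternate) hypotheses, each a set of distributions of binary
strings. -/
structure HypTest where
  H₀ : ℕ → Set (PMF (List Bool))
  H₁ : ℕ → Set (PMF (List Bool))

/-- `M` solves the hypothesis testing problem: the sum of the two worst-case success probabilities
is `1 + Ω(1)`. -/
def RATM.Solves (M : RATM) (T : HypTest) : Prop :=
  ∃ c : ℝ, 0 < c ∧ ∀ᶠ i in Filter.atTop,
    1 + c ≤ (⨅ P : T.H₀ i, M.outProbOn P.1 false) + (⨅ P : T.H₁ i, M.outProbOn P.1 true)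

/-! ### Planted clique -/

/-- Independent fair bits, one for each unordered pair of vertices (those of the pairs `{v, v}`
are ignored below). -/
noncomputable def edgeBits (n : ℕ) : PMF (Sym2 (Fin n) → Bool) :=
  PMF.uniformOfFintype _

/-- The Erdős–Rényi distribution `G(n, 1/2)`. -/
noncomputable def erdosRenyi (n : ℕ) : PMF (SimpleGraph (Fin n)) :=
  (edgeBits n).map fun e => SimpleGraph.fromEdgeSet {s | e s = true}

/-- A uniformly random set of `k` vertices.  (There is none if `n < k`; the value is then
irrelevant.) -/
noncomputable def uniformSubset (n k : ℕ) : PMF (Finset (Fin n)) :=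
  if h : (Finset.univ.powersetCard k : Finset (Finset (Fin n))).Nonempty then
    PMF.uniformOfFinset _ h
  else PMF.pure Finset.univ

/-- The planted clique distribution `G(n, 1/2, k)`: all pairs inside a uniformly random `k`-set of
vertices are edges, and every other pair is an edge independently with probability `1/2`. -/
noncomputable def plantedClique (n k : ℕ) : PMF (SimpleGraph (Fin n)) :=
  (uniformSubset n k).bind fun K =>
    (edgeBits n).map fun e => SimpleGraph.fromEdgeSet {s | (∀ v ∈ s, v ∈ K) ∨ e s = true}

/-- The pair `(n, k)` as the string `1ⁿ 0 1ᵏ 0`. -/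
def encodePair (n k : ℕ) : List Bool :=
  List.replicate n true ++ [false] ++ List.replicate k true ++ [false]

open Classical in
/-- The triple `(n, k, A)`, where `A` is the `n²`-bit adjacency matrix of the graph, row by row. -/
noncomputable def encodeInstance (n k : ℕ) (G : SimpleGraph (Fin n)) : List Bool :=
  encodePair n k ++ List.ofFn fun p : Fin (n * n) =>
    decide (G.Adj (finProdFinEquiv.symm p).1 (finProdFinEquiv.symm p).2)

/-- Law of an input of the planted clique problem under the null hypothesis. -/
noncomputable def nullInput (n k : ℕ) : PMF (List Bool) :=
  (erdosRenyi n).map (encodeInstance n k)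

/-- Law of an input of the planted clique problem under the alternate hypothesis. -/
noncomputable def plantedInput (n k : ℕ) : PMF (List Bool) :=
  (plantedClique n k).map (encodeInstance n k)

/-- The planted clique detection problem for the sequences `n` and `k`. -/
noncomputable def PCD (n k : ℕ → ℕ) : HypTest where
  H₀ i := {nullInput (n i) (k i)}
  H₁ i := {plantedInput (n i) (k i)}

/-- The logspace planted clique conjecture. -/
def PCConjSpace : Prop :=
  ∀ A : RATM, A.IsRandomizedLogspace →
  ∀ n k : ℕ → ℕ, Monotone n → Monotone k → (∀ i, 0 < n i) → (∀ i, 0 < k i) →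
    Filter.Tendsto n Filter.atTop Filter.atTop →
    (∃ d : ℝ, 0 < d ∧
      (fun i => (k i : ℝ)) =O[Filter.atTop] fun i => (n i : ℝ) ^ (1 / 2 - d : ℝ)) →
    Filter.Tendsto
      (fun i => A.outProbOn (nullInput (n i) (k i)) false +
        A.outProbOn (plantedInput (n i) (k i)) true)
      Filter.atTop (nhds 1)

/-- Given `n` and `k`, the value `m` can be computed deterministically in logarithmic space: one
deterministic logspace machine outputs the binary expansion of `m i` on input `(n i, k i)`. -/
def LogspaceComputable (n k m : ℕ → ℕ) : Prop :=
  ∃ D : RATM, D.IsDeterministic ∧ D.RunsInLogspace ∧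
    ∀ (i : ℕ) (ro ma : ℕ → Bool), ∃ l : List Bool,
      D.Outputs (encodePair (n i) (k i)) ro ma l ∧ bitsVal l = m i

/-! Suppose that a multiple access algorithm `S` solves the problem on `v = n - m` vertices. A graph
on `n` vertices contains an instance on its first `v` vertices, and the remaining `C(n,2) - C(v,2)`
pairs provide exactly as many bits as `S` may reread. So let `A` compute `m`, simulate `S` on the
induced subgraph, answer each access to the multiple access string by the adjacency bit of an outer
pair, and pass its own read-once bits on to `S`.

Under the null hypothesis the outer bits are fair and independent of the subgraph, so `A` and `S`
have the same output law. Under the alternate hypothesis the same is true conditionally on the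
clique lying among the first `v` vertices, because a pair with an endpoint outside the clique is
never planted (`subRandom_plantedGraph`, `expect_outProb_eq`). This event has probability `C(v,k) /
C(n,k) ≥ 1 - mk/n` (`one_sub_le_choose_div`). Hence the success sum of `S` exceeds that of `A` by at
most `mk/n = o(1)`, while the conjecture makes the sum of `A` tend to `1`.

Most of the work is to show that `A` is a legitimate machine (`exists_reduction`). Programs are
built from composable fragments, numbers live in binary counters on separate tapes, and
`exists_trans_simulate` interprets a given machine with its input, address and output operations
replaced by subroutines. Resource bounds must hold on every string, so malformed inputs are parsed
too, `m` is cut off at `n`, and absent bits are read as `0`.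

Running time is never counted. A machine with read-once randomness that halts for all random strings
cannot repeat a configuration, since otherwise a periodic random string would keep it running
forever (`core_conf_ne`). Halting and logarithmic space therefore already give polynomial time
(`runsInLogspace_of_halts`). -/

/-! ### Machine fragments -/

/-- The effect of one step of a machine fragment. -/
inductive Act (ι : Type) where
  | work (write : ι → Option Bool) (move : ι → Move)
  | address (b : Bool)
  | readInput
  | flip
  | emit (b : Bool)

/-- The memory of a machine with tapes indexed by `ι` and control data in `F`. -/
structure Store (ι F : Type) where
  ctl : F
  cells : ι → ℤ → Option Bool
  head : ι → ℤ
  addr : List Bool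
  fetched : Option Bool
  coins : ℕ
  out : List Bool

/-- What the finite control sees. -/
structure View (ι F : Type) where
  ctl : F
  scan : ι → Option Bool
  fetched : Option Bool

/-- Leave everything in place. -/
def View.noop {ι F : Type} (v : View ι F) : Act ι := .work v.scan fun _ => .stay

namespace Store

variable {ι F : Type}

def view (σ : Store ι F) : View ι F where
  ctl := σ.ctl
  scan i := σ.cells i (σ.head i)
  fetched := σ.fetched

/-- Perform an action and replace the control data. -/
def act (x : List Bool) (ro : ℕ → Bool) (σ : Store ι F) (f : F) : Act ι → Store ι F
  | .work w mv =>
      { σ with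
        ctl := f
        cells := fun i => Function.update (σ.cells i) (σ.head i) (w i)
        head := fun i => σ.head i + (mv i).shift }
  | .address b => { σ with ctl := f, addr := σ.addr ++ [b] }
  | .readInput => { σ with ctl := f, fetched := x[bitsVal σ.addr]?, addr := [] }
  | .flip => { σ with ctl := f, fetched := some (ro σ.coins), coins := σ.coins + 1 }
  | .emit b => { σ with ctl := f, out := σ.out ++ [b] }

/-- There is no idle action, so branching and changes of the control data are encoded as a work step
that writes back what is scanned. -/
theorem act_noop (x : List Bool) (ro : ℕ → Bool) (σ : Store ι F) (f : F) :
    σ.act x ro f σ.view.noop = { σ with ctl := f } := by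
  simp [act, View.noop, view, Move.shift]

end Store

/-- A machine fragment: it is started in its entry state, and left by going to `none`. -/
structure Frag (ι F : Type) where
  Q : Type
  finite_state : Finite Q
  entry : Q
  δ : Q → View ι F → Act ι × F × Option Q

namespace Frag

variable {ι F : Type}

def next (x : List Bool) (ro : ℕ → Bool) (A : Frag ι F) (q : A.Q) (σ : Store ι F) :
    Option A.Q × Store ι F :=
  ((A.δ q σ.view).2.2, σ.act x ro (A.δ q σ.view).2.1 (A.δ q σ.view).1)

/-- A run of a fragment all of whose stores, except perhaps the last, satisfy `P`. -/
def Path (x : List Bool) (ro : ℕ → Bool) (P : Store ι F → Prop) (A : Frag ι F) :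
    Option A.Q × Store ι F → Option A.Q × Store ι F → Prop :=
  Relation.ReflTransGen fun c c' => ∃ q, c.1 = some q ∧ P c.2 ∧ c' = A.next x ro q c.2

/-- The fragment transforms the store `σ` into `σ'`. -/
def Runs (x : List Bool) (ro : ℕ → Bool) (P : Store ι F → Prop) (A : Frag ι F)
    (σ σ' : Store ι F) : Prop :=
  A.Path x ro P (some A.entry, σ) (none, σ')

variable {x : List Bool} {ro : ℕ → Bool} {P : Store ι F → Prop}

/-- A map of states compatible with the transitions transports runs. Only live states have to stay
live: `φ none` may be a state of `B`, and this is how composition and loops redirect the exit of a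
subfragment. -/
theorem Path.lift {A B : Frag ι F} (φ : Option A.Q → Option B.Q)
    (h : ∀ q v, ∃ q', φ (some q) = some q' ∧
      B.δ q' v = ((A.δ q v).1, (A.δ q v).2.1, φ (A.δ q v).2.2))
    {c c' : Option A.Q × Store ι F} (hp : A.Path x ro P c c') :
    B.Path x ro P (φ c.1, c.2) (φ c'.1, c'.2) := by
  induction hp with
  | refl => exact .refl
  | tail _ hs ih =>
    obtain ⟨q, hq, hP, rfl⟩ := hs
    refine ih.tail ?_
    obtain ⟨q', hq', hδ⟩ := h q (Store.view _)
    exact ⟨q', by rw [hq, hq'], hP, by simp only [next]; rw [hδ]⟩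

/-- A single step. -/
def step (f : View ι F → Act ι × F) : Frag ι F where
  Q := Unit
  finite_state := inferInstance
  entry := ()
  δ _ v := ((f v).1, (f v).2, none)

theorem runs_step (f : View ι F → Act ι × F) {σ : Store ι F} (h : P σ) :
    (step f).Runs x ro P σ (σ.act x ro (f σ.view).2 (f σ.view).1) :=
  .single ⟨(), rfl, h, rfl⟩

/-- Do nothing. -/
def skip : Frag ι F := step fun v => (v.noop, v.ctl)

theorem runs_skip {σ : Store ι F} (h : P σ) : skip.Runs x ro P σ σ := by
  have := runs_step (x := x) (ro := ro) (fun v : View ι F => (v.noop, v.ctl)) h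
  rwa [Store.act_noop] at this

/-- Sequential composition. -/
def seq (A B : Frag ι F) : Frag ι F where
  Q := A.Q ⊕ B.Q
  finite_state := by
    have := A.finite_state
    have := B.finite_state
    infer_instance
  entry := .inl A.entry
  δ
    | .inl q, v => ((A.δ q v).1, (A.δ q v).2.1, some ((A.δ q v).2.2.elim (.inr B.entry) .inl))
    | .inr q, v => ((B.δ q v).1, (B.δ q v).2.1, (B.δ q v).2.2.map .inr)

theorem Runs.seq {A B : Frag ι F} {σ₁ σ₂ σ₃ : Store ι F} (hA : A.Runs x ro P σ₁ σ₂)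
    (hB : B.Runs x ro P σ₂ σ₃) : (A.seq B).Runs x ro P σ₁ σ₃ :=
  (Path.lift (B := A.seq B) (fun o => some (o.elim (.inr B.entry) .inl))
    (fun q _ => ⟨.inl q, rfl, rfl⟩) hA).trans
  (Path.lift (B := A.seq B) (Option.map .inr) (fun q _ => ⟨.inr q, rfl, rfl⟩) hB)

/-- Case distinction. -/
def switch {κ : Type} [Finite κ] (sel : View ι F → κ) (A : κ → Frag ι F) : Frag ι F where
  Q := Option (Σ i, (A i).Q)
  finite_state := by
    have := fun i => (A i).finite_state
    infer_instance
  entry := none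
  δ
    | none, v => (v.noop, v.ctl, some (some ⟨sel v, (A (sel v)).entry⟩))
    | some ⟨i, q⟩, v =>
      (((A i).δ q v).1, ((A i).δ q v).2.1, ((A i).δ q v).2.2.map fun q' => some ⟨i, q'⟩)

theorem Runs.switch {κ : Type} [Finite κ] {sel : View ι F → κ} {A : κ → Frag ι F}
    {σ σ' : Store ι F} (h : P σ) (hA : (A (sel σ.view)).Runs x ro P σ σ') :
    (switch sel A).Runs x ro P σ σ' := by
  refine Relation.ReflTransGen.head ⟨none, rfl, h, rfl⟩ ?_
  have := Path.lift (B := Frag.switch sel A) (Option.map fun q' => some ⟨sel σ.view, q'⟩)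
    (fun q _ => ⟨some ⟨_, q⟩, rfl, rfl⟩) hA
  have e : (Frag.switch sel A).next x ro none σ =
      (some (some ⟨sel σ.view, (A (sel σ.view)).entry⟩), σ) :=
    Prod.ext rfl (Store.act_noop x ro σ σ.ctl)
  exact (congrArg (fun c => Path x ro P (Frag.switch sel A) c (none, σ')) e).mpr this

/-- Iteration as long as a condition holds. -/
def loop (c : View ι F → Bool) (A : Frag ι F) : Frag ι F where
  Q := Option A.Q
  finite_state := by
    have := A.finite_state
    infer_instance
  entry := none
  δ
    | none, v => (v.noop, v.ctl, if c v then some (some A.entry) else none)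
    | some q, v => ((A.δ q v).1, (A.δ q v).2.1, some (A.δ q v).2.2)

theorem runs_loop_false {c : View ι F → Bool} {A : Frag ι F} {σ : Store ι F} (h : P σ)
    (hc : c σ.view = false) : (loop c A).Runs x ro P σ σ := by
  refine .single ⟨none, rfl, h, ?_⟩
  refine Prod.ext ?_ (Store.act_noop x ro σ σ.ctl).symm
  change none = if c σ.view then some (some A.entry) else none
  simp [hc]

theorem Runs.loop_true {c : View ι F → Bool} {A : Frag ι F} {σ₁ σ₂ σ₃ : Store ι F} (h : P σ₁)
    (hc : c σ₁.view = true) (hA : A.Runs x ro P σ₁ σ₂) (hL : (loop c A).Runs x ro P σ₂ σ₃) :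
    (loop c A).Runs x ro P σ₁ σ₃ := by
  refine Relation.ReflTransGen.head ⟨none, rfl, h, rfl⟩ (.trans ?_ hL)
  have := Path.lift (B := loop c A) some (fun q _ => ⟨some q, rfl, rfl⟩) hA
  have e : (loop c A).next x ro none σ₁ = (some (some A.entry), σ₁) := by
    refine Prod.ext ?_ (Store.act_noop x ro σ₁ σ₁.ctl)
    change (if c σ₁.view then some (some A.entry) else none) = _
    simp [hc]
  exact (congrArg (fun d => Path x ro P (loop c A) d (some none, σ₂)) e).mpr this

theorem runs_loop {c : View ι F → Bool} {A : Frag ι F} (N : ℕ) (f : ℕ → Store ι F)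
    (hP : ∀ i ≤ N, P (f i)) (hc : ∀ i < N, c (f i).view = true) (hN : c (f N).view = false)
    (hA : ∀ i < N, A.Runs x ro P (f i) (f (i + 1))) : (loop c A).Runs x ro P (f 0) (f N) := by
  induction N generalizing f with
  | zero => exact runs_loop_false (hP 0 le_rfl) hN
  | succ N ih =>
    exact (hA 0 N.succ_pos).loop_true (hP 0 (Nat.zero_le _)) (hc 0 N.succ_pos)
      (ih (fun i => f (i + 1)) (fun i hi => hP _ (by omega)) (fun i hi => hc _ (by omega)) hN
        fun i hi => hA _ (by omega))

/-! ### Fragments as machines -/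

/-- An action as an instruction. -/
def _root_.Act.toInstr {t : ℕ} {Q : Type} (e : ι ≃ Fin t) (q : Q) : Act ι → Instr t Q
  | .work w mv => .work (fun i => w (e.symm i)) (fun i => mv (e.symm i)) q
  | .address b => .address b q
  | .readInput => .readInput q
  | .flip => .flip q
  | .emit b => .emit b q

variable [Fintype ι] [Finite F]

/-- The machine that runs a fragment and then terminates. -/
noncomputable def toRATM (A : Frag ι F) (f₀ : F) : RATM where
  tapes := Fintype.card ι
  State := Option A.Q × F
  finite_state := by
    have := A.finite_state
    infer_instance
  start := (some A.entry, f₀)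
  δ
    | (none, _), _, _ => .halt
    | (some q, f), s, a =>
      let d := A.δ q ⟨f, fun i => s (Fintype.equivFin ι i), a⟩
      d.1.toInstr (Fintype.equivFin ι) (d.2.2, d.2.1)

/-- A fragment configuration as a machine configuration. -/
noncomputable def toConfig (A : Frag ι F) (f₀ : F) (c : Option A.Q × Store ι F) :
    (A.toRATM f₀).Config where
  state := (c.1, c.2.ctl)
  cells i := c.2.cells ((Fintype.equivFin ι).symm i)
  head i := c.2.head ((Fintype.equivFin ι).symm i)
  addr := c.2.addr
  fetched := c.2.fetched
  coins := c.2.coins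
  out := c.2.out

/-- `Act` offers no access to the multiple access string, so every machine built from fragments is
read-once by construction. -/
theorem toRATM_noMultipleAccess (A : Frag ι F) (f₀ : F) : (A.toRATM f₀).NoMultipleAccess := by
  rintro ⟨_ | q, f⟩ s a q'
  · simp [toRATM]
  · simp only [toRATM]
    generalize A.δ _ _ = d
    obtain ⟨d1, d2⟩ := d
    cases d1 <;> simp [Act.toInstr]

theorem step_toConfig (A : Frag ι F) (f₀ : F) (ma : ℕ → Bool) (q : A.Q) (σ : Store ι F) :
    (A.toRATM f₀).step x ro ma (A.toConfig f₀ (some q, σ)) = A.toConfig f₀ (A.next x ro q σ) := by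
  have hi : (A.toRATM f₀).instr (A.toConfig f₀ (some q, σ)) =
      (A.δ q σ.view).1.toInstr (Fintype.equivFin ι)
        ((A.δ q σ.view).2.2, (A.δ q σ.view).2.1) := by
    simp [RATM.instr, toConfig, toRATM, Store.view]
  rw [RATM.step, hi, next]
  generalize A.δ q σ.view = d
  obtain ⟨d1, d2, d3⟩ := d
  cases d1 <;> rfl

/-- The empty store. -/
def _root_.Store.blank (f₀ : F) : Store ι F where
  ctl := f₀
  cells _ _ := none
  head _ := 0
  addr := []
  fetched := none
  coins := 0
  out := []

/-- The invariant `P` holds at every time before the end; with `P` a space bound on stores this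
becomes a space bound for the machine. -/
theorem Runs.exists_conf {A : Frag ι F} {f₀ : F} {σ : Store ι F}
    (h : A.Runs x ro P (.blank f₀) σ) (ma : ℕ → Bool) :
    ∃ N, (A.toRATM f₀).conf x ro ma N = A.toConfig f₀ (none, σ) ∧
      ∀ j < N, ∃ c : Option A.Q × Store ι F, P c.2 ∧
        (A.toRATM f₀).conf x ro ma j = A.toConfig f₀ c := by
  suffices ∀ c, A.Path x ro P (some A.entry, .blank f₀) c →
      ∃ N, (A.toRATM f₀).conf x ro ma N = A.toConfig f₀ c ∧
      ∀ j < N, ∃ c : Option A.Q × Store ι F, P c.2 ∧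
        (A.toRATM f₀).conf x ro ma j = A.toConfig f₀ c from this _ h
  intro c hc
  induction hc with
  | refl => exact ⟨0, rfl, fun _ hj => absurd hj (Nat.not_lt_zero _)⟩
  | @tail b c _ hs ih =>
    obtain ⟨N, hN, hlt⟩ := ih
    obtain ⟨q, hq, hP, rfl⟩ := hs
    have hb : b = (some q, b.2) := Prod.ext hq rfl
    refine ⟨N + 1, ?_, fun j hj => ?_⟩
    · rw [RATM.conf, Function.iterate_succ_apply']
      change (A.toRATM f₀).step x ro ma ((A.toRATM f₀).conf x ro ma N) = _
      rw [hN, hb, step_toConfig]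
    · rcases Nat.lt_succ_iff_lt_or_eq.1 hj with h | rfl
      · exact hlt j h
      · exact ⟨b, hP, hN⟩

end Frag

/-! ### Termination -/

namespace RATM

variable (M : RATM)

theorem conf_succ (x : List Bool) (ro ma : ℕ → Bool) (j : ℕ) :
    M.conf x ro ma (j + 1) = M.step x ro ma (M.conf x ro ma j) :=
  Function.iterate_succ_apply' _ _ _

variable {M}

theorem step_of_halt {x : List Bool} {ro ma : ℕ → Bool} {c : M.Config} (h : M.instr c = .halt) :
    M.step x ro ma c = c := by
  simp [step, h]

theorem conf_of_halt {x : List Bool} {ro ma : ℕ → Bool} {i j : ℕ}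
    (h : M.instr (M.conf x ro ma i) = .halt) (hij : i ≤ j) :
    M.conf x ro ma j = M.conf x ro ma i := by
  induction j, hij using Nat.le_induction with
  | base => rfl
  | succ j _ ih => rw [conf_succ, ih, step_of_halt h]

/-- Halted configurations are frozen, so any halting time may be used to read off the output. -/
theorem outputs_iff_of_halt {x : List Bool} {ro ma : ℕ → Bool} {i : ℕ}
    (h : M.instr (M.conf x ro ma i) = .halt) (l : List Bool) :
    M.Outputs x ro ma l ↔ (M.conf x ro ma i).out = l := by
  refine ⟨fun ⟨j, hj, hl⟩ => ?_, fun hl => ⟨i, h, hl⟩⟩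
  rw [← hl]
  rcases le_total i j with hij | hij
  · rw [conf_of_halt h hij]
  · rw [conf_of_halt hj hij]

theorem coins_step_le (x : List Bool) (ro ma : ℕ → Bool) (c : M.Config) :
    c.coins ≤ (M.step x ro ma c).coins ∧ (M.step x ro ma c).coins ≤ c.coins + 1 := by
  unfold step
  split <;> simp

theorem coins_mono (x : List Bool) (ro ma : ℕ → Bool) :
    Monotone fun j => (M.conf x ro ma j).coins :=
  monotone_nat_of_le_succ fun j => by
    rw [conf_succ]
    exact (coins_step_le x ro ma _).1

theorem coins_le (x : List Bool) (ro ma : ℕ → Bool) (j : ℕ) : (M.conf x ro ma j).coins ≤ j := by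
  induction j with
  | zero => exact le_rfl
  | succ j ih =>
    rw [conf_succ]
    exact (coins_step_le x ro ma _).2.trans (Nat.succ_le_succ ih)

/-- The run only depends on the random bits that have been read. -/
theorem conf_congr {x : List Bool} {ro ro' ma ma' : ℕ → Bool} {N : ℕ}
    (hro : ∀ c < (M.conf x ro ma N).coins, ro c = ro' c)
    (hma : ∀ j < N, ∀ q, M.instr (M.conf x ro ma j) = .readRandom q →
      ma (bitsVal (M.conf x ro ma j).addr) = ma' (bitsVal (M.conf x ro ma j).addr)) :
    M.conf x ro' ma' N = M.conf x ro ma N := by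
  induction N with
  | zero => rfl
  | succ N ih =>
    rw [conf_succ, ih (fun c hc => hro c (hc.trans_le (coins_mono x ro ma N.le_succ)))
      (fun j hj => hma j (by omega)), conf_succ]
    have hm := hma N N.lt_succ_self
    -- A flip in the last step fetches the bit with index `c.coins`, which is below the coin count
    -- after that step, so `hro` covers it.
    rw [conf_succ] at hro
    generalize M.conf x ro ma N = c at *
    unfold step at *
    cases h : M.instr c with
    | flip q => simp_all
    | readRandom q => simp_all
    | _ => rfl

/-- Two configurations that agree up to the number of coins and the output behave alike. -/
def Config.core (c : M.Config) : M.Config := { c with coins := 0, out := [] }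

/-- A step never looks at the output, and it sees the coin count only through the next random bit.
Hence agreement survives a shift by `s` of the position on the random tape, provided that the two
bits coincide. -/
theorem core_step_eq (hM : M.NoMultipleAccess) {x : List Bool} {ro ma ma' : ℕ → Bool} {s : ℕ}
    {c c' : M.Config} (hc : c.core = c'.core) (hs : c'.coins = c.coins + s)
    (hro : ro (c.coins + s) = ro c.coins) :
    (M.step x ro ma c).core = (M.step x ro ma' c').core ∧
      (M.step x ro ma' c').coins = (M.step x ro ma c).coins + s := by
  obtain ⟨a1, a2, a3, a4, a5, a6, a7⟩ := c
  obtain ⟨b1, b2, b3, b4, b5, b6, b7⟩ := c'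
  simp only [Config.core, Config.mk.injEq, and_true] at hc hs hro
  obtain ⟨rfl, rfl, rfl, rfl, rfl⟩ := hc
  subst hs
  simp only [step, instr]
  have hne := hM a1 (fun i => a2 i (a3 i)) a5
  cases h : M.δ a1 (fun i => a2 i (a3 i)) a5 with
  | readRandom q => exact absurd h (hne q)
  | flip q => simp [Config.core, hro]; omega
  | _ => simp [Config.core]

/-- A machine that terminates for all random bits never repeats a configuration. -/
theorem core_conf_ne (hM : M.NoMultipleAccess) {x : List Bool}
    (hhalt : ∀ ro ma, ∃ j, M.instr (M.conf x ro ma j) = .halt) {ro ma : ℕ → Bool} {i j : ℕ}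
    (hij : i < j) (hj : ∀ l < j, M.instr (M.conf x ro ma l) ≠ .halt) :
    (M.conf x ro ma i).core ≠ (M.conf x ro ma j).core := by
  intro heq
  set a := (M.conf x ro ma i).coins with ha
  set b := (M.conf x ro ma j).coins with hb
  have hab : a ≤ b := coins_mono x ro ma hij.le
  -- The bits read up to time `j` are kept, and the block consumed between the times `i` and `j` is
  -- then repeated forever. If no bit was consumed (`a = b`), reduction modulo `0` changes nothing
  -- and `ro'` still equals `ro` from `a` on.
  set ro' : ℕ → Bool := fun c => if c < b then ro c else ro (a + (c - a) % (b - a)) with hro'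
  have hper : ∀ c, a ≤ c → ro' (c + (b - a)) = ro' c := by
    intro c hc
    rcases hab.eq_or_lt with h | h
    · simp [h]
    · have h1 : ∀ c, a ≤ c → ro' c = ro (a + (c - a) % (b - a)) := by
        intro c hc
        simp only [hro']
        split
        · rw [Nat.mod_eq_of_lt (by omega)]
          congr 1
          omega
        · rfl
      rw [h1 c hc, h1 _ (by omega), show c + (b - a) - a = c - a + (b - a) by omega,
        Nat.add_mod_right]
  have hma : ∀ (N : ℕ), ∀ j < N, ∀ q, M.instr (M.conf x ro ma j) = .readRandom q →
      ma (bitsVal (M.conf x ro ma j).addr) = ma (bitsVal (M.conf x ro ma j).addr) :=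
    fun _ _ _ _ _ => rfl
  have hci : ∀ l ≤ j, M.conf x ro' ma l = M.conf x ro ma l := fun l hl =>
    conf_congr (fun c hc => by
      have : c < b := hc.trans_le (coins_mono x ro ma hl)
      simp [hro', this]) (hma l)
  -- With the periodic random string the run is periodic from time `i` on, up to the coin count and
  -- the output.
  have key : ∀ l, (M.conf x ro' ma (i + l)).core = (M.conf x ro' ma (j + l)).core ∧
      (M.conf x ro' ma (j + l)).coins = (M.conf x ro' ma (i + l)).coins + (b - a) := by
    intro l
    induction l with
    | zero =>
      simp only [add_zero]
      rw [hci i hij.le, hci j le_rfl]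
      exact ⟨heq, by omega⟩
    | succ l ih =>
      rw [← add_assoc, ← add_assoc, conf_succ, conf_succ]
      refine core_step_eq hM ih.1 ih.2 (hper _ ?_)
      have := coins_mono (M := M) x ro' ma (Nat.le_add_right i l)
      simp only [hci i hij.le] at this
      exact this
  have hinstr : ∀ c c' : M.Config, c.core = c'.core → M.instr c = M.instr c' := by
    intro c c' h
    change M.instr c.core = M.instr c'.core
    rw [h]
  have hnot : ∀ l, M.instr (M.conf x ro' ma l) ≠ .halt := by
    intro l
    induction l using Nat.strong_induction_on with
    | _ l ih =>
      rcases lt_or_ge l j with hl | hl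
      · rw [hci l hl.le]
        exact hj l hl
      · obtain ⟨d, rfl⟩ := Nat.exists_eq_add_of_le hl
        -- Time `j + d` behaves like the earlier time `i + d`, so halting at any time would force
        -- halting before `j`.
        rw [← hinstr _ _ (key d).1]
        exact ih _ (by omega)
  obtain ⟨l, hl⟩ := hhalt ro' ma
  exact hnot l hl

/-- Cells that the heads cannot have reached are blank. -/
theorem cells_eq_none {x : List Bool} {ro ma : ℕ → Bool} {s : ℕ}
    (hs : ∀ j i, ((M.conf x ro ma j).head i).natAbs ≤ s) (j : ℕ) (i : Fin M.tapes) (z : ℤ)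
    (hz : s < z.natAbs) : (M.conf x ro ma j).cells i z = none := by
  induction j with
  | zero => rfl
  | succ j ih =>
    rw [conf_succ]
    have := hs j i
    generalize M.conf x ro ma j = c at *
    unfold step
    split
    case h_1 =>
      change Function.update (c.cells i) (c.head i) _ z = none
      rw [Function.update_of_ne (by rintro rfl; omega), ih]
    all_goals exact ih

/-- The number of configurations in space `s` is exponential in `s`. -/
theorem exists_halt_le (hM : M.NoMultipleAccess) : ∃ D : ℕ, ∀ (x : List Bool) (s : ℕ),
    (∀ ro ma, ∃ j, M.instr (M.conf x ro ma j) = .halt) → ∀ ro ma,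
    (∀ j, (∀ i, ((M.conf x ro ma j).head i).natAbs ≤ s) ∧
      (M.conf x ro ma j).addr.length ≤ s) →
    ∃ j ≤ 2 ^ (D * (s + 1)), M.instr (M.conf x ro ma j) = .halt := by
  classical
  have := M.finite_state
  have := Fintype.ofFinite M.State
  -- The exponents of the separate factors add up: the number of states for the state, `4 * M.tapes`
  -- each for the tape contents and for the head positions, and `4` for the address together with
  -- the fetched bit.
  refine ⟨Fintype.card M.State + 8 * M.tapes + 4, fun x s hh ro ma hs => ?_⟩
  have hex := hh ro ma
  refine ⟨Nat.find hex, ?_, Nat.find_spec hex⟩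
  -- Finite snapshots of a configuration: only the window `[-s, s]` of each tape matters, and the
  -- address is stored as its length and its bits padded to length `s`. The times before the first
  -- halt inject into `X`.
  let X := M.State × (Fin M.tapes → Set.Icc (-s : ℤ) s → Option Bool) ×
    (Fin M.tapes → Set.Icc (-s : ℤ) s) × (Fin (s + 1) × (Fin s → Bool)) × Option Bool
  have hmem : ∀ j i, (M.conf x ro ma j).head i ∈ Set.Icc (-s : ℤ) s := fun j i => by
    have := (hs j).1 i
    constructor <;> omega
  let f : Fin (Nat.find hex) → X := fun j =>
    let c := M.conf x ro ma j
    (c.state, fun i z => c.cells i z, fun i => ⟨c.head i, hmem j i⟩,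
      (⟨c.addr.length, Nat.lt_succ_of_le (hs j).2⟩, fun l => c.addr.getD l false), c.fetched)
  have hf : Function.Injective f := by
    intro j l hjl
    have hcore : (M.conf x ro ma j).core = (M.conf x ro ma l).core := by
      simp only [f, X, Prod.mk.injEq, Fin.mk.injEq] at hjl
      obtain ⟨h1, h2, h3, ⟨h4, h5⟩, h6⟩ := hjl
      have hcells : (M.conf x ro ma j).cells = (M.conf x ro ma l).cells := by
        funext i z
        by_cases hz : s < z.natAbs
        · rw [cells_eq_none (fun j => (hs j).1) _ _ _ hz,
            cells_eq_none (fun j => (hs j).1) _ _ _ hz]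
        · exact congr_fun (congr_fun h2 i) ⟨z, by constructor <;> omega⟩
      have hhead : (M.conf x ro ma j).head = (M.conf x ro ma l).head := by
        funext i
        simpa using congr_fun h3 i
      have haddr : (M.conf x ro ma j).addr = (M.conf x ro ma l).addr := by
        refine List.ext_getElem h4 fun p hp hp' => ?_
        have := congr_fun h5 ⟨p, hp.trans_le (hs j).2⟩
        simp only [List.getD_eq_getElem _ _ hp, List.getD_eq_getElem _ _ hp'] at this
        exact this
      simp [Config.core, h1, hcells, hhead, haddr, h6]
    by_contra hne
    rcases lt_or_gt_of_ne (fun h => hne (Fin.ext h) : (j : ℕ) ≠ l) with h | h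
    · exact core_conf_ne hM hh h (fun p hp => Nat.find_min hex (hp.trans l.2)) hcore
    · exact core_conf_ne hM hh h (fun p hp => Nat.find_min hex (hp.trans j.2)) hcore.symm
  have hcard := Fintype.card_le_of_injective f hf
  have hI : Fintype.card (Set.Icc (-s : ℤ) s) = 2 * s + 1 := by
    simp only [Fintype.card_ofFinset, Int.card_Icc]
    omega
  simp only [X, Fintype.card_prod, Fintype.card_pi, Fintype.card_fin, hI, Finset.prod_const,
    Finset.card_univ, Fintype.card_option, Fintype.card_bool] at hcard
  refine hcard.trans ?_
  have e1 : Fintype.card M.State ≤ 2 ^ (Fintype.card M.State * (s + 1)) :=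
    Nat.lt_two_pow_self.le.trans (Nat.pow_le_pow_right (by norm_num) (by nlinarith))
  have e2 : ((2 + 1) ^ (2 * s + 1)) ^ M.tapes ≤ 2 ^ (4 * M.tapes * (s + 1)) := by
    rw [← pow_mul]
    calc (2 + 1) ^ ((2 * s + 1) * M.tapes) ≤ (2 ^ 2) ^ ((2 * s + 1) * M.tapes) :=
          Nat.pow_le_pow_left (by norm_num) _
      _ = 2 ^ (2 * ((2 * s + 1) * M.tapes)) := by rw [← pow_mul]
      _ ≤ _ := Nat.pow_le_pow_right (by norm_num) (by nlinarith)
  have e3 : (2 * s + 1) ^ M.tapes ≤ 2 ^ (4 * M.tapes * (s + 1)) := by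
    calc (2 * s + 1) ^ M.tapes ≤ (2 ^ (2 * s + 1)) ^ M.tapes :=
          Nat.pow_le_pow_left Nat.lt_two_pow_self.le _
      _ = 2 ^ ((2 * s + 1) * M.tapes) := by rw [← pow_mul]
      _ ≤ _ := Nat.pow_le_pow_right (by norm_num) (by nlinarith)
  have e4 : (s + 1) * 2 ^ s * (2 + 1) ≤ 2 ^ (4 * (s + 1)) := by
    calc (s + 1) * 2 ^ s * (2 + 1) ≤ 2 ^ (s + 1) * 2 ^ s * 2 ^ 2 := by
          gcongr
          · exact Nat.lt_two_pow_self.le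
          · norm_num
      _ = 2 ^ (s + 1 + s + 2) := by ring
      _ ≤ _ := Nat.pow_le_pow_right (by norm_num) (by omega)
  calc _ = Fintype.card M.State * (((2 + 1) ^ (2 * s + 1)) ^ M.tapes *
        ((2 * s + 1) ^ M.tapes * ((s + 1) * 2 ^ s * (2 + 1)))) := by ring
    _ ≤ 2 ^ (Fintype.card M.State * (s + 1)) * (2 ^ (4 * M.tapes * (s + 1)) *
        (2 ^ (4 * M.tapes * (s + 1)) * 2 ^ (4 * (s + 1)))) := by gcongr
    _ = _ := by
      rw [← pow_add, ← pow_add, ← pow_add]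
      congr 1
      ring

/-- In space `O(log |x|)` there are `2 ^ O(log |x|)` configurations, which is polynomial in `|x|`;
no step count of the program is needed. -/
theorem runsInLogspace_of_halts (hM : M.NoMultipleAccess) (K : ℕ)
    (hhalt : ∀ x ro ma, ∃ j, M.instr (M.conf x ro ma j) = .halt)
    (hK : ∀ (x : List Bool) (ro ma : ℕ → Bool) (j : ℕ),
      (∀ i, ((M.conf x ro ma j).head i).natAbs ≤ K * (Nat.log 2 x.length + 1)) ∧
      (M.conf x ro ma j).addr.length ≤ K * (Nat.log 2 x.length + 1)) :
    M.RunsInLogspace := by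
  obtain ⟨D, hD⟩ := exists_halt_le hM
  -- `E` absorbs the constant factor `2 ^ (D * (K + 1))`; the rest of the bound is `(2 ^ log |x|) ^
  -- (D * K) ≤ |x| ^ (D * K)`.
  obtain ⟨E, hE⟩ : ∃ E, E = 2 ^ (D * (2 * K + 1)) := ⟨_, rfl⟩
  have hKC : K ≤ E + D * K + K := by omega
  refine ⟨E + D * K + K, fun x ro ma => ⟨?_, fun j => ⟨fun i => ?_, ?_⟩⟩⟩
  · obtain ⟨j, hj, hh⟩ := hD x _ (hhalt x) ro ma (hK x ro ma)
    rw [conf_of_halt hh (hj.trans ?_), hh]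
    rcases Nat.eq_zero_or_pos x.length with h0 | hpos
    -- For the empty input the power of the length may vanish, and the summand `1` in the time bound
    -- has to suffice.
    · rw [h0]
      calc 2 ^ (D * (K * (Nat.log 2 0 + 1) + 1)) ≤ E := hE ▸
            Nat.pow_le_pow_right (by norm_num) (by simp; nlinarith)
        _ ≤ (E + D * K + K) * 1 := by omega
        _ ≤ _ := Nat.mul_le_mul_left _ (Nat.le_add_left 1 _)
    · calc 2 ^ (D * (K * (Nat.log 2 x.length + 1) + 1))
          = 2 ^ (D * (K + 1)) * (2 ^ Nat.log 2 x.length) ^ (D * K) := by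
            rw [← pow_mul, ← pow_add]
            congr 1
            ring
        _ ≤ E * x.length ^ (D * K) := by
            rw [hE]
            gcongr
            · norm_num
            · omega
            · exact Nat.pow_log_le_self 2 hpos.ne'
        _ ≤ (E + D * K + K) *
              (x.length ^ (E + D * K + K) + 1) := by
            refine Nat.mul_le_mul (by omega) (le_trans ?_ (Nat.le_succ _))
            exact Nat.pow_le_pow_right hpos (by omega)
  · exact ((hK x ro ma j).1 i).trans (Nat.mul_le_mul_right _ hKC)
  · exact (hK x ro ma j).2.trans (Nat.mul_le_mul_right _ hKC)

end RATM

/-! ### Binary counters -/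

/-- Carry propagation, least significant digit first: `t` trailing ones become zeros and the next
zero becomes a one. If `r = []` there is no such zero, and the number gains a digit. -/
theorem bits_succ (v : ℕ) : ∃ (t : ℕ) (r : List Bool),
    (v + 1).bits = List.replicate t false ++ true :: r ∧
      v.bits = List.replicate t true ++ if r = [] then [] else false :: r := by
  induction v using Nat.strong_induction_on with
  | _ v ih =>
    rcases Nat.even_or_odd' v with ⟨u, rfl | rfl⟩
    · refine ⟨0, u.bits, by simp [Nat.bit1_bits], ?_⟩
      rcases Nat.eq_zero_or_pos u with rfl | hu
      · simp
      · have : u.bits ≠ [] := by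
          intro h
          have := Nat.size_eq_bits_len u
          rw [h] at this
          simp only [List.length_nil] at this
          exact hu.ne' (Nat.size_eq_zero.1 this.symm)
        simp [this, Nat.bit0_bits u hu.ne']
    · obtain ⟨t, r, h1, h2⟩ := ih u (by omega)
      refine ⟨t + 1, r, ?_, ?_⟩
      · rw [show 2 * u + 1 + 1 = 2 * (u + 1) by ring, Nat.bit0_bits _ u.succ_ne_zero, h1]
        rfl
      · rw [Nat.bit1_bits, h2]
        rfl

theorem bitsVal_append_singleton (l : List Bool) (b : Bool) :
    bitsVal (l ++ [b]) = 2 * bitsVal l + b.toNat := by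
  simp [bitsVal]

theorem bitsVal_lt (l : List Bool) : bitsVal l < 2 ^ l.length := by
  induction l using List.reverseRecOn with
  | nil => simp [bitsVal]
  | append_singleton l b ih =>
    rw [bitsVal_append_singleton, List.length_append, List.length_singleton, pow_succ]
    have := Bool.toNat_lt b
    omega

/-- Counters store the least significant digit first, whereas addresses are read most significant
digit first. -/
theorem bitsVal_reverse_bits (v : ℕ) : bitsVal v.bits.reverse = v := by
  induction v using Nat.strong_induction_on with
  | _ v ih =>
    rcases Nat.even_or_odd' v with ⟨u, rfl | rfl⟩
    · rcases Nat.eq_zero_or_pos u with rfl | hu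
      · rfl
      · rw [Nat.bit0_bits _ hu.ne', List.reverse_cons, bitsVal_append_singleton, ih u (by omega)]
        simp
    · rw [Nat.bit1_bits, List.reverse_cons, bitsVal_append_singleton, ih u (by omega)]
      simp

/-- The tape contents with the word `l` written from cell `0` on. -/
def wordCells (l : List Bool) (z : ℤ) : Option Bool := if 0 ≤ z then l[z.toNat]? else none

@[simp]
theorem wordCells_natCast (l : List Bool) (i : ℕ) : wordCells l i = l[i]? := by
  simp [wordCells]

theorem wordCells_of_neg (l : List Bool) {z : ℤ} (hz : z < 0) : wordCells l z = none := by
  simp [wordCells, hz]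

theorem wordCells_nil : wordCells [] = fun _ => none := by
  funext z
  simp [wordCells]

theorem wordCells_ext {c : ℤ → Option Bool} {l : List Bool} (hneg : ∀ z < 0, c z = none)
    (h : ∀ i : ℕ, c i = l[i]?) : c = wordCells l := by
  funext z
  rcases lt_or_ge z 0 with hz | hz
  · rw [hneg z hz, wordCells_of_neg l hz]
  · lift z to ℕ using hz
    rw [h, wordCells_natCast]

theorem update_wordCells (l₁ l₂ : List Bool) (b b' : Bool) :
    Function.update (wordCells (l₁ ++ b :: l₂)) l₁.length (some b') =
      wordCells (l₁ ++ b' :: l₂) := by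
  refine wordCells_ext (fun z hz => ?_) fun i => ?_
  · rw [Function.update_of_ne (by omega), wordCells_of_neg _ hz]
  · by_cases hi : i = l₁.length
    · subst hi
      simp
    · rw [Function.update_of_ne (by exact_mod_cast hi), wordCells_natCast]
      rcases lt_or_gt_of_ne hi with h | h
      · rw [List.getElem?_append_left h, List.getElem?_append_left h]
      · rw [List.getElem?_append_right h.le, List.getElem?_append_right h.le]
        obtain ⟨d, hd⟩ := Nat.exists_eq_add_of_lt h
        rw [show i - l₁.length = d + 1 by omega]
        simp

theorem update_wordCells_end (l : List Bool) (b : Bool) :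
    Function.update (wordCells l) l.length (some b) = wordCells (l ++ [b]) := by
  refine wordCells_ext (fun z hz => ?_) fun i => ?_
  · rw [Function.update_of_ne (by omega), wordCells_of_neg _ hz]
  · by_cases hi : i = l.length
    · subst hi
      simp
    · rw [Function.update_of_ne (by exact_mod_cast hi), wordCells_natCast]
      rcases lt_or_gt_of_ne hi with h | h
      · rw [List.getElem?_append_left h]
      · rw [List.getElem?_eq_none h.le, List.getElem?_eq_none (by simp; omega)]

theorem update_wordCells_none (l : List Bool) (b : Bool) :
    Function.update (wordCells (l ++ [b])) l.length none = wordCells l := by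
  rw [← update_wordCells_end, Function.update_idem, Function.update_eq_self_iff]
  simp

namespace Store

variable {ι F : Type} [DecidableEq ι]

/-- Replace the contents and the head position of one tape. -/
def put (σ : Store ι F) (i : ι) (l : List Bool) (z : ℤ) : Store ι F :=
  { σ with
    cells := Function.update σ.cells i (wordCells l)
    head := Function.update σ.head i z }

@[simp]
theorem view_put_scan (σ : Store ι F) (i : ι) (l : List Bool) (z : ℤ) :
    (σ.put i l z).view.scan i = wordCells l z := by
  simp [put, view]

/-- The space bound. -/
def Fits (W : ℕ) (σ : Store ι F) : Prop :=
  (∀ i, (σ.head i).natAbs ≤ W) ∧ σ.addr.length ≤ W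

theorem Fits.put {W : ℕ} {σ : Store ι F} (h : σ.Fits W) (i : ι) (l : List Bool) {z : ℤ}
    (hz : z.natAbs ≤ W) : (σ.put i l z).Fits W := by
  refine ⟨fun j => ?_, h.2⟩
  by_cases hj : j = i
  · subst hj
    simpa [Store.put] using hz
  · simpa [Store.put, hj] using h.1 j

end Store

/-! ### Elementary operations on one counter tape -/

namespace Frag

variable {ι F : Type} [DecidableEq ι]

/-- An action on a single tape. -/
def onTape (i : ι) (f : Option Bool → Option Bool × Move) : Frag ι F :=
  step fun v =>
    (.work (Function.update v.scan i (f (v.scan i)).1)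
      (Function.update (fun _ => .stay) i (f (v.scan i)).2), v.ctl)

/-- Move the head of a tape. -/
def shift (i : ι) (m : Move) : Frag ι F := onTape i fun s => (s, m)

/-- Return to the beginning of the word on a tape. -/
def home (i : ι) : Frag ι F :=
  (loop (fun v => (v.scan i).isSome) (shift i .left)).seq (shift i .right)

/-- Increment a counter. -/
def inc (i : ι) : Frag ι F :=
  (loop (fun v => v.scan i == some true) (onTape i fun _ => (some false, .right))).seq
    ((onTape i fun _ => (some true, .left)).seq (home i))

/-- Decrement a counter, unless it is zero. -/
def pred (i : ι) : Frag ι F :=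
  switch (fun v => (v.scan i).isSome) fun b => bif b then
    (loop (fun v => v.scan i == some false) (onTape i fun _ => (some true, .right))).seq
      ((onTape i fun _ => (some false, .right)).seq
        ((switch (fun v => (v.scan i).isSome) fun b => bif b then shift i .left
          else (shift i .left).seq (onTape i fun _ => (none, .left))).seq (home i)))
    else skip

/-- Fetch the input bit whose address is in a counter. -/
def readAt (i : ι) : Frag ι F :=
  (loop (fun v => (v.scan i).isSome) (shift i .right)).seq ((shift i .left).seq
    ((loop (fun v => (v.scan i).isSome)
      ((step fun v => (.address ((v.scan i).getD false), v.ctl)).seq (shift i .left))).seq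
        ((shift i .right).seq (step fun v => (.readInput, v.ctl)))))

variable {x : List Bool} {ro : ℕ → Bool} {P : Store ι F → Prop} {W : ℕ}

theorem runs_onTape {i : ι} {f : Option Bool → Option Bool × Move} {σ : Store ι F}
    {l l' : List Bool} {z z' : ℤ} (h : P (σ.put i l z))
    (hl : Function.update (wordCells l) z (f (wordCells l z)).1 = wordCells l')
    (hz : z + (f (wordCells l z)).2.shift = z') :
    (onTape i f).Runs x ro P (σ.put i l z) (σ.put i l' z') := by
  have := runs_step (x := x) (ro := ro) (fun v : View ι F =>
    (Act.work (Function.update v.scan i (f (v.scan i)).1)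
      (Function.update (fun _ => .stay) i (f (v.scan i)).2), v.ctl)) h
  refine (congrArg (Runs x ro P (onTape i f) (σ.put i l z)) ?_).mp this
  rw [Store.view_put_scan]
  subst hz
  simp only [Store.act, Store.put, Store.view, Store.mk.injEq, true_and, and_true]
  constructor
  · funext j
    by_cases hj : j = i
    · subst hj
      simp [hl]
    · simp [hj]
  · funext j
    by_cases hj : j = i
    · subst hj
      simp
    · simp [hj, Move.shift]

theorem runs_shift {i : ι} {m : Move} {σ : Store ι F} {l : List Bool} {z z' : ℤ}
    (h : P (σ.put i l z)) (hz : z + m.shift = z') :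
    (shift i m).Runs x ro P (σ.put i l z) (σ.put i l z') :=
  runs_onTape h (by simp) hz

/-- The head moves left to the blank cell `-1` and then one cell right. Starting from `z - 1` with
`z` natural includes the case that the head is already at `-1`. -/
theorem runs_home {i : ι} {σ : Store ι F} (hσ : σ.Fits W) {l : List Bool} {z : ℕ}
    (hz : z ≤ l.length) (hW : l.length + 1 ≤ W) :
    (home i).Runs x ro (Store.Fits W) (σ.put i l (z - 1)) (σ.put i l 0) := by
  have := runs_loop (x := x) (ro := ro) (P := Store.Fits W)
    (c := fun v : View ι F => (v.scan i).isSome) (A := shift i .left) z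
    (fun j => σ.put i l (z - 1 - j))
    (fun j hj => hσ.put _ _ (by omega))
    (fun j hj => by
      rw [Store.view_put_scan, show ((z : ℤ) - 1 - j) = ((z - 1 - j : ℕ) : ℤ) by omega]
      simp
      omega)
    (by
      rw [Store.view_put_scan, wordCells_of_neg _ (by omega)]
      rfl)
    (fun j hj => runs_shift (hσ.put _ _ (by omega)) (by simp [Move.shift]; ring))
  refine Runs.seq (σ₂ := σ.put i l (-1)) ?_ (runs_shift (hσ.put _ _ (by simp; omega)) rfl)
  simpa using this

theorem runs_inc {i : ι} {σ : Store ι F} (hσ : σ.Fits W) {v : ℕ}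
    (hW : (v + 1).bits.length + 1 ≤ W) :
    (inc i).Runs x ro (Store.Fits W) (σ.put i v.bits 0) (σ.put i (v + 1).bits 0) := by
  obtain ⟨t, r, h1, h2⟩ := bits_succ v
  rw [h1] at hW
  rw [h1, h2]
  simp only [List.length_append, List.length_replicate, List.length_cons] at hW
  -- What follows the block of ones does not begin with a one, so the carry loop stops after exactly
  -- `t` rounds.
  obtain ⟨r', hr', hr1⟩ : ∃ r', r' = (if r = [] then [] else false :: r) ∧
      r'[0]? ≠ some true := by
    refine ⟨_, rfl, ?_⟩
    split <;> simp
  rw [← hr']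
  have hloop := runs_loop (x := x) (ro := ro) (P := Store.Fits W)
    (c := fun v : View ι F => v.scan i == some true)
    (A := onTape i fun _ => (some false, .right)) t
    (fun j => σ.put i (List.replicate j false ++ (List.replicate (t - j) true ++ r')) j)
    (fun j hj => hσ.put _ _ (by omega))
    (fun j hj => by
      rw [Store.view_put_scan, wordCells_natCast, List.getElem?_append_right (by simp)]
      obtain ⟨d, hd⟩ := Nat.exists_eq_add_of_lt hj
      rw [show t - j = d + 1 by omega]
      simp [List.replicate_succ])
    (by
      rw [Store.view_put_scan, wordCells_natCast, List.getElem?_append_right (by simp)]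
      simpa using hr1)
    (fun j hj => by
      refine runs_onTape (hσ.put _ _ (by omega)) ?_ (by simp [Move.shift])
      obtain ⟨d, hd⟩ := Nat.exists_eq_add_of_lt hj
      have := update_wordCells (List.replicate j false) (List.replicate d true ++ r') true false
      rw [show t - j = d + 1 by omega, show t - (j + 1) = d by omega, List.replicate_succ,
        List.replicate_succ']
      simpa using this)
  simp only [Nat.sub_self, List.replicate_zero, List.nil_append, Nat.cast_zero,
    Nat.sub_zero] at hloop
  refine hloop.seq (Runs.seq (σ₂ := σ.put i (List.replicate t false ++ true :: r) (t - 1))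
    (runs_onTape (hσ.put _ _ (by omega)) ?_ (by simp [Move.shift]; ring)) ?_)
  -- Either the word is extended by a new leading one, or the zero that stopped the carry is
  -- overwritten.
  · rw [hr']
    split_ifs with hr
    · have := update_wordCells_end (List.replicate t false) true
      simpa [hr] using this
    · have := update_wordCells (List.replicate t false) r false true
      simpa using this
  · exact runs_home hσ (by simp) (by simpa using by omega)

theorem runs_pred {i : ι} {σ : Store ι F} (hσ : σ.Fits W) {v : ℕ}
    (hW : v.bits.length + 1 ≤ W) :
    (pred i).Runs x ro (Store.Fits W) (σ.put i v.bits 0) (σ.put i (v - 1).bits 0) := by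
  rcases Nat.eq_zero_or_pos v with rfl | hv
  · refine Runs.switch (hσ.put _ _ (by simp)) ?_
    have : wordCells (Nat.bits 0) 0 = none := rfl
    rw [Store.view_put_scan, this]
    exact runs_skip (hσ.put _ _ (by simp))
  obtain ⟨v, rfl⟩ := Nat.exists_eq_add_of_le' hv
  obtain ⟨t, r, h1, h2⟩ := bits_succ v
  rw [Nat.add_sub_cancel]
  rw [h1] at hW
  rw [h1, h2]
  simp only [List.length_append, List.length_replicate, List.length_cons] at hW
  refine Runs.switch (hσ.put _ _ (by simp)) ?_
  have h0 : (wordCells (List.replicate t false ++ true :: r) 0).isSome = true := by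
    have := wordCells_natCast (List.replicate t false ++ true :: r) 0
    rw [Nat.cast_zero] at this
    rw [this]
    simp
  rw [Store.view_put_scan, h0]
  have hloop := runs_loop (x := x) (ro := ro) (P := Store.Fits W)
    (c := fun v : View ι F => v.scan i == some false)
    (A := onTape i fun _ => (some true, .right)) t
    (fun j => σ.put i (List.replicate j true ++ (List.replicate (t - j) false ++ true :: r)) j)
    (fun j hj => hσ.put _ _ (by omega))
    (fun j hj => by
      rw [Store.view_put_scan, wordCells_natCast, List.getElem?_append_right (by simp)]
      obtain ⟨d, hd⟩ := Nat.exists_eq_add_of_lt hj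
      rw [show t - j = d + 1 by omega]
      simp [List.replicate_succ])
    (by
      rw [Store.view_put_scan, wordCells_natCast, List.getElem?_append_right (by simp)]
      simp)
    (fun j hj => by
      refine runs_onTape (hσ.put _ _ (by omega)) ?_ (by simp [Move.shift])
      obtain ⟨d, hd⟩ := Nat.exists_eq_add_of_lt hj
      have := update_wordCells (List.replicate j true) (List.replicate d false ++ true :: r)
        false true
      rw [show t - j = d + 1 by omega, show t - (j + 1) = d by omega, List.replicate_succ,
        List.replicate_succ']
      simpa using this)
  simp only [Nat.sub_self, List.replicate_zero, List.nil_append, Nat.cast_zero,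
    Nat.sub_zero] at hloop
  refine hloop.seq (Runs.seq
    (σ₂ := σ.put i (List.replicate t true ++ false :: r) ((t + 1 : ℕ) : ℤ))
    (runs_onTape (hσ.put _ _ (by omega)) ?_ (by simp [Move.shift])) ?_)
  · have := update_wordCells (List.replicate t true) r true false
    simpa using this
  have hscan : (wordCells (List.replicate t true ++ false :: r) ((t + 1 : ℕ) : ℤ)) = r[0]? := by
    rw [wordCells_natCast, List.getElem?_append_right (by simp)]
    simp
  have hfit := hσ.put i (List.replicate t true ++ false :: r) (z := ((t + 1 : ℕ) : ℤ))
    (by omega)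
  -- If `r = []`, the digit just cleared was the leading one. It must be erased, since the tape has
  -- to hold `Nat.bits` without leading zeros; this is what makes the blankness of cell `0` a test
  -- for zero.
  split_ifs with hr
  · refine Runs.seq (σ₂ := σ.put i (List.replicate t true) (t - 1)) (Runs.switch hfit ?_) ?_
    · rw [Store.view_put_scan, hscan]
      subst hr
      refine Runs.seq (σ₂ := σ.put i (List.replicate t true ++ [false]) t)
        (runs_shift hfit (by simp [Move.shift])) (runs_onTape (hσ.put _ _ (by omega)) ?_
          (by simp [Move.shift]; ring))
      simpa using update_wordCells_none (List.replicate t true) false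
    · rw [List.append_nil]
      exact runs_home hσ (by simp) (by simpa using by omega)
  · refine Runs.seq (σ₂ := σ.put i (List.replicate t true ++ false :: r) ((t + 1 : ℕ) - 1))
      (Runs.switch hfit ?_) ?_
    · obtain ⟨b, r', rfl⟩ := List.exists_cons_of_ne_nil hr
      rw [Store.view_put_scan, hscan]
      exact runs_shift hfit (by simp [Move.shift])
    · exact runs_home hσ (by simp) (by simpa using by omega)

/-- Walking from the top digit back to cell `0` copies the counter in the digit order of addresses.
The fetch erases the address tape, so that it is empty again afterwards. -/
theorem runs_readAt {i : ι} {σ : Store ι F} (hσ : σ.Fits W) (ha : σ.addr = []) {v : ℕ}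
    (hW : v.bits.length + 1 ≤ W) :
    (readAt i).Runs x ro (Store.Fits W) (σ.put i v.bits 0)
      ({ σ with fetched := x[v]? }.put i v.bits 0) := by
  have he : { σ with addr := [] } = σ := by rw [← ha]
  set l := v.bits with hl
  have hloop := runs_loop (x := x) (ro := ro) (P := Store.Fits W)
    (c := fun v : View ι F => (v.scan i).isSome) (A := shift i .right) l.length
    (fun j => σ.put i l j) (fun j hj => hσ.put _ _ (by omega))
    (fun j hj => by simpa using hj) (by simp)
    (fun j hj => runs_shift (hσ.put _ _ (by omega)) (by simp [Move.shift]))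
  refine Runs.seq hloop (Runs.seq (σ₂ := σ.put i l (l.length - 1))
    (runs_shift (hσ.put _ _ (by omega)) (by simp [Move.shift]; ring)) ?_)
  have hfit : ∀ j ≤ l.length, Store.Fits W
      { σ with addr := (l.drop (l.length - j)).reverse } := fun j hj =>
    ⟨hσ.1, by simp; omega⟩
  -- After `j` rounds the `j` most significant digits have been copied.
  have hloop2 := runs_loop (x := x) (ro := ro) (P := Store.Fits W)
    (c := fun v : View ι F => (v.scan i).isSome)
    (A := (step fun v => (.address ((v.scan i).getD false), v.ctl)).seq (shift i .left)) l.length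
    (fun j => { σ with addr := (l.drop (l.length - j)).reverse }.put i l (l.length - 1 - j))
    (fun j hj => (hfit j hj).put _ _ (by omega))
    (fun j hj => by
      rw [Store.view_put_scan,
        show ((l.length : ℤ) - 1 - j) = ((l.length - 1 - j : ℕ) : ℤ) by omega]
      simp
      omega)
    (by
      rw [Store.view_put_scan, wordCells_of_neg _ (by omega)]
      rfl)
    (fun j hj => by
      refine Runs.seq (runs_step _ ((hfit j hj.le).put _ _ (by omega))) ?_
      have hlt : l.length - (j + 1) < l.length := by omega
      have : ((l.length : ℤ) - 1 - j) = ((l.length - (j + 1) : ℕ) : ℤ) := by omega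
      rw [Store.view_put_scan, this, wordCells_natCast, List.getElem?_eq_getElem hlt,
        Option.getD_some]
      have hd : (l.drop (l.length - (j + 1))).reverse =
          (l.drop (l.length - j)).reverse ++ [l[l.length - (j + 1)]] := by
        rw [List.drop_eq_getElem_cons hlt, List.reverse_cons,
          show l.length - (j + 1) + 1 = l.length - j by omega]
      have := runs_shift (x := x) (ro := ro) (m := .left)
        ((hfit (j + 1) hj).put i l (z := ((l.length - (j + 1) : ℕ) : ℤ)) (by omega))
        (z' := l.length - 1 - (j + 1 : ℕ)) (by simp [Move.shift]; omega)
      rw [hd] at this ⊢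
      exact this)
  simp only [Nat.sub_zero, List.drop_length, List.reverse_nil, Nat.sub_self, List.drop_zero,
    Nat.cast_zero, sub_zero] at hloop2
  rw [he] at hloop2
  refine hloop2.seq ?_
  have hf : Store.Fits W { σ with addr := l.reverse } := ⟨hσ.1, by simp; omega⟩
  refine Runs.seq (σ₂ := { σ with addr := l.reverse }.put i l 0) (runs_shift (hf.put _ _ (by simp; omega)) (by simp [Move.shift])) ?_
  have := runs_step (x := x) (ro := ro) (fun v : View ι F => (.readInput, v.ctl))
    (hf.put i l (z := 0) (by simp))
  convert this using 1
  simp [Store.act, Store.put, Store.view, hl, bitsVal_reverse_bits, ha]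

end Frag

/-! ### Simulation of machines with the help of counters -/

/-- The tapes: those of the simulated machines, and one for each counter. -/
abbrev SimTape (Ms : Bool → RATM) (R : Type) : Type := (Σ b, Fin (Ms b).tapes) ⊕ R

/-- The control data: for each simulated machine its state and the bit it fetched last. -/
abbrev SimCtl (Ms : Bool → RATM) : Type := ∀ b, (Ms b).State × Option Bool

/-- A simulation fragment. -/
abbrev SimFrag (Ms : Bool → RATM) (R : Type) : Type 1 := Frag (SimTape Ms R) (SimCtl Ms)

/-- The memory of the simulation: configurations of the simulated machines, and counters. -/
structure Mem (Ms : Bool → RATM) (R : Type) where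
  vm : ∀ b, (Ms b).Config
  reg : R → ℕ
  fetched : Option Bool
  coins : ℕ
  out : List Bool

namespace Mem

variable {Ms : Bool → RATM} {R : Type}

def toStore (μ : Mem Ms R) : Store (SimTape Ms R) (SimCtl Ms) where
  ctl b := ((μ.vm b).state, (μ.vm b).fetched)
  cells
    | .inl ⟨b, i⟩ => (μ.vm b).cells i
    | .inr r => wordCells (μ.reg r).bits
  head
    | .inl ⟨b, i⟩ => (μ.vm b).head i
    | .inr _ => 0
  addr := []
  fetched := μ.fetched
  coins := μ.coins
  out := μ.out

/-- The simulated machines use space at most `W`, and all counters are bounded by `B`. -/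
def Good (W B : ℕ) (μ : Mem Ms R) : Prop :=
  B.size + 1 ≤ W ∧ (∀ b i, ((μ.vm b).head i).natAbs ≤ W) ∧ ∀ r, μ.reg r ≤ B

theorem Good.fits {W B : ℕ} {μ : Mem Ms R} (h : μ.Good W B) : μ.toStore.Fits W := by
  refine ⟨?_, by simp [toStore]⟩
  rintro (⟨b, i⟩ | r)
  · exact h.2.1 b i
  · simp [toStore]

theorem Good.length_bits {W B : ℕ} {μ : Mem Ms R} (h : μ.Good W B) {v : ℕ} (hv : v ≤ B) :
    v.bits.length + 1 ≤ W := by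
  rw [Nat.size_eq_bits_len]
  exact (Nat.succ_le_succ (Nat.size_le_size hv)).trans h.1

@[simp]
-- The head of a counter rests at cell `0`, which is blank exactly when the binary expansion is
-- empty, that is, for the value zero.
theorem scan_reg (μ : Mem Ms R) (r : R) :
    (μ.toStore.view.scan (.inr r)).isSome = decide (μ.reg r ≠ 0) := by
  have h := wordCells_natCast (μ.reg r).bits 0
  rw [Nat.cast_zero] at h
  change (wordCells (μ.reg r).bits 0).isSome = _
  rw [h, Bool.eq_iff_iff, decide_eq_true_eq, ← Nat.pos_iff_ne_zero, ← Nat.size_pos,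
    ← Nat.size_eq_bits_len]
  simp

variable [DecidableEq R]

/-- The bridge from statements about one tape to statements about counter values. -/
theorem put_toStore (μ : Mem Ms R) (r : R) (v : ℕ) :
    μ.toStore.put (.inr r) v.bits 0 =
      { μ with reg := Function.update μ.reg r v }.toStore := by
  simp only [Store.put, toStore, Store.mk.injEq, true_and, and_true]
  constructor
  · funext i
    rcases i with i | r'
    · simp
    · by_cases h : r' = r
      · subst h
        simp
      · simp [h]
  · funext i
    rcases i with i | r'
    · simp
    · by_cases h : r' = r
      · subst h
        simp
      · simp [h]

end Mem

namespace SimFrag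

variable {Ms : Bool → RATM} {R : Type}

/-- The fragment transforms good memory `μ` into good memory `μ'`. -/
def Trans (x : List Bool) (ro : ℕ → Bool) (W B : ℕ) (A : SimFrag Ms R) (μ μ' : Mem Ms R) : Prop :=
  μ.Good W B → A.Runs x ro (Store.Fits W) μ.toStore μ'.toStore ∧ μ'.Good W B

variable {x : List Bool} {ro : ℕ → Bool} {W B : ℕ} {A A' : SimFrag Ms R} {μ μ₁ μ₂ μ₃ : Mem Ms R}

theorem Trans.seq (h : Trans x ro W B A μ₁ μ₂) (h' : Trans x ro W B A' μ₂ μ₃) :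
    Trans x ro W B (A.seq A') μ₁ μ₃ := fun hg =>
  have h1 := h hg
  have h2 := h' h1.2
  ⟨h1.1.seq h2.1, h2.2⟩

theorem Trans.switch {κ : Type} [Finite κ] {sel : View (SimTape Ms R) (SimCtl Ms) → κ}
    {A : κ → SimFrag Ms R} (h : Trans x ro W B (A (sel μ.toStore.view)) μ μ₁) :
    Trans x ro W B (Frag.switch sel A) μ μ₁ := fun hg =>
  ⟨(h hg).1.switch hg.fits, (h hg).2⟩

theorem trans_skip : Trans x ro W B Frag.skip μ μ := fun hg => ⟨Frag.runs_skip hg.fits, hg⟩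

theorem trans_step (f : View (SimTape Ms R) (SimCtl Ms) → Act (SimTape Ms R) × SimCtl Ms)
    (h : μ.toStore.act x ro (f μ.toStore.view).2 (f μ.toStore.view).1 = μ₁.toStore)
    (hh : ∀ b i, ((μ₁.vm b).head i).natAbs ≤ W) (hr : μ₁.reg = μ.reg) :
    Trans x ro W B (Frag.step f) μ μ₁ := fun hg =>
  ⟨h ▸ Frag.runs_step f hg.fits, hg.1, hh, fun r => hr ▸ hg.2.2 r⟩

/-- Loops with a relational invariant. -/
theorem exists_trans_loop {c : View (SimTape Ms R) (SimCtl Ms) → Bool} (N : ℕ)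
    (I : ℕ → Mem Ms R → Prop) (h0 : I 0 μ)
    (hstep : ∀ i < N, ∀ μ, I i μ → c μ.toStore.view = true ∧
      ∃ μ', I (i + 1) μ' ∧ Trans x ro W B A μ μ')
    (hN : ∀ μ, I N μ → c μ.toStore.view = false) :
    ∃ μ', I N μ' ∧ Trans x ro W B (Frag.loop c A) μ μ' := by
  induction N generalizing I μ with
  | zero => exact ⟨μ, h0, fun hg => ⟨Frag.runs_loop_false hg.fits (hN μ h0), hg⟩⟩
  | succ N ih =>
    obtain ⟨hc, μ₁, h1, ht⟩ := hstep 0 N.succ_pos μ h0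
    obtain ⟨μ₂, h2, ht2⟩ := ih (μ := μ₁) (fun i => I (i + 1)) h1
      (fun i hi => hstep _ (by omega)) hN
    refine ⟨μ₂, h2, fun hg => ?_⟩
    have a := ht hg
    have b := ht2 a.2
    exact ⟨a.1.loop_true hg.fits hc b.1, b.2⟩

theorem trans_loop {c : View (SimTape Ms R) (SimCtl Ms) → Bool} (N : ℕ) (f : ℕ → Mem Ms R)
    (hc : ∀ i < N, c (f i).toStore.view = true) (hN : c (f N).toStore.view = false)
    (hA : ∀ i < N, Trans x ro W B A (f i) (f (i + 1))) :
    Trans x ro W B (Frag.loop c A) (f 0) (f N) := by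
  obtain ⟨μ', rfl, h⟩ := exists_trans_loop (x := x) (ro := ro) (W := W) (B := B) (A := A)
    (c := c) (μ := f 0) N (fun i μ => μ = f i) rfl
    (by rintro i hi _ rfl; exact ⟨hc i hi, _, rfl, hA i hi⟩) (by rintro _ rfl; exact hN)
  exact h

/-! ### Counter programs -/

/-- The fragment transforms the counters as indicated, and nothing else. -/
def RegTrans (x : List Bool) (ro : ℕ → Bool) (W B : ℕ) (A : SimFrag Ms R) (ρ ρ' : R → ℕ) : Prop :=
  ∀ μ : Mem Ms R, μ.reg = ρ → Trans x ro W B A μ { μ with reg := ρ' }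

/-- Iterate as long as a counter is positive. -/
def whilePos (r : R) (A : SimFrag Ms R) : SimFrag Ms R :=
  .loop (fun v => (v.scan (.inr r)).isSome) A

/-- Distinguish whether a counter is positive. -/
def ifPos (r : R) (A A' : SimFrag Ms R) : SimFrag Ms R :=
  .switch (fun v => (v.scan (.inr r)).isSome) fun b => bif b then A else A'

variable {ρ ρ₁ ρ₂ ρ₃ : R → ℕ}

theorem RegTrans.congr (h : RegTrans x ro W B A ρ ρ₁) (h' : ρ₁ = ρ₂) :
    RegTrans x ro W B A ρ ρ₂ := h' ▸ h

theorem RegTrans.seq (h : RegTrans x ro W B A ρ₁ ρ₂) (h' : RegTrans x ro W B A' ρ₂ ρ₃) :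
    RegTrans x ro W B (A.seq A') ρ₁ ρ₃ := fun μ hμ => (h μ hμ).seq (h' _ rfl)

theorem regTrans_skip : RegTrans x ro W B (Frag.skip : SimFrag Ms R) ρ ρ := by
  rintro μ rfl
  exact trans_skip

theorem RegTrans.whilePos (r : R) (N : ℕ) (g : ℕ → R → ℕ) (h0 : g 0 = ρ)
    (hpos : ∀ i < N, g i r ≠ 0) (hN : g N r = 0)
    (hA : ∀ i < N, RegTrans x ro W B A (g i) (g (i + 1))) :
    RegTrans x ro W B (whilePos r A) ρ (g N) := by
  rintro μ hμ
  have := trans_loop (x := x) (ro := ro) (W := W) (B := B) (A := A)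
    (c := fun v => (v.scan (.inr r)).isSome) N (fun i => { μ with reg := g i })
    (fun i hi => by simpa using hpos i hi) (by simpa using hN) (fun i hi => hA i hi _ rfl)
  simp only [h0] at this
  rwa [← hμ] at this

theorem RegTrans.ifPos_pos {r : R} (hr : ρ r ≠ 0) (h : RegTrans x ro W B A ρ ρ₁) :
    RegTrans x ro W B (ifPos r A A') ρ ρ₁ := by
  rintro μ rfl
  refine .switch ?_
  rw [Mem.scan_reg, decide_eq_true hr]
  exact h μ rfl

theorem RegTrans.ifPos_zero {r : R} (hr : ρ r = 0) (h : RegTrans x ro W B A' ρ ρ₁) :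
    RegTrans x ro W B (ifPos r A A') ρ ρ₁ := by
  rintro μ rfl
  refine .switch ?_
  rw [Mem.scan_reg, decide_eq_false (not_not.2 hr)]
  exact h μ rfl

variable [DecidableEq R]

theorem trans_readAt (r : R) :
    Trans x ro W B (Frag.readAt (.inr r)) μ { μ with fetched := x[μ.reg r]? } := by
  intro hg
  refine ⟨?_, hg⟩
  have := Frag.runs_readAt (x := x) (ro := ro) (i := .inr r) hg.fits rfl
    (hg.length_bits (hg.2.2 r))
  rw [Mem.put_toStore, Function.update_eq_self] at this
  have h2 := Mem.put_toStore { μ with fetched := x[μ.reg r]? } r (μ.reg r)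
  simp only [Function.update_eq_self] at h2
  rwa [← h2]

def inc (r : R) : SimFrag Ms R := Frag.inc (.inr r)

def pred (r : R) : SimFrag Ms R := Frag.pred (.inr r)

theorem regTrans_inc (r : R) (h : ρ r < B) :
    RegTrans x ro W B (inc r : SimFrag Ms R) ρ (Function.update ρ r (ρ r + 1)) := by
  rintro μ rfl hg
  have := Frag.runs_inc (x := x) (ro := ro) (i := .inr r) hg.fits
    (hg.length_bits (v := μ.reg r + 1) h)
  rw [Mem.put_toStore, Mem.put_toStore, Function.update_eq_self] at this
  refine ⟨this, hg.1, hg.2.1, fun r' => ?_⟩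
  by_cases hr : r' = r
  · subst hr
    simpa using h
  · simpa [hr] using hg.2.2 r'

theorem regTrans_pred (r : R) :
    RegTrans x ro W B (pred r : SimFrag Ms R) ρ (Function.update ρ r (ρ r - 1)) := by
  rintro μ rfl hg
  have := Frag.runs_pred (x := x) (ro := ro) (i := .inr r) hg.fits
    (hg.length_bits (hg.2.2 r))
  rw [Mem.put_toStore, Mem.put_toStore, Function.update_eq_self] at this
  refine ⟨this, hg.1, hg.2.1, fun r' => ?_⟩
  by_cases hr : r' = r
  · subst hr
    have := hg.2.2 r'
    simpa using by omega
  · simpa [hr] using hg.2.2 r'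

/-- Set a counter to zero. -/
def clear (r : R) : SimFrag Ms R := whilePos r (pred r)

theorem regTrans_clear (r : R) :
    RegTrans x ro W B (clear r : SimFrag Ms R) ρ (Function.update ρ r 0) := by
  refine (RegTrans.whilePos r (ρ r) (fun i => Function.update ρ r (ρ r - i)) (by simp)
    (fun i hi => by simpa using by omega) (by simp)
    fun i hi => (regTrans_pred r).congr (by simp [Nat.sub_sub])).congr (by simp)

/-- Add the counter `r` to the counter `s`, with the help of the counter `z`. -/
def addTo (z r s : R) : SimFrag Ms R :=
  (whilePos r ((pred r).seq ((inc s).seq (inc z)))).seq (whilePos z ((pred z).seq (inc r)))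

/-- Subtract the counter `r` from the counter `s`, with the help of the counter `z`. -/
def subFrom (z r s : R) : SimFrag Ms R :=
  (whilePos r ((pred r).seq ((pred s).seq (inc z)))).seq (whilePos z ((pred z).seq (inc r)))

/-- Double the counter `r` and add a bit, with the help of the counter `z`. -/
def double (z r : R) (b : Bool) : SimFrag Ms R :=
  (whilePos r ((pred r).seq (inc z))).seq
    ((whilePos z ((pred z).seq ((inc r).seq (inc r)))).seq (bif b then inc r else Frag.skip))

/-- The restoring phase shared by addition and subtraction; with the roles of `z` and `r` exchanged
it is also the first phase of doubling. -/
theorem regTrans_moveBack {z r : R} (hzr : z ≠ r) (hr : ρ r + ρ z ≤ B) :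
    RegTrans x ro W B (whilePos z ((pred z).seq (inc r)) : SimFrag Ms R) ρ
      (Function.update (Function.update ρ r (ρ r + ρ z)) z 0) := by
  refine (RegTrans.whilePos z (ρ z)
    (fun i => Function.update (Function.update ρ r (ρ r + i)) z (ρ z - i)) (by simp)
    (fun i hi => by simpa using by omega) (by simp)
    fun i hi => ((regTrans_pred z).seq (regTrans_inc r ?_)).congr ?_).congr (by simp)
  · simpa [hzr.symm] using by omega
  · funext y
    by_cases h1 : y = z
    · subst h1
      simp [hzr]
      omega
    · by_cases h2 : y = r
      · subst h2
        simp [h1]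
        omega
      · simp [h1, h2]

/-- A counter can only be used up by counting it down, so its value is saved in `z` and restored.
After `i` rounds `r` has lost `i`, and both `s` and `z` have gained `i`. -/
theorem regTrans_addTo {z r s : R} (hzr : z ≠ r) (hzs : z ≠ s) (hrs : r ≠ s) (hz : ρ z = 0)
    (hr : ρ r ≤ B) (hs : ρ s + ρ r ≤ B) :
    RegTrans x ro W B (addTo z r s : SimFrag Ms R) ρ (Function.update ρ s (ρ s + ρ r)) := by
  refine RegTrans.seq (RegTrans.whilePos r (ρ r) (fun i => Function.update (Function.update
    (Function.update ρ s (ρ s + i)) z i) r (ρ r - i)) (by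
      simp only [Nat.add_zero, Nat.sub_zero, Function.update_eq_self]
      rw [← hz]
      simp)
    (fun i hi => by simpa using by omega) (by simp)
    fun i hi => ((regTrans_pred r).seq ((regTrans_inc s ?_).seq (regTrans_inc z ?_))).congr ?_)
    ((regTrans_moveBack hzr ?_).congr ?_)
  · simpa [hrs, hrs.symm, hzs.symm] using by omega
  · simpa [hrs, hzr, hzs] using by omega
  · funext y
    by_cases h1 : y = r
    · subst h1
      simp [hzr.symm, hrs]
      omega
    · by_cases h2 : y = z
      · subst h2
        simp [h1, hzs]
      · by_cases h3 : y = s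
        · subst h3
          simp [h1, h2]
          omega
        · simp [h1, h2, h3]
  · simpa [hzr] using hr
  · funext y
    by_cases h1 : y = r
    · subst h1
      simp [hzr, hzr.symm, hrs]
    · by_cases h2 : y = z
      · subst h2
        simp [hzs, hz]
      · by_cases h3 : y = s
        · subst h3
          simp [h1, h2]
        · simp [h1, h2, h3]

/-- Decrementing stops at zero, so this is truncated subtraction, and no inequality between the two
counters is required. Followed by a test for zero it serves as a comparison. -/
theorem regTrans_subFrom {z r s : R} (hzr : z ≠ r) (hzs : z ≠ s) (hrs : r ≠ s) (hz : ρ z = 0)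
    (hr : ρ r ≤ B) :
    RegTrans x ro W B (subFrom z r s : SimFrag Ms R) ρ (Function.update ρ s (ρ s - ρ r)) := by
  refine RegTrans.seq (RegTrans.whilePos r (ρ r) (fun i => Function.update (Function.update
    (Function.update ρ s (ρ s - i)) z i) r (ρ r - i)) (by
      simp only [Nat.sub_zero, Function.update_eq_self]
      rw [← hz]
      simp)
    (fun i hi => by simpa using by omega) (by simp)
    fun i hi => ((regTrans_pred r).seq ((regTrans_pred s).seq (regTrans_inc z ?_))).congr ?_)
    ((regTrans_moveBack hzr ?_).congr ?_)
  · simpa [hrs, hzr, hzs] using by omega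
  · funext y
    by_cases h1 : y = r
    · subst h1
      simp [hzr.symm, hrs]
      omega
    · by_cases h2 : y = z
      · subst h2
        simp [h1, hzs]
      · by_cases h3 : y = s
        · subst h3
          simp [h1, h2]
          omega
        · simp [h1, h2, h3]
  · simpa [hzr] using hr
  · funext y
    by_cases h1 : y = r
    · subst h1
      simp [hzr, hzr.symm, hrs]
    · by_cases h2 : y = z
      · subst h2
        simp [hzs, hz]
      · by_cases h3 : y = s
        · subst h3
          simp [h1, h2]
        · simp [h1, h2, h3]

theorem regTrans_double {z r : R} (hzr : z ≠ r) (hz : ρ z = 0) (b : Bool)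
    (hr : 2 * ρ r + b.toNat ≤ B) :
    RegTrans x ro W B (double z r b : SimFrag Ms R) ρ
      (Function.update ρ r (2 * ρ r + b.toNat)) := by
  have hmove := regTrans_moveBack (x := x) (ro := ro) (W := W) (B := B) (Ms := Ms) (ρ := ρ)
    hzr.symm (by omega)
  refine RegTrans.seq hmove (RegTrans.seq (ρ₂ := Function.update ρ r (2 * ρ r)) ?_ ?_)
  · refine (RegTrans.whilePos z (ρ r)
      (fun i => Function.update (Function.update ρ r (2 * i)) z (ρ r - i)) ?_
      (fun i hi => by simpa using by omega) (by simp)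
      fun i hi => ((regTrans_pred z).seq ((regTrans_inc r ?_).seq (regTrans_inc r ?_))).congr
        ?_).congr ?_
    · funext y
      by_cases h1 : y = z
      · subst h1
        simp [hzr, hz]
      · by_cases h2 : y = r
        · subst h2
          simp [hzr.symm]
        · simp [h1, h2]
    · simpa [hzr.symm] using by omega
    · simpa [hzr.symm] using by omega
    · funext y
      by_cases h1 : y = z
      · subst h1
        simp [hzr]
        omega
      · by_cases h2 : y = r
        · subst h2
          simp [hzr.symm]
          omega
        · simp [h1, h2]
    · funext y
      by_cases h1 : y = z
      · subst h1
        simp [hzr, hz]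
      · simp [h1]
  · cases b
    · exact regTrans_skip.congr (by simp)
    · exact (regTrans_inc r (by simpa using hr)).congr (by simp)

end SimFrag

/-! ### Interpreting the instructions of a simulated machine -/

/-- The kind of an instruction. -/
inductive InstrKind where
  | work
  | address (b : Bool)
  | readInput
  | readRandom
  | flip
  | emit (b : Bool)
  | halt
  deriving DecidableEq, Fintype

namespace Instr

variable {t : ℕ} {Q : Type}

def kind : Instr t Q → InstrKind
  | .work _ _ _ => .work
  | .address b _ => .address b
  | .readInput _ => .readInput
  | .readRandom _ => .readRandom
  | .flip _ => .flip
  | .emit b _ => .emit b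
  | .halt => .halt

/-- The next state, or `q₀` if there is none. -/
def next (q₀ : Q) : Instr t Q → Q
  | .work _ _ q => q
  | .address _ q => q
  | .readInput q => q
  | .readRandom q => q
  | .flip q => q
  | .emit _ q => q
  | .halt => q₀

/-- The effect of an instruction on the work tapes. -/
def onTapes (s : Fin t → Option Bool) : Instr t Q → Fin t → Option Bool × Move
  | .work w mv _ => fun i => (w i, mv i)
  | _ => fun i => (s i, .stay)

end Instr

namespace SimFrag

variable {Ms : Bool → RATM} {R : Type}

/-- The instruction to be simulated next. -/
def vmInstr (b : Bool) (v : View (SimTape Ms R) (SimCtl Ms)) :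
    Instr (Ms b).tapes (Ms b).State :=
  (Ms b).δ (v.ctl b).1 (fun i => v.scan (.inl ⟨b, i⟩)) (v.ctl b).2

/-- Change the control data of one of the simulated machines. -/
def setCtl (b : Bool)
    (f : View (SimTape Ms R) (SimCtl Ms) → (Ms b).State × Option Bool) : SimFrag Ms R :=
  .step fun v => (v.noop, Function.update v.ctl b (f v))

/-- Go to the next state of a simulated machine. -/
def goNext (b : Bool) : SimFrag Ms R :=
  setCtl b fun v => ((vmInstr b v).next (v.ctl b).1, (v.ctl b).2)

/-- Simulate a step on the work tapes. -/
def workStep (b : Bool) : SimFrag Ms R :=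
  .step fun v =>
    let d := (vmInstr b v).onTapes fun i => v.scan (.inl ⟨b, i⟩)
    (.work
      (Sum.elim (fun s => if h : s.1 = b then (d (h ▸ s.2)).1 else v.scan (.inl s))
        fun r => v.scan (.inr r))
      (Sum.elim (fun s => if h : s.1 = b then (d (h ▸ s.2)).2 else .stay) fun _ => .stay),
     Function.update v.ctl b ((vmInstr b v).next (v.ctl b).1, (v.ctl b).2))

/-- Simulate a step of the machine `Ms b`, where the counter `a` holds the address, and procedures
for reading the input and the multiple access random string and for the output are given. -/
def simStep (b : Bool) (addr : Bool → SimFrag Ms R) (rdInput rdRandom : SimFrag Ms R)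
    (emit : Bool → SimFrag Ms R) : SimFrag Ms R :=
  .switch (fun v => (vmInstr b v).kind) fun
    | .work => workStep b
    | .address c => (goNext b).seq (addr c)
    | .readInput => (goNext b).seq rdInput
    | .readRandom => (goNext b).seq rdRandom
    | .flip => (goNext b).seq ((Frag.step fun v => (.flip, v.ctl)).seq
        (setCtl b fun v => ((v.ctl b).1, v.fetched)))
    | .emit c => (goNext b).seq (emit c)
    | .halt => .skip

/-- Simulate the machine `Ms b` until it terminates. -/
def simulate (b : Bool) (addr : Bool → SimFrag Ms R) (rdInput rdRandom : SimFrag Ms R)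
    (emit : Bool → SimFrag Ms R) : SimFrag Ms R :=
  .loop (fun v => decide ((vmInstr b v).kind ≠ .halt)) (simStep b addr rdInput rdRandom emit)

variable {x : List Bool} {ro : ℕ → Bool} {W B : ℕ} {μ : Mem Ms R}

theorem vmInstr_toStore (b : Bool) (μ : Mem Ms R) :
    vmInstr b μ.toStore.view = (Ms b).instr (μ.vm b) := rfl

/-- The store keeps only the state, the fetched bit, the cells and the heads of a simulated machine.
The address, the coin count and the output of `c` are therefore unconstrained. -/
theorem trans_setCtl {b : Bool}
    {f : View (SimTape Ms R) (SimCtl Ms) → (Ms b).State × Option Bool} (c : (Ms b).Config)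
    (hcells : c.cells = (μ.vm b).cells) (hhead : c.head = (μ.vm b).head)
    (hf : f μ.toStore.view = (c.state, c.fetched)) :
    Trans x ro W B (setCtl b f) μ { μ with vm := Function.update μ.vm b c } := by
  intro hg
  refine trans_step _ ?_ (fun b' i => ?_) rfl hg
  · rw [Store.act_noop]
    simp only [Mem.toStore, Store.mk.injEq, and_true]
    refine ⟨?_, ?_, ?_⟩
    · funext b'
      by_cases h : b' = b
      · subst h
        rw [Function.update_self, Function.update_self]
        exact hf
      · simp [h, Store.view]
    · funext i
      rcases i with ⟨b', i⟩ | r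
      · by_cases h : b' = b
        · subst h
          simp [hcells]
        · simp [h]
      · rfl
    · funext i
      rcases i with ⟨b', i⟩ | r
      · by_cases h : b' = b
        · subst h
          simp [hhead]
        · simp [h]
      · rfl
  · by_cases h : b' = b
    · subst h
      simpa [hhead] using hg.2.1 b' i
    · simpa [h] using hg.2.1 b' i

theorem trans_workStep {b : Bool} {w : Fin (Ms b).tapes → Option Bool}
    {mv : Fin (Ms b).tapes → Move} {q : (Ms b).State} {x' : List Bool} {ro' ma' : ℕ → Bool}
    (h : (Ms b).instr (μ.vm b) = .work w mv q)
    (hW : ∀ i, (((Ms b).step x' ro' ma' (μ.vm b)).head i).natAbs ≤ W) :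
    Trans x ro W B (workStep b) μ
      { μ with vm := Function.update μ.vm b ((Ms b).step x' ro' ma' (μ.vm b)) } := by
  intro hg
  have hs : (Ms b).step x' ro' ma' (μ.vm b) = { μ.vm b with
      state := q
      cells := fun i => Function.update ((μ.vm b).cells i) ((μ.vm b).head i) (w i)
      head := fun i => (μ.vm b).head i + (mv i).shift } := by
    rw [RATM.step, h]
  refine trans_step _ ?_ (fun b' i => ?_) rfl hg
  · simp only [vmInstr_toStore, h, hs, Instr.onTapes, Instr.next]
    simp only [Mem.toStore, Store.act, Store.mk.injEq, and_true]
    refine ⟨?_, ?_, ?_⟩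
    · funext b'
      by_cases h : b' = b
      · subst h
        simp [Store.view]
      · simp [h, Store.view]
    · funext i
      rcases i with ⟨b', i⟩ | r
      · by_cases h : b' = b
        · subst h
          simp
        · simp [h, Store.view]
      · simp [Store.view]
    · funext i
      rcases i with ⟨b', i⟩ | r
      · by_cases h : b' = b
        · subst h
          simp
        · simp [h, Move.shift]
      · simp [Move.shift]
  · by_cases h : b' = b
    · subst h
      simpa using hW i
    · simpa [h] using hg.2.1 b' i

/-- The memory during the simulation of `Ms b`: the other machine is not touched, and the counters
and the output are functions of the address and the output of the simulated machine. -/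
def simMem (vm : ∀ b, (Ms b).Config) (b : Bool) (reg : List Bool → List Bool → R → ℕ)
    (out : List Bool → List Bool) (c : (Ms b).Config) (f : Option Bool) : Mem Ms R where
  vm := Function.update vm b c
  reg := reg c.addr c.out
  fetched := f
  coins := c.coins
  out := out c.out

variable {b : Bool} {addr : Bool → SimFrag Ms R} {rdInput rdRandom : SimFrag Ms R}
  {emit : Bool → SimFrag Ms R} {vm : ∀ b, (Ms b).Config}
  {reg : List Bool → List Bool → R → ℕ} {out : List Bool → List Bool} {x' : List Bool}
  {ma' : ℕ → Bool} {L : ℕ}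

theorem vmInstr_simMem (c : (Ms b).Config) (f : Option Bool) :
    vmInstr b (simMem vm b reg out c f).toStore.view = (Ms b).instr c := by
  rw [vmInstr_toStore]
  simp [simMem]

theorem trans_goNext (c : (Ms b).Config) (f : Option Bool) :
    Trans x ro W B (goNext b) (simMem vm b reg out c f)
      (simMem vm b reg out { c with state := ((Ms b).instr c).next c.state } f) := by
  have := trans_setCtl (x := x) (ro := ro) (W := W) (B := B) (μ := simMem vm b reg out c f)
    (f := fun v => ((vmInstr b v).next (v.ctl b).1, (v.ctl b).2))
    { c with state := ((Ms b).instr c).next c.state } (by simp [simMem]) (by simp [simMem])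
    (by
      simp only [vmInstr_simMem]
      simp [simMem, Store.view, Mem.toStore])
  simp only [simMem, Function.update_idem] at this
  exact this

/-- Each subroutine only has to reproduce the effect of its instruction on `simMem`. The bit last
fetched by the simulator itself is scratch data, hence the existential `f'`. Coin counts are shared,
so the simulated machine reads the very same read-once string. -/
theorem exists_trans_simStep
    (haddr : ∀ (c : (Ms b).Config) (f : Option Bool) (d : Bool), c.addr.length < L →
      ∃ f', Trans x ro W B (addr d) (simMem vm b reg out c f)
        (simMem vm b reg out { c with addr := c.addr ++ [d] } f'))
    (hinput : ∀ (c : (Ms b).Config) (f : Option Bool), c.addr.length ≤ L →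
      ∃ f', Trans x ro W B rdInput (simMem vm b reg out c f)
        (simMem vm b reg out { c with fetched := x'[bitsVal c.addr]?, addr := [] } f'))
    (hrandom : (Ms b).NoMultipleAccess ∨
      ∀ (c : (Ms b).Config) (f : Option Bool), c.addr.length ≤ L →
      ∃ f', Trans x ro W B rdRandom (simMem vm b reg out c f)
        (simMem vm b reg out { c with fetched := some (ma' (bitsVal c.addr)), addr := [] } f'))
    (hemit : ∀ (c : (Ms b).Config) (f : Option Bool) (d : Bool),
      ∃ f', Trans x ro W B (emit d) (simMem vm b reg out c f)
        (simMem vm b reg out { c with out := c.out ++ [d] } f'))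
    (c : (Ms b).Config) (f : Option Bool) (hL : c.addr.length ≤ L)
    (hL' : ((Ms b).step x' ro ma' c).addr.length ≤ L)
    (hW : ∀ i, (((Ms b).step x' ro ma' c).head i).natAbs ≤ W) :
    ∃ f', Trans x ro W B (simStep b addr rdInput rdRandom emit) (simMem vm b reg out c f)
      (simMem vm b reg out ((Ms b).step x' ro ma' c) f') := by
  have hnext := trans_goNext (x := x) (ro := ro) (W := W) (B := B) (vm := vm) (reg := reg)
    (out := out) c f
  -- Resolves the case distinction of `simStep` once, so that each case below only treats its own
  -- branch.
  have hk : ∀ {f'}, Trans x ro W B (match ((Ms b).instr c).kind with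
      | .work => workStep b
      | .address c => (goNext b).seq (addr c)
      | .readInput => (goNext b).seq rdInput
      | .readRandom => (goNext b).seq rdRandom
      | .flip => (goNext b).seq ((Frag.step fun v => (.flip, v.ctl)).seq
          (setCtl b fun v => ((v.ctl b).1, v.fetched)))
      | .emit c => (goNext b).seq (emit c)
      | .halt => .skip) (simMem vm b reg out c f)
        (simMem vm b reg out ((Ms b).step x' ro ma' c) f') →
      ∃ f', Trans x ro W B (simStep b addr rdInput rdRandom emit) (simMem vm b reg out c f)
        (simMem vm b reg out ((Ms b).step x' ro ma' c) f') := by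
    intro f' h
    refine ⟨f', .switch ?_⟩
    rw [vmInstr_simMem]
    exact h
  cases h : (Ms b).instr c with
  | work w mv q =>
    rw [h] at hk
    refine hk (f' := f) ?_
    have := trans_workStep (x := x) (ro := ro) (W := W) (B := B) (μ := simMem vm b reg out c f)
      (b := b) (x' := x') (ro' := ro) (ma' := ma') (w := w) (mv := mv) (q := q)
      (by simpa [simMem] using h) (by simpa [simMem] using hW)
    have hs : ((Ms b).step x' ro ma' c).addr = c.addr ∧ ((Ms b).step x' ro ma' c).out = c.out ∧
        ((Ms b).step x' ro ma' c).coins = c.coins := by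
      simp [RATM.step, h]
    simp only [simMem, Function.update_idem, Function.update_self] at this ⊢
    rw [hs.1, hs.2.1, hs.2.2]
    exact this
  | address d q =>
    rw [h] at hk hnext
    have hs : (Ms b).step x' ro ma' c = { c with state := q, addr := c.addr ++ [d] } := by
      simp [RATM.step, h]
    rw [hs] at hL' hk ⊢
    obtain ⟨f', hf⟩ := haddr { c with state := q } f d (by simpa using hL')
    exact hk (hnext.seq hf)
  | readInput q =>
    rw [h] at hk hnext
    obtain ⟨f', hf⟩ := hinput { c with state := q } f hL
    refine hk (f' := f') (hnext.seq ?_)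
    have hs : (Ms b).step x' ro ma' c =
        { c with state := q, fetched := x'[bitsVal c.addr]?, addr := [] } := by
      simp [RATM.step, h]
    rw [hs]
    exact hf
  | readRandom q =>
    rw [h] at hk hnext
    rcases hrandom with hno | hrandom
    · exact absurd h (hno _ _ _ _)
    obtain ⟨f', hf⟩ := hrandom { c with state := q } f hL
    refine hk (f' := f') (hnext.seq ?_)
    have hs : (Ms b).step x' ro ma' c =
        { c with state := q, fetched := some (ma' (bitsVal c.addr)), addr := [] } := by
      simp [RATM.step, h]
    rw [hs]
    exact hf
  | flip q =>
    rw [h] at hk hnext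
    have hs : (Ms b).step x' ro ma' c =
        { c with state := q, fetched := some (ro c.coins), coins := c.coins + 1 } := by
      simp [RATM.step, h]
    rw [hs] at hk ⊢
    refine hk (f' := some (ro c.coins)) fun hg => (hnext.seq (Trans.seq
      (μ₂ := { simMem vm b reg out { c with state := q } (some (ro c.coins)) with
        coins := c.coins + 1 })
      (trans_step _ rfl ?_ rfl) ?_)) hg
    · exact (hnext hg).2.2.1
    · have := trans_setCtl (x := x) (ro := ro) (W := W) (B := B)
        (μ := { simMem vm b reg out { c with state := q } (some (ro c.coins)) with
          coins := c.coins + 1 }) (f := fun v => ((v.ctl b).1, v.fetched))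
        { c with state := q, fetched := some (ro c.coins), coins := c.coins + 1 }
        (by simp [simMem]) (by simp [simMem])
        (by simp [simMem, Store.view, Mem.toStore])
      simpa [simMem] using this
  | emit d q =>
    rw [h] at hk hnext
    have hs : (Ms b).step x' ro ma' c = { c with state := q, out := c.out ++ [d] } := by
      simp [RATM.step, h]
    rw [hs] at hk ⊢
    obtain ⟨f', hf⟩ := hemit { c with state := q } f d
    exact hk (hnext.seq hf)
  | halt =>
    rw [h] at hk
    rw [RATM.step_of_halt h] at hk ⊢
    exact hk (f' := f) trans_skip

/-- The loop makes as many rounds as the simulated machine makes steps before its first halting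
configuration. -/
theorem exists_trans_simulate
    (haddr : ∀ (c : (Ms b).Config) (f : Option Bool) (d : Bool), c.addr.length < L →
      ∃ f', Trans x ro W B (addr d) (simMem vm b reg out c f)
        (simMem vm b reg out { c with addr := c.addr ++ [d] } f'))
    (hinput : ∀ (c : (Ms b).Config) (f : Option Bool), c.addr.length ≤ L →
      ∃ f', Trans x ro W B rdInput (simMem vm b reg out c f)
        (simMem vm b reg out { c with fetched := x'[bitsVal c.addr]?, addr := [] } f'))
    (hrandom : (Ms b).NoMultipleAccess ∨
      ∀ (c : (Ms b).Config) (f : Option Bool), c.addr.length ≤ L →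
      ∃ f', Trans x ro W B rdRandom (simMem vm b reg out c f)
        (simMem vm b reg out { c with fetched := some (ma' (bitsVal c.addr)), addr := [] } f'))
    (hemit : ∀ (c : (Ms b).Config) (f : Option Bool) (d : Bool),
      ∃ f', Trans x ro W B (emit d) (simMem vm b reg out c f)
        (simMem vm b reg out { c with out := c.out ++ [d] } f'))
    (hL : ∀ j, ((Ms b).conf x' ro ma' j).addr.length ≤ L)
    (hW : ∀ j i, (((Ms b).conf x' ro ma' j).head i).natAbs ≤ W)
    (hhalt : ∃ j, (Ms b).instr ((Ms b).conf x' ro ma' j) = .halt) (f : Option Bool) :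
    ∃ N f', (Ms b).instr ((Ms b).conf x' ro ma' N) = .halt ∧
      Trans x ro W B (simulate b addr rdInput rdRandom emit) (simMem vm b reg out (Ms b).init f)
        (simMem vm b reg out ((Ms b).conf x' ro ma' N) f') := by
  classical
  have hkind : ∀ c : (Ms b).Config, ((Ms b).instr c).kind = .halt ↔ (Ms b).instr c = .halt := by
    intro c
    cases (Ms b).instr c <;> simp [Instr.kind]
  obtain ⟨μ', ⟨f', rfl⟩, hN⟩ := exists_trans_loop (x := x) (ro := ro) (W := W) (B := B)
    (A := simStep b addr rdInput rdRandom emit)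
    (c := fun v => decide ((vmInstr b v).kind ≠ .halt))
    (μ := simMem vm b reg out (Ms b).init f) (Nat.find hhalt)
    (fun j μ => ∃ f', μ = simMem vm b reg out ((Ms b).conf x' ro ma' j) f') ⟨f, rfl⟩
    (by
      rintro j hj _ ⟨f', rfl⟩
      refine ⟨?_, ?_⟩
      · rw [vmInstr_simMem]
        simpa [hkind] using Nat.find_min hhalt hj
      · have h1 := hL (j + 1)
        have h2 := hW (j + 1)
        rw [RATM.conf_succ] at h1 h2
        obtain ⟨f'', hf⟩ := exists_trans_simStep haddr hinput hrandom hemit _ f' (hL j) h1 h2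
        exact ⟨_, ⟨f'', by rw [RATM.conf_succ]⟩, hf⟩)
    (by
      rintro _ ⟨f', rfl⟩
      rw [vmInstr_simMem]
      simpa [hkind] using Nat.find_spec hhalt)
  exact ⟨_, f', Nat.find_spec hhalt, hN⟩

end SimFrag

/-! ### The reduction program -/

/-- The counters of the reduction: the parameters `n`, `k`, `m` and `v = n - m`, the length `g` of
the encoding of the pair of parameters, the length `h` of the simulated input, the number `w` of
pairs among the first `v` vertices, the simulated address `a`, and auxiliary counters. -/
inductive Counter where
  | n | k | g | m | v | h | w | a | p | q | c | j | z
  deriving DecidableEq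

instance : Fintype Counter where
  elems := {.n, .k, .g, .m, .v, .h, .w, .a, .p, .q, .c, .j, .z}
  complete y := by cases y <;> decide

/-- Counter contents. -/
def file (n k g m v h w a p q c j : ℕ) : Counter → ℕ
  | .n => n
  | .k => k
  | .g => g
  | .m => m
  | .v => v
  | .h => h
  | .w => w
  | .a => a
  | .p => p
  | .q => q
  | .c => c
  | .j => j
  | .z => 0

/-- The successor in the enumeration `(1, 0), (2, 0), (2, 1), (3, 0), …` of the pairs `(j, i)`
with `i < j`. -/
def triNext (s : ℕ × ℕ) : ℕ × ℕ := if s.2 + 1 = s.1 then (s.1 + 1, 0) else (s.1, s.2 + 1)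

/-- The enumeration of the pairs `(j, i)` with `i < j`. -/
def tri (t : ℕ) : ℕ × ℕ := triNext^[t] (1, 0)

theorem tri_succ (t : ℕ) : tri (t + 1) = triNext (tri t) := Function.iterate_succ_apply' _ _ _

/-- The pair `(j, i)` has number `C(j,2) + i`; passing from `j` to `j + 1` is Pascal's rule
`C(j+1,2) = j + C(j,2)`. Hence the pairs among the first `v` vertices are those numbered below
`C(v,2)`. -/
theorem tri_spec (t : ℕ) : (tri t).2 < (tri t).1 ∧ (tri t).1.choose 2 + (tri t).2 = t := by
  induction t with
  | zero => simp [tri]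
  | succ t ih =>
    rw [tri_succ, triNext]
    split_ifs with h
    · have := Nat.choose_succ_succ (tri t).1 1
      simp only [Nat.choose_one_right, Nat.succ_eq_add_one, Nat.reduceAdd] at this
      simp only
      omega
    · simp only
      omega

theorem tri_fst_le (t : ℕ) : (tri t).1 ≤ t + 1 := by
  induction t with
  | zero => simp [tri]
  | succ t ih =>
    rw [tri_succ, triNext]
    split_ifs <;> simp only <;> omega

/-- The input `(n - m, k, G')` of the simulated machine, where `G'` is the graph on the first
`v = n - m` vertices; `g = v + k + 2`. -/
def subInput (x : List Bool) (g m v : ℕ) : List Bool :=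
  List.ofFn fun a : Fin (g + v * v) => x[(a + m + ((a - g) / v) * m : ℕ)]?.getD false

/-- The multiple access random string of the simulated machine: the adjacency bits of the pairs
after the first `w`, where `e` is the length of the encoding of the pair of parameters. -/
def subRandom (x : List Bool) (n e w : ℕ) (a : ℕ) : Bool :=
  x[e + (tri (a + w)).1 * n + (tri (a + w)).2]?.getD false

namespace SimFrag

variable {Ms : Bool → RATM} {x : List Bool} {ro : ℕ → Bool} {W B : ℕ}

abbrev add (r s : Counter) : SimFrag Ms Counter := addTo .z r s

abbrev sub (r s : Counter) : SimFrag Ms Counter := subFrom .z r s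

section

variable {A A' : SimFrag Ms Counter} {ρ ρ' : Counter → ℕ} {μ μ' : Mem Ms Counter}

theorem regTrans_add {r s : Counter} (hB : ρ s + ρ r ≤ B)
    (h' : Function.update ρ s (ρ s + ρ r) = ρ') (hz : ρ .z = 0 := by rfl)
    (h : r ≠ .z ∧ s ≠ .z ∧ r ≠ s := by decide) :
    RegTrans x ro W B (add r s : SimFrag Ms Counter) ρ ρ' :=
  (regTrans_addTo h.1.symm h.2.1.symm h.2.2 hz (by omega) hB).congr h'

theorem regTrans_sub {r s : Counter} (hB : ρ r ≤ B)
    (h' : Function.update ρ s (ρ s - ρ r) = ρ') (hz : ρ .z = 0 := by rfl)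
    (h : r ≠ .z ∧ s ≠ .z ∧ r ≠ s := by decide) :
    RegTrans x ro W B (sub r s : SimFrag Ms Counter) ρ ρ' :=
  (regTrans_subFrom h.1.symm h.2.1.symm h.2.2 hz hB).congr h'

theorem RegTrans.inc {r : Counter} (hB : ρ r < B) (h : Function.update ρ r (ρ r + 1) = ρ') :
    RegTrans x ro W B (inc r : SimFrag Ms Counter) ρ ρ' :=
  h ▸ regTrans_inc r hB

theorem RegTrans.pred {r : Counter} (h : Function.update ρ r (ρ r - 1) = ρ') :
    RegTrans x ro W B (pred r : SimFrag Ms Counter) ρ ρ' :=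
  h ▸ regTrans_pred r

theorem RegTrans.clear {r : Counter} (h : Function.update ρ r 0 = ρ') :
    RegTrans x ro W B (clear r : SimFrag Ms Counter) ρ ρ' :=
  h ▸ regTrans_clear r

theorem RegTrans.double {r : Counter} (b : Bool) (hB : 2 * ρ r + b.toNat ≤ B)
    (h : Function.update ρ r (2 * ρ r + b.toNat) = ρ') (hz : ρ .z = 0 := by rfl)
    (hr : .z ≠ r := by decide) :
    RegTrans x ro W B (double .z r b : SimFrag Ms Counter) ρ ρ' :=
  h ▸ regTrans_double hr hz b hB

theorem RegTrans.loop {r : Counter} (N : ℕ) (f : ℕ → Counter → ℕ) (h₀ : f 0 = ρ) (h : f N = ρ')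
    (hpos : ∀ i < N, f i r ≠ 0) (hzero : f N r = 0)
    (hA : ∀ i < N, RegTrans x ro W B A (f i) (f (i + 1))) :
    RegTrans x ro W B (SimFrag.whilePos r A) ρ ρ' :=
  h ▸ RegTrans.whilePos r N f h₀ hpos hzero hA

theorem trans_ifPos_pos {r : Counter} (hr : μ.reg r ≠ 0) (h : Trans x ro W B A μ μ') :
    Trans x ro W B (ifPos r A A') μ μ' := by
  refine .switch ?_
  rw [Mem.scan_reg, decide_eq_true hr]
  exact h

theorem trans_ifPos_zero {r : Counter} (hr : μ.reg r = 0) (h : Trans x ro W B A' μ μ') :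
    Trans x ro W B (ifPos r A A') μ μ' := by
  refine .switch ?_
  rw [Mem.scan_reg, decide_eq_false (not_not.2 hr)]
  exact h

end

/-! #### Reading the parameters -/

/-- Count the ones of the input from the position `r` on. -/
def countOnes (r s : Counter) : SimFrag Ms Counter :=
  (Frag.readAt (.inr r)).seq (.loop (fun v => v.fetched == some true)
    ((inc s).seq ((inc r).seq (Frag.readAt (.inr r)))))

theorem trans_countOnes {r s : Counter} (hrs : r ≠ s) {μ : Mem Ms Counter} (N : ℕ)
    (hN : ∀ i < N, x[μ.reg r + i]? = some true) (hN' : x[μ.reg r + N]? ≠ some true)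
    (hr : μ.reg r + N ≤ B) (hs : μ.reg s + N ≤ B) :
    Trans x ro W B (countOnes r s) μ
      { μ with
        reg := Function.update (Function.update μ.reg s (μ.reg s + N)) r (μ.reg r + N)
        fetched := x[μ.reg r + N]? } := by
  refine (trans_readAt r).seq ?_
  have := trans_loop (x := x) (ro := ro) (W := W) (B := B)
    (A := ((inc s).seq ((inc r).seq (Frag.readAt (.inr r))) : SimFrag Ms Counter))
    (c := fun v => v.fetched == some true) N
    (fun i => { μ with
        reg := Function.update (Function.update μ.reg s (μ.reg s + i)) r (μ.reg r + i)
        fetched := x[μ.reg r + i]? })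
    (fun i hi => by simpa [Mem.toStore, Store.view] using hN i hi)
    (by simpa [Mem.toStore, Store.view] using hN')
    (fun i hi => by
      refine (regTrans_inc s ?_ _ rfl).seq ((regTrans_inc r ?_ _ rfl).seq ?_)
      · simpa [hrs.symm] using by omega
      · simpa [hrs] using by omega
      · convert trans_readAt r using 2
        · funext y
          by_cases h1 : y = r
          · subst h1
            simp [hrs]
            omega
          · by_cases h2 : y = s
            · subst h2
              simp [h1]
              omega
            · simp [h1, h2]
        · simp [hrs]
          rfl)
  simpa using this

/-- The parameters `n` and `k` at the beginning of a string. -/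
structure Parses (x : List Bool) (n k : ℕ) : Prop where
  ones_left : ∀ i < n, x[i]? = some true
  sep_left : x[n]? ≠ some true
  ones_right : ∀ i < k, x[n + 1 + i]? = some true
  sep_right : x[n + 1 + k]? ≠ some true

theorem exists_ones (x : List Bool) (d : ℕ) :
    ∃ N, (∀ i < N, x[d + i]? = some true) ∧ x[d + N]? ≠ some true := by
  have h : ∃ N, x[d + N]? ≠ some true := ⟨x.length, by simp⟩
  exact ⟨Nat.find h, fun i hi => not_not.1 (Nat.find_min h hi), Nat.find_spec h⟩

/-- Separators are only required not to be ones, and a missing bit will do. So every string has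
parameters, and the reduction can be analysed on all inputs. -/
theorem exists_parses (x : List Bool) : ∃ n k, Parses x n k := by
  obtain ⟨n, h1, h2⟩ := exists_ones x 0
  obtain ⟨k, h3, h4⟩ := exists_ones x (n + 1)
  exact ⟨n, k, by simpa using h1, by simpa using h2, h3, h4⟩

theorem Parses.le_length {n k : ℕ} (h : Parses x n k) : n ≤ x.length ∧ k ≤ x.length := by
  constructor
  · by_contra hn
    have := h.ones_left x.length (by omega)
    simp at this
  · by_contra hn
    have := h.ones_right x.length (by omega)
    simp at this

/-- Determine `n` and `k`. -/
def parse : SimFrag Ms Counter :=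
  (countOnes .g .n).seq ((inc .g).seq ((countOnes .g .k).seq (inc .g)))

theorem exists_trans_parse {n k : ℕ} (h : Parses x n k) (hB : n + k + 2 ≤ B) (μ : Mem Ms Counter)
    (hμ : μ.reg = fun _ => 0) :
    ∃ f, Trans x ro W B parse μ
      { μ with reg := file n k (n + k + 2) 0 0 0 0 0 0 0 0 0, fetched := f } := by
  refine ⟨x[n + 1 + k]?, ?_⟩
  have h1 := trans_countOnes (x := x) (ro := ro) (W := W) (B := B) (r := .g) (s := .n) (μ := μ)
    (by decide) n (by simpa [hμ] using h.ones_left) (by simpa [hμ] using h.sep_left)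
    (by simp [hμ]; omega) (by simp [hμ]; omega)
  have e1 : Function.update (Function.update μ.reg .n (μ.reg .n + n)) .g (μ.reg .g + n) =
      file n 0 n 0 0 0 0 0 0 0 0 0 := by
    rw [hμ]
    funext y
    cases y <;> simp [file]
  rw [e1] at h1
  refine h1.seq ((RegTrans.inc (ρ' := file n 0 (n + 1) 0 0 0 0 0 0 0 0 0) ?_ ?_ _ rfl).seq ?_)
  · simp [file]; omega
  · funext y
    cases y <;> rfl
  have h2 := fun f => trans_countOnes (x := x) (ro := ro) (W := W) (B := B) (r := .g) (s := .k)
    (μ := { μ with reg := file n 0 (n + 1) 0 0 0 0 0 0 0 0 0, fetched := f })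
    (by decide) k h.ones_right h.sep_right (by simp [file]; omega) (by simp [file]; omega)
  have e2 : Function.update (Function.update (file n 0 (n + 1) 0 0 0 0 0 0 0 0 0) .k
      (file n 0 (n + 1) 0 0 0 0 0 0 0 0 0 .k + k)) .g
      (file n 0 (n + 1) 0 0 0 0 0 0 0 0 0 .g + k) =
      file n k (n + 1 + k) 0 0 0 0 0 0 0 0 0 := by
    funext y
    cases y <;> simp [file]
  refine Trans.seq (h2 _) ?_
  simp only
  rw [e2]
  refine RegTrans.inc ?_ ?_ _ rfl
  · simp [file]; omega
  · funext y
    cases y <;> simp [file]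
    omega

/-! #### The computation of `m` -/

/-- Read a bit of the pair of parameters. -/
def pairInput : SimFrag Ms Counter :=
  ((add .a .p).seq ((inc .p).seq (sub .g .p))).seq (ifPos .p
    (((clear .p).seq (clear .a)).seq (setCtl false fun v => ((v.ctl false).1, none)))
    ((Frag.readAt (.inr .a)).seq ((setCtl false fun v => ((v.ctl false).1, v.fetched)).seq
      (clear .a))))

/-- The value `a + 1 - g` is positive exactly if the address lies beyond the header. The machine
computing `m` must then see an address out of range instead of a bit of the graph. -/
theorem exists_trans_pairInput {n k g m a : ℕ} (hg : g ≤ B) (ha : a < B) (μ : Mem Ms Counter)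
    (hμ : μ.reg = file n k g m 0 0 0 a 0 0 0 0) (c : (Ms false).Config)
    (hcells : c.cells = (μ.vm false).cells) (hhead : c.head = (μ.vm false).head)
    (hstate : c.state = (μ.vm false).state) (hfetched : c.fetched = (x.take g)[a]?) :
    ∃ f, Trans x ro W B pairInput μ { μ with
      vm := Function.update μ.vm false c
      reg := file n k g m 0 0 0 0 0 0 0 0
      fetched := f } := by
  have h1 : RegTrans x ro W B ((add .a .p).seq ((inc .p).seq (sub .g .p)) : SimFrag Ms Counter)
      (file n k g m 0 0 0 a 0 0 0 0) (file n k g m 0 0 0 a (a + 1 - g) 0 0 0) :=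
    RegTrans.seq (regTrans_add (ρ' := file n k g m 0 0 0 a a 0 0 0) (by simp [file]; omega)
        (by funext y; cases y <;> simp [file]))
    (RegTrans.seq (RegTrans.inc (ρ' := file n k g m 0 0 0 a (a + 1) 0 0 0)
        (by simp [file]; omega) (by funext y; cases y <;> simp [file]))
    (regTrans_sub (by simpa [file] using hg)
      (by funext y; cases y <;> simp [file])))
  rcases lt_or_ge a g with hlt | hge
  · have h2 : Trans x ro W B (Frag.readAt (.inr .a))
        { μ with reg := file n k g m 0 0 0 a (a + 1 - g) 0 0 0 }
        { μ with reg := file n k g m 0 0 0 a (a + 1 - g) 0 0 0, fetched := x[a]? } := by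
      have := trans_readAt (x := x) (ro := ro) (W := W) (B := B)
        (μ := { μ with reg := file n k g m 0 0 0 a (a + 1 - g) 0 0 0 }) .a
      exact this
    have h3 : Trans x ro W B (setCtl false fun v => ((v.ctl false).1, v.fetched))
        { μ with reg := file n k g m 0 0 0 a (a + 1 - g) 0 0 0, fetched := x[a]? }
        { μ with
          vm := Function.update μ.vm false c
          reg := file n k g m 0 0 0 a (a + 1 - g) 0 0 0
          fetched := x[a]? } := by
      refine trans_setCtl c hcells hhead ?_
      simp only [hstate, hfetched, Mem.toStore, Store.view, Prod.mk.injEq, true_and]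
      rw [List.getElem?_take_of_lt hlt]
    have h4 : RegTrans x ro W B (clear .a : SimFrag Ms Counter)
        (file n k g m 0 0 0 a (a + 1 - g) 0 0 0) (file n k g m 0 0 0 0 0 0 0 0) :=
      RegTrans.clear (by funext y; cases y <;> simp [file]; omega)
    exact ⟨_, (h1 μ hμ).seq (trans_ifPos_zero (by simp [file]; omega)
      (h2.seq (h3.seq (h4 _ rfl))))⟩
  · have h2 : RegTrans x ro W B ((clear .p).seq (clear .a) : SimFrag Ms Counter)
        (file n k g m 0 0 0 a (a + 1 - g) 0 0 0) (file n k g m 0 0 0 0 0 0 0 0) :=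
      RegTrans.seq (RegTrans.clear (ρ' := file n k g m 0 0 0 a 0 0 0 0)
        (by funext y; cases y <;> simp [file])) (RegTrans.clear
            (by funext y; cases y <;> simp [file]))
    have h3 : Trans x ro W B (setCtl false fun v => ((v.ctl false).1, none))
        { μ with reg := file n k g m 0 0 0 0 0 0 0 0 }
        { μ with
          vm := Function.update μ.vm false c
          reg := file n k g m 0 0 0 0 0 0 0 0
          fetched := μ.fetched } := by
      refine trans_setCtl c hcells hhead ?_
      simp only [hstate, hfetched, Mem.toStore, Store.view, Prod.mk.injEq, true_and]
      rw [List.getElem?_eq_none]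
      simp
      omega
    exact ⟨_, (h1 μ hμ).seq (trans_ifPos_pos (by simp [file]; omega)
      ((h2 _ rfl).seq h3))⟩

/-- Append a bit to `m`, which is truncated at `n`. -/
def pairEmit (b : Bool) : SimFrag Ms Counter :=
  (double .z .m b).seq ((add .m .p).seq ((sub .n .p).seq ((sub .p .m).seq (clear .p))))

/-- Subtracting `d - n` from `d` leaves `min d n`. On malformed inputs the emitted number need not
be at most `n`, and truncation keeps the counter small; it may be applied after every bit. -/
theorem regTrans_pairEmit {n k g m a : ℕ} (b : Bool) (hm : m ≤ n) (hB : 2 * n + 1 ≤ B) :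
    RegTrans x ro W B (pairEmit b : SimFrag Ms Counter) (file n k g m 0 0 0 a 0 0 0 0)
      (file n k g (min (2 * m + b.toNat) n) 0 0 0 a 0 0 0 0) := by
  have hb := Bool.toNat_lt b
  set d := 2 * m + b.toNat with hd
  refine RegTrans.seq (RegTrans.double (ρ' := file n k g d 0 0 0 a 0 0 0 0) b
      (by simp [file]; omega)
    (by funext y; cases y <;> simp [file, hd])) ?_
  refine RegTrans.seq (regTrans_add (ρ' := file n k g d 0 0 0 a d 0 0 0)
    (by simp [file]; omega) (by funext y; cases y <;> simp [file])) ?_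
  refine RegTrans.seq (regTrans_sub (ρ' := file n k g d 0 0 0 a (d - n) 0 0 0)
    (by simp [file]; omega) (by funext y; cases y <;> simp [file])) ?_
  refine RegTrans.seq (regTrans_sub (ρ' := file n k g (min d n) 0 0 0 a (d - n) 0 0 0)
      (by simp [file]; omega) (by funext y; cases y <;> simp [file]; omega)) ?_
  exact RegTrans.clear (by funext y; cases y <;> simp [file])

theorem regTrans_address {n k g m v h w a : ℕ} (b : Bool) (hB : 2 * a + 1 ≤ B) :
    RegTrans x ro W B (double .z .a b : SimFrag Ms Counter) (file n k g m v h w a 0 0 0 0)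
      (file n k g m v h w (2 * a + b.toNat) 0 0 0 0) := by
  have hb := Bool.toNat_lt b
  exact RegTrans.double b (by simp [file]; omega)
    (by funext y; cases y <;> simp [file])

/-! #### The parameters of the simulated problem -/

/-- Compute `v`, `g`, `h` and `w`. -/
def prepare : SimFrag Ms Counter :=
  (clear .a).seq ((add .n .v).seq ((sub .m .v).seq ((sub .m .g).seq ((add .g .h).seq
    ((add .v .p).seq ((whilePos .p ((pred .p).seq (add .v .h))).seq
      ((add .v .p).seq (whilePos .p ((pred .p).seq (add .p .w))))))))))

theorem regTrans_prepare {n k g m a : ℕ} (hB : n + g + n * n ≤ B) (hm : m ≤ n) :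
    RegTrans x ro W B (prepare : SimFrag Ms Counter) (file n k g m 0 0 0 a 0 0 0 0)
      (file n k (g - m) m (n - m) (g - m + (n - m) * (n - m)) ((n - m).choose 2) 0 0 0 0 0) := by
  refine RegTrans.seq (RegTrans.clear (ρ' := file n k g m 0 0 0 0 0 0 0 0)
      (by funext y; cases y <;> simp [file])) ?_
  refine RegTrans.seq (regTrans_add (ρ' := file n k g m n 0 0 0 0 0 0 0) (by simp [file]; omega)
      (by funext y; cases y <;> simp [file])) ?_
  set v := n - m with hv
  have hvn : v ≤ n := by omega
  have hvv : v * v ≤ n * n := Nat.mul_le_mul hvn hvn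
  refine RegTrans.seq (regTrans_sub (ρ' := file n k g m v 0 0 0 0 0 0 0) (by simp [file]; omega)
      (by funext y; cases y <;> simp [file, hv])) ?_
  refine RegTrans.seq (regTrans_sub (ρ' := file n k (g - m) m v 0 0 0 0 0 0 0)
      (by simp [file]; omega) (by funext y; cases y <;> simp [file])) ?_
  set e := g - m with he
  refine RegTrans.seq (regTrans_add (ρ' := file n k e m v e 0 0 0 0 0 0) (by simp [file]; omega)
      (by funext y; cases y <;> simp [file])) ?_
  refine RegTrans.seq (regTrans_add (ρ' := file n k e m v e 0 0 v 0 0 0) (by simp [file]; omega)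
      (by funext y; cases y <;> simp [file])) ?_
  refine RegTrans.seq (RegTrans.loop (ρ' := file n k e m v (e + v * v) 0 0 0 0 0 0) v
    (fun i => file n k e m v (e + i * v) 0 0 (v - i) 0 0 0) (by simp) (by simp)
    (fun i hi => by simp [file]; omega) (by simp [file]) fun i hi => ?_) ?_
  · refine RegTrans.seq (RegTrans.pred (ρ' := file n k e m v (e + i * v) 0 0 (v - (i + 1)) 0 0 0)
      (by funext y; cases y <;> simp [file, Nat.sub_sub])) (regTrans_add ?_
      (by funext y; cases y <;> simp [file, Nat.succ_mul, add_assoc]))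
    have : (i + 1) * v ≤ v * v := Nat.mul_le_mul_right v hi
    rw [Nat.succ_mul] at this
    simp [file]
    omega
  refine RegTrans.seq (regTrans_add (ρ' := file n k e m v (e + v * v) 0 0 v 0 0 0)
      (by simp [file]; omega) (by funext y; cases y <;> simp [file])) ?_
  -- The last loop sums `(v - 1) + (v - 2) + ⋯ + 0 = C(v,2)`.
  have hw : ∀ i, i < v → v.choose 2 - (v - i).choose 2 + (v - (i + 1)) =
      v.choose 2 - (v - (i + 1)).choose 2 := by
    intro i hi
    have h1 := Nat.choose_succ_succ (v - (i + 1)) 1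
    rw [Nat.choose_one_right, Nat.succ_eq_add_one, show v - (i + 1) + 1 = v - i by omega] at h1
    change (v - i).choose 2 = v - (i + 1) + (v - (i + 1)).choose 2 at h1
    have h2 := Nat.choose_le_choose 2 (show v - i ≤ v by omega)
    omega
  have hle : v.choose 2 ≤ v * v := by
    rw [Nat.choose_two_right]
    exact (Nat.div_le_self _ _).trans (Nat.mul_le_mul_left v (Nat.sub_le _ _))
  refine RegTrans.loop v
    (fun i => file n k e m v (e + v * v) (v.choose 2 - (v - i).choose 2) 0 (v - i) 0 0 0)
        (by simp) (by simp)
    (fun i hi => by simp [file]; omega) (by simp [file]) fun i hi => ?_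
  refine RegTrans.seq (RegTrans.pred
      (ρ' := file n k e m v (e + v * v) (v.choose 2 - (v - i).choose 2) 0 (v - (i + 1)) 0 0 0)
    (by funext y; cases y <;> simp [file, Nat.sub_sub])) (regTrans_add ?_
    (by funext y; cases y <;> simp [file, hw i hi]))
  simp [file, hw i hi]
  omega

/-! #### The simulated instance -/

/-- Fetch the bit at the position `q`, or `0` if there is none, and clear the counters. -/
def deliver : SimFrag Ms Counter :=
  (Frag.readAt (.inr .q)).seq
    ((setCtl true fun v => ((v.ctl true).1, some (v.fetched.getD false))).seq
      ((clear .q).seq ((clear .c).seq ((clear .j).seq (clear .a)))))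

theorem exists_trans_deliver {n k g m v h w a q d j : ℕ} (μ : Mem Ms Counter)
    (hμ : μ.reg = file n k g m v h w a 0 q d j) (c : (Ms true).Config)
    (hcells : c.cells = (μ.vm true).cells) (hhead : c.head = (μ.vm true).head)
    (hstate : c.state = (μ.vm true).state) (hfetched : c.fetched = some (x[q]?.getD false)) :
    ∃ f, Trans x ro W B deliver μ { μ with
      vm := Function.update μ.vm true c
      reg := file n k g m v h w 0 0 0 0 0
      fetched := f } := by
  have h2 : Trans x ro W B (Frag.readAt (.inr .q)) μ { μ with fetched := x[q]? } := by
    have := trans_readAt (x := x) (ro := ro) (W := W) (B := B) (μ := μ) .q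
    rwa [show μ.reg .q = q by rw [hμ]; rfl] at this
  have h3 : Trans x ro W B (setCtl true fun v => ((v.ctl true).1, some (v.fetched.getD false)))
      { μ with fetched := x[q]? }
      { μ with vm := Function.update μ.vm true c, fetched := x[q]? } := by
    refine trans_setCtl c hcells hhead ?_
    simp only [hstate, hfetched, Mem.toStore, Store.view]
  have h4 : RegTrans x ro W B
      ((clear .q).seq ((clear .c).seq ((clear .j).seq (clear .a))) : SimFrag Ms Counter)
      (file n k g m v h w a 0 q d j) (file n k g m v h w 0 0 0 0 0) := by
    refine RegTrans.seq (RegTrans.clear (ρ' := file n k g m v h w a 0 0 d j)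
      (by funext y; cases y <;> simp [file])) ?_
    refine RegTrans.seq (RegTrans.clear (ρ' := file n k g m v h w a 0 0 0 j)
      (by funext y; cases y <;> simp [file])) ?_
    refine RegTrans.seq (RegTrans.clear (ρ' := file n k g m v h w a 0 0 0 0)
      (by funext y; cases y <;> simp [file])) ?_
    exact RegTrans.clear (by funext y; cases y <;> simp [file])
  exact ⟨_, h2.seq (h3.seq (h4 _ hμ))⟩

/-- Compute the position in the input of the simulated input bit `a`. -/
def locateInput : SimFrag Ms Counter :=
  (add .a .q).seq ((add .m .q).seq ((add .a .p).seq ((sub .g .p).seq ((add .v .c).seq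
    (whilePos .p ((pred .p).seq ((pred .c).seq
      (ifPos .c .skip ((add .v .c).seq (add .m .q))))))))))

/-- The header of the large instance is longer by `m`, and every completed row of the small matrix
skips `m` further columns. Division by `v` is done by counting the columns left in the current row,
which needs `v ≠ 0` unless the loop is empty. -/
theorem regTrans_locateInput {n k g m v h w a : ℕ} (hB : a + m + (a + 1) * m + g + v ≤ B)
    (hv : v ≠ 0 ∨ a ≤ g) :
    ∃ d, RegTrans x ro W B (locateInput : SimFrag Ms Counter) (file n k g m v h w a 0 0 0 0)
      (file n k g m v h w a 0 (a + m + (a - g) / v * m) d 0) := by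
  refine ⟨v - (a - g) % v, ?_⟩
  refine RegTrans.seq (regTrans_add (ρ' := file n k g m v h w a 0 a 0 0) (by simp [file]; omega)
      (by funext y; cases y <;> simp [file])) ?_
  refine RegTrans.seq (regTrans_add (ρ' := file n k g m v h w a 0 (a + m) 0 0)
      (by simp [file]; omega) (by funext y; cases y <;> simp [file])) ?_
  refine RegTrans.seq (regTrans_add (ρ' := file n k g m v h w a a (a + m) 0 0)
      (by simp [file]; omega) (by funext y; cases y <;> simp [file])) ?_
  refine RegTrans.seq (regTrans_sub (ρ' := file n k g m v h w a (a - g) (a + m) 0 0)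
      (by simp [file]; omega) (by funext y; cases y <;> simp [file])) ?_
  refine RegTrans.seq (regTrans_add (ρ' := file n k g m v h w a (a - g) (a + m) v 0)
      (by simp [file]; omega) (by funext y; cases y <;> simp [file])) ?_
  refine RegTrans.loop (a - g)
    (fun i => file n k g m v h w a (a - g - i) (a + m + i / v * m) (v - i % v) 0) (by simp)
        (by simp)
    (fun i hi => by simp [file]; omega) (by simp [file]) fun i hi => ?_
  have hv0 : 0 < v := by omega
  have hmod := Nat.mod_lt i hv0
  refine RegTrans.seq (RegTrans.pred
      (ρ' := file n k g m v h w a (a - g - (i + 1)) (a + m + i / v * m) (v - i % v) 0)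
    (by funext y; cases y <;> simp [file, Nat.sub_sub, add_assoc])) (RegTrans.seq
    (RegTrans.pred
        (ρ' := file n k g m v h w a (a - g - (i + 1)) (a + m + i / v * m) (v - (i % v + 1)) 0)
    (by funext y; cases y <;> simp [file, Nat.sub_sub])) ?_)
  by_cases hc : i % v + 1 = v
  · have hd : v ∣ i + 1 := by
      rw [Nat.dvd_iff_mod_eq_zero, Nat.add_mod]
      rcases Nat.lt_or_ge 1 v with h1 | h1
      · rw [Nat.mod_eq_of_lt h1, hc, Nat.mod_self]
      · have : v = 1 := by omega
        subst this
        exact Nat.mod_one _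
    have h1 : (i + 1) / v = i / v + 1 := Nat.succ_div_of_dvd hd
    have h2 : (i + 1) % v = 0 := Nat.mod_eq_zero_of_dvd hd
    have h3 : (i / v + 1) * m ≤ (a + 1) * m :=
      Nat.mul_le_mul_right m (by have := Nat.div_le_self i v; omega)
    rw [Nat.succ_mul] at h3
    refine RegTrans.ifPos_zero (by simp [file]; omega) (RegTrans.seq (regTrans_add
      (ρ' := file n k g m v h w a (a - g - (i + 1)) (a + m + i / v * m) v 0)
          (by simp [file]; omega) (by funext y; cases y <;> simp [file]; omega))
      (regTrans_add ?_ ?_))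
    · simp [file]
      omega
    · rw [h1, h2, Nat.succ_mul]
      funext y
      cases y <;> simp [file, add_assoc]
  · have hd : ¬ v ∣ i + 1 := by
      intro hd
      have h1 := Nat.mod_eq_zero_of_dvd hd
      have h2 := Nat.div_add_mod i v
      rw [show i + 1 = v * (i / v) + (i % v + 1) by omega, Nat.mul_add_mod,
        Nat.mod_eq_of_lt (by omega)] at h1
      omega
    have h1 : (i + 1) / v = i / v := Nat.succ_div_of_not_dvd hd
    have h2 : (i + 1) % v = i % v + 1 := by
      have h2 := Nat.div_add_mod i v
      rw [show i + 1 = v * (i / v) + (i % v + 1) by omega, Nat.mul_add_mod,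
        Nat.mod_eq_of_lt (by omega)]
    rw [h1, h2]
    exact RegTrans.ifPos_pos (by simp [file]; omega) regTrans_skip

/-- Read a bit of the simulated input. -/
def graphInput : SimFrag Ms Counter :=
  ((add .a .p).seq ((inc .p).seq (sub .h .p))).seq (ifPos .p
    (((clear .p).seq (clear .a)).seq (setCtl true fun v => ((v.ctl true).1, none)))
    (locateInput.seq deliver))

theorem exists_trans_graphInput {n k g m v w a : ℕ} (ha : a < B)
    (hB : g + v * v + m + (g + v * v + 1) * m + g + v ≤ B) (μ : Mem Ms Counter)
    (hμ : μ.reg = file n k g m v (g + v * v) w a 0 0 0 0) (c : (Ms true).Config)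
    (hcells : c.cells = (μ.vm true).cells) (hhead : c.head = (μ.vm true).head)
    (hstate : c.state = (μ.vm true).state) (hfetched : c.fetched = (subInput x g m v)[a]?) :
    ∃ f, Trans x ro W B graphInput μ { μ with
      vm := Function.update μ.vm true c
      reg := file n k g m v (g + v * v) w 0 0 0 0 0
      fetched := f } := by
  set h := g + v * v with hh
  have h1 : RegTrans x ro W B ((add .a .p).seq ((inc .p).seq (sub .h .p)) : SimFrag Ms Counter)
      (file n k g m v h w a 0 0 0 0) (file n k g m v h w a (a + 1 - h) 0 0 0) :=
    RegTrans.seq (regTrans_add (ρ' := file n k g m v h w a a 0 0 0) (by simp [file]; omega)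
        (by funext y; cases y <;> simp [file]))
    (RegTrans.seq (RegTrans.inc (ρ' := file n k g m v h w a (a + 1) 0 0 0)
        (by simp [file]; omega) (by funext y; cases y <;> simp [file]))
    (regTrans_sub (by simp [file]; omega)
      (by funext y; cases y <;> simp [file])))
  rcases lt_or_ge a h with hlt | hge
  · have h0 : a + 1 - h = 0 := by omega
    rw [h0] at h1
    have hle : (a + 1) * m ≤ (h + 1) * m := Nat.mul_le_mul_right m (by omega)
    obtain ⟨d, hd⟩ := regTrans_locateInput (Ms := Ms) (x := x) (ro := ro) (W := W) (B := B)
      (n := n) (k := k) (g := g) (m := m) (v := v) (h := h) (w := w) (a := a) (by omega) (by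
        by_contra hcon
        simp only [not_or, not_not] at hcon
        rw [hcon.1] at hh
        omega)
    have h2 := hd { μ with reg := file n k g m v h w a 0 0 0 0 } rfl
    obtain ⟨f, hf⟩ := exists_trans_deliver (x := x) (ro := ro) (W := W) (B := B)
      { μ with reg := file n k g m v h w a 0 (a + m + (a - g) / v * m) d 0 } rfl c hcells hhead
      hstate (by
        rw [hfetched, subInput, List.getElem?_ofFn, dif_pos hlt])
    exact ⟨f, (h1 μ hμ).seq (trans_ifPos_zero rfl (h2.seq hf))⟩
  · have h2 : RegTrans x ro W B ((clear .p).seq (clear .a) : SimFrag Ms Counter)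
        (file n k g m v h w a (a + 1 - h) 0 0 0) (file n k g m v h w 0 0 0 0 0) :=
      RegTrans.seq (RegTrans.clear (ρ' := file n k g m v h w a 0 0 0 0)
        (by funext y; cases y <;> simp [file])) (RegTrans.clear
            (by funext y; cases y <;> simp [file]))
    have h3 : Trans x ro W B (setCtl true fun v => ((v.ctl true).1, none))
        { μ with reg := file n k g m v h w 0 0 0 0 0 }
        { μ with
          vm := Function.update μ.vm true c
          reg := file n k g m v h w 0 0 0 0 0
          fetched := μ.fetched } := by
      refine trans_setCtl c hcells hhead ?_
      simp only [hstate, hfetched, Mem.toStore, Store.view, Prod.mk.injEq, true_and]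
      rw [List.getElem?_eq_none]
      simpa [subInput] using hge
    exact ⟨_, (h1 μ hμ).seq (trans_ifPos_pos (by simp [file]; omega)
      ((h2 _ rfl).seq h3))⟩

/-- Compute the position in the input of the pair with number `a + w`. -/
def locateRandom : SimFrag Ms Counter :=
  ((add .a .p).seq ((add .w .p).seq ((inc .c).seq ((inc .j).seq ((add .g .q).seq ((add .m .q).seq
    (add .n .q))))))).seq
      (whilePos .p ((pred .p).seq ((pred .c).seq ((inc .q).seq (ifPos .c .skip
        ((add .n .q).seq ((sub .j .q).seq ((inc .j).seq (add .j .c)))))))))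

/-- Walk through the enumeration `tri`, keeping in `q` the matrix position of the current pair `(j,
i)` and in `c` the number `j - i` of entries left in its row. The start is `(1, 0)`. -/
theorem regTrans_locateRandom {n k g m v h w a : ℕ} (hB : g + m + (a + w + 3) * (n + 1) ≤ B) :
    ∃ d j, RegTrans x ro W B (locateRandom : SimFrag Ms Counter) (file n k g m v h w a 0 0 0 0)
      (file n k g m v h w a 0 (g + m + (tri (a + w)).1 * n + (tri (a + w)).2) d j) := by
  have haw : a + w + 3 ≤ (a + w + 3) * (n + 1) := Nat.le_mul_of_pos_right _ n.succ_pos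
  have hn1 : (n + 1) * 3 ≤ (a + w + 3) * (n + 1) := by
    rw [mul_comm]
    exact Nat.mul_le_mul_right _ (by omega)
  refine ⟨(tri (a + w)).1 - (tri (a + w)).2, (tri (a + w)).1, ?_⟩
  refine RegTrans.seq (ρ₂ := file n k g m v h w a (a + w) (g + m + n) 1 1) ?_ ?_
  · refine RegTrans.seq (regTrans_add (ρ' := file n k g m v h w a a 0 0 0)
      (by simp [file]; omega) (by funext y; cases y <;> simp [file])) ?_
    refine RegTrans.seq (regTrans_add (ρ' := file n k g m v h w a (a + w) 0 0 0)
        (by simp [file]; omega) (by funext y; cases y <;> simp [file])) ?_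
    refine RegTrans.seq (RegTrans.inc (ρ' := file n k g m v h w a (a + w) 0 1 0)
        (by simp [file]; omega)
      (by funext y; cases y <;> simp [file])) ?_
    refine RegTrans.seq (RegTrans.inc (ρ' := file n k g m v h w a (a + w) 0 1 1)
        (by simp [file]; omega)
      (by funext y; cases y <;> simp [file])) ?_
    refine RegTrans.seq (regTrans_add (ρ' := file n k g m v h w a (a + w) g 1 1)
        (by simp [file]; omega) (by funext y; cases y <;> simp [file])) ?_
    refine RegTrans.seq (regTrans_add (ρ' := file n k g m v h w a (a + w) (g + m) 1 1)
        (by simp [file]; omega) (by funext y; cases y <;> simp [file])) ?_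
    exact regTrans_add (by simp [file]; omega)
      (by funext y; cases y <;> simp [file])
  refine RegTrans.loop (a + w) (fun t => file n k g m v h w a (a + w - t)
    (g + m + (tri t).1 * n + (tri t).2) ((tri t).1 - (tri t).2) (tri t).1) (by simp [tri]) (by simp)
    (fun i hi => by simp [file]; omega) (by simp [file]) fun t ht => ?_
  rw [tri_succ, triNext]
  obtain ⟨hlt, -⟩ := tri_spec t
  have hj := tri_fst_le t
  generalize (tri t).1 = j at *
  generalize (tri t).2 = i at *
  have hjn : (j + 1) * (n + 1) ≤ (a + w + 2) * (n + 1) := Nat.mul_le_mul_right _ (by omega)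
  have hexp : (j + 1) * (n + 1) = j * n + n + j + 1 := by ring
  have hexp2 : (a + w + 3) * (n + 1) = (a + w + 2) * (n + 1) + n + 1 := by ring
  refine RegTrans.seq (RegTrans.pred
      (ρ' := file n k g m v h w a (a + w - (t + 1)) (g + m + j * n + i) (j - i) j)
    (by funext y; cases y <;> simp [file, Nat.sub_sub])) ?_
  refine RegTrans.seq (RegTrans.pred
      (ρ' := file n k g m v h w a (a + w - (t + 1)) (g + m + j * n + i) (j - (i + 1)) j)
    (by funext y; cases y <;> simp [file, Nat.sub_sub])) ?_
  refine RegTrans.seq (RegTrans.inc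
      (ρ' := file n k g m v h w a (a + w - (t + 1)) (g + m + j * n + (i + 1)) (j - (i + 1)) j)
      (by simp [file]; omega)
    (by funext y; cases y <;> simp [file, add_assoc])) ?_
  split_ifs with hi
  · have h0 : j - (i + 1) = 0 := by omega
    rw [h0]
    refine RegTrans.ifPos_zero rfl ?_
    -- At the end of a row `q` points to `(j, j)`; adding `n` and subtracting `j` leads to `(j + 1,
    -- 0)`.
    refine RegTrans.seq (regTrans_add
      (ρ' := file n k g m v h w a (a + w - (t + 1)) (g + m + j * n + (i + 1) + n) 0 j)
          (by simp [file]; omega) (by funext y; cases y <;> simp [file])) ?_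
    refine RegTrans.seq (regTrans_sub
      (ρ' := file n k g m v h w a (a + w - (t + 1)) (g + m + (j + 1) * n) 0 j)
          (by simp [file]; omega)
      (by rw [Nat.succ_mul]; funext y; cases y <;> simp [file]; omega)) ?_
    refine RegTrans.seq (RegTrans.inc
        (ρ' := file n k g m v h w a (a + w - (t + 1)) (g + m + (j + 1) * n) 0 (j + 1))
        (by simp [file]; omega)
      (by funext y; cases y <;> simp [file])) ?_
    exact regTrans_add (by simp [file]; omega)
      (by funext y; cases y <;> simp [file])
  · exact RegTrans.ifPos_pos (by simp [file]; omega) regTrans_skip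

/-- Read a bit of the simulated multiple access random string. -/
def graphRandom : SimFrag Ms Counter := locateRandom.seq deliver

theorem exists_trans_graphRandom {n k g m v h w a : ℕ}
    (hB : g + m + (a + w + 3) * (n + 1) ≤ B) (μ : Mem Ms Counter)
    (hμ : μ.reg = file n k g m v h w a 0 0 0 0) (c : (Ms true).Config)
    (hcells : c.cells = (μ.vm true).cells) (hhead : c.head = (μ.vm true).head)
    (hstate : c.state = (μ.vm true).state)
    (hfetched : c.fetched = some (subRandom x n (g + m) w a)) :
    ∃ f, Trans x ro W B graphRandom μ { μ with
      vm := Function.update μ.vm true c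
      reg := file n k g m v h w 0 0 0 0 0
      fetched := f } := by
  obtain ⟨d, j, hd⟩ := regTrans_locateRandom (Ms := Ms) (x := x) (ro := ro) (W := W) (B := B)
    (n := n) (k := k) (g := g) (m := m) (v := v) (h := h) (w := w) (a := a) hB
  obtain ⟨f, hf⟩ := exists_trans_deliver (x := x) (ro := ro) (W := W) (B := B)
    { μ with reg := file n k g m v h w a 0 (g + m + (tri (a + w)).1 * n + (tri (a + w)).2) d j }
    rfl c hcells hhead hstate hfetched
  exact ⟨f, (hd μ hμ).seq hf⟩

end SimFrag

/-! ### Assembling the reduction into one machine -/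

namespace RATM

/-- The computation of `m` consumes no read-once bits, so the second simulation starts at the
beginning of the random tape. -/
theorem IsDeterministic.coins_eq_zero {M : RATM} (h : M.IsDeterministic) (x : List Bool)
    (ro ma : ℕ → Bool) (j : ℕ) : (M.conf x ro ma j).coins = 0 := by
  induction j with
  | zero => rfl
  | succ j ih =>
    rw [conf_succ]
    generalize M.conf x ro ma j = c at *
    unfold step
    split
    case h_5 q hq => exact absurd hq (h.2 _ _ _ _)
    all_goals exact ih

theorem RunsInLogspace.exists_halt {M : RATM} (h : M.RunsInLogspace) (x : List Bool)
    (ro ma : ℕ → Bool) : ∃ j, M.instr (M.conf x ro ma j) = .halt := by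
  obtain ⟨C, hC⟩ := h
  exact ⟨_, (hC x ro ma).1⟩

end RATM

namespace SimFrag

variable {Ms : Bool → RATM} {x : List Bool} {ro : ℕ → Bool} {W B : ℕ}

/-- The reduction: compute `m` by the machine `Ms false`, and simulate the machine `Ms true` on
the first `n - m` vertices, with the other pairs of vertices as multiple access random bits. -/
def reduction : SimFrag Ms Counter :=
  parse.seq ((simulate false (double .z .a) pairInput .skip pairEmit).seq (prepare.seq
    (simulate true (double .z .a) graphInput graphRandom fun b => .step fun v => (.emit b, v.ctl))))

/-- The memory at the start. -/
def startMem (Ms : Bool → RATM) : Mem Ms Counter where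
  vm b := (Ms b).init
  reg _ := 0
  fetched := none
  coins := 0
  out := []

theorem startMem_toStore :
    (startMem Ms).toStore = .blank fun b => ((Ms b).start, none) := by
  simp only [startMem, Mem.toStore, Store.blank, Store.mk.injEq, and_true]
  refine ⟨rfl, ?_, ?_⟩
  · funext i
    rcases i with ⟨b, i⟩ | r
    · rfl
    · simp [wordCells_nil]
  · funext i
    rcases i with ⟨b, i⟩ | r <;> rfl

/-- The counters during the computation of `m`. -/
def pairReg (n k g : ℕ) (a o : List Bool) : Counter → ℕ :=
  file n k g (min (bitsVal o) n) 0 0 0 (bitsVal a) 0 0 0 0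

/-- The counters during the simulation on the first `v` vertices. -/
def graphReg (n k g m v h w : ℕ) (a _ : List Bool) : Counter → ℕ :=
  file n k g m v h w (bitsVal a) 0 0 0 0

theorem bitsVal_lt_two_pow {a : List Bool} {L : ℕ} (h : a.length ≤ L) : bitsVal a < 2 ^ L :=
  (bitsVal_lt a).trans_le (Nat.pow_le_pow_right (by norm_num) h)

theorem two_mul_bitsVal_lt {a : List Bool} {L : ℕ} (h : a.length < L) :
    2 * bitsVal a + 1 < 2 ^ L := by
  have h1 := bitsVal_lt a
  have h2 : 2 ^ (a.length + 1) ≤ 2 ^ L := Nat.pow_le_pow_right (by norm_num) h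
  rw [pow_succ] at h2
  omega

/-- The addresses and outputs of the simulated machines are not stored. -/
theorem Trans.update_vm {R : Type} {A : SimFrag Ms R} {μ : Mem Ms R} {b : Bool}
    {vm : ∀ b, (Ms b).Config} {c c' : (Ms b).Config} {reg : R → ℕ} {f : Option Bool} {t : ℕ}
    {o : List Bool} (h : Trans x ro W B A μ ⟨Function.update vm b c, reg, f, t, o⟩)
    (hstate : c'.state = c.state) (hcells : c'.cells = c.cells) (hhead : c'.head = c.head)
    (hfetched : c'.fetched = c.fetched) :
    Trans x ro W B A μ ⟨Function.update vm b c', reg, f, t, o⟩ := by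
  intro hg
  have hs : (⟨Function.update vm b c, reg, f, t, o⟩ : Mem Ms R).toStore =
      (⟨Function.update vm b c', reg, f, t, o⟩ : Mem Ms R).toStore := by
    simp only [Mem.toStore, Store.mk.injEq, and_true]
    refine ⟨?_, ?_, ?_⟩
    · funext b'
      by_cases h : b' = b
      · subst h
        simp [hstate, hfetched]
      · simp [h]
    · funext i
      rcases i with ⟨b', i⟩ | r
      · by_cases h : b' = b
        · subst h
          simp [hcells]
        · simp [h]
      · rfl
    · funext i
      rcases i with ⟨b', i⟩ | r
      · by_cases h : b' = b
        · subst h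
          simp [hhead]
        · simp [h]
      · rfl
  obtain ⟨h1, h2⟩ := h hg
  refine ⟨hs ▸ h1, h2.1, fun b' i => ?_, h2.2.2⟩
  by_cases hb : b' = b
  · subst hb
    simpa [hhead] using h2.2.1 b' i
  · simpa [hb] using h2.2.1 b' i

theorem exists_trans_simulate_pair {n k g L : ℕ} (vm : ∀ b, (Ms b).Config)
    (hno : (Ms false).NoMultipleAccess)
    (hhalt : ∃ j, (Ms false).instr ((Ms false).conf (x.take g) ro (fun _ => false) j) = .halt)
    (hL : ∀ j, ((Ms false).conf (x.take g) ro (fun _ => false) j).addr.length ≤ L)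
    (hW : ∀ j i, (((Ms false).conf (x.take g) ro (fun _ => false) j).head i).natAbs ≤ W)
    (hB : 2 ^ L ≤ B) (hg : g ≤ B) (hn : 2 * n + 1 ≤ B) (f : Option Bool) :
    ∃ N f', (Ms false).instr ((Ms false).conf (x.take g) ro (fun _ => false) N) = .halt ∧
      Trans x ro W B (simulate false (double .z .a) pairInput .skip pairEmit)
        (simMem vm false (pairReg n k g) (fun _ => []) (Ms false).init f)
        (simMem vm false (pairReg n k g) (fun _ => [])
          ((Ms false).conf (x.take g) ro (fun _ => false) N) f') := by
  refine exists_trans_simulate (L := L) (fun c f d hc => ⟨f, ?_⟩) (fun c f hc => ?_) (.inl hno)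
    (fun c f d => ⟨f, ?_⟩) hL hW hhalt f
  · have h := two_mul_bitsVal_lt hc
    have := regTrans_address (Ms := Ms) (x := x) (ro := ro) (W := W) (B := B) (n := n) (k := k)
      (g := g) (m := min (bitsVal c.out) n) (v := 0) (h := 0) (w := 0) (a := bitsVal c.addr) d
      (by omega) (simMem vm false (pairReg n k g) (fun _ => []) c f) rfl
    rw [← bitsVal_append_singleton] at this
    exact Trans.update_vm this rfl rfl rfl rfl
  · obtain ⟨f', hf⟩ := exists_trans_pairInput (x := x) (ro := ro) (W := W) (B := B)
      hg ((bitsVal_lt_two_pow hc).trans_le hB)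
      (simMem vm false (pairReg n k g) (fun _ => []) c f) rfl
      { c with fetched := (x.take g)[bitsVal c.addr]?, addr := [] }
      (by simp [simMem]) (by simp [simMem]) (by simp [simMem]) rfl
    simp only [simMem, Function.update_idem] at hf
    exact ⟨f', hf⟩
  · have := regTrans_pairEmit (Ms := Ms) (x := x) (ro := ro) (W := W) (B := B) (k := k)
      (g := g) (a := bitsVal c.addr) d (min_le_right (bitsVal c.out) n) hn
      (simMem vm false (pairReg n k g) (fun _ => []) c f) rfl
    -- Truncating after each bit gives the same result as truncating once at the end.
    have hd := Bool.toNat_lt d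
    rw [show min (2 * min (bitsVal c.out) n + d.toNat) n =
      min (bitsVal (c.out ++ [d])) n by rw [bitsVal_append_singleton]; omega] at this
    exact Trans.update_vm this rfl rfl rfl rfl

/-- Output of the second simulated machine is forwarded directly to the output tape, whereas that of
the first is collected in the counter `m`. -/
theorem trans_emit {vm : ∀ b, (Ms b).Config} {reg : List Bool → Counter → ℕ}
    {c : (Ms true).Config} {f : Option Bool} (d : Bool) :
    Trans x ro W B (Frag.step fun v => (.emit d, v.ctl))
      (simMem vm true (fun a _ => reg a) id c f)
      (simMem vm true (fun a _ => reg a) id { c with out := c.out ++ [d] } f) := by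
  intro hg
  refine Trans.update_vm (vm := vm) (b := true) (c := c) ?_ rfl rfl rfl rfl hg
  exact trans_step _ rfl hg.2.1 rfl

theorem exists_trans_simulate_graph {n k g m v h w L : ℕ} (vm : ∀ b, (Ms b).Config)
    {y : List Bool} (hy : y = subInput x g m v) {r : ℕ → Bool}
    (hr : r = subRandom x n (g + m) w) (hh : h = g + v * v)
    (hhalt : ∃ j, (Ms true).instr ((Ms true).conf y ro r j) = .halt)
    (hL : ∀ j, ((Ms true).conf y ro r j).addr.length ≤ L)
    (hW : ∀ j i, (((Ms true).conf y ro r j).head i).natAbs ≤ W)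
    (hB : 2 ^ L ≤ B) (hB' : g + v * v + m + (g + v * v + 1) * m + g + v ≤ B)
    (hB'' : g + m + (2 ^ L + w + 3) * (n + 1) ≤ B) (f : Option Bool) :
    ∃ N f', (Ms true).instr ((Ms true).conf y ro r N) = .halt ∧
      Trans x ro W B (simulate true (double .z .a) graphInput graphRandom
          fun b => .step fun v => (.emit b, v.ctl))
        (simMem vm true (graphReg n k g m v h w) id (Ms true).init f)
        (simMem vm true (graphReg n k g m v h w) id ((Ms true).conf y ro r N) f') := by
  subst hh
  refine exists_trans_simulate (L := L) (fun c f d hc => ⟨f, ?_⟩) (fun c f hc => ?_)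
    (.inr fun c f hc => ?_) (fun c f d => ⟨f, ?_⟩) hL hW hhalt f
  · have h := two_mul_bitsVal_lt hc
    have := regTrans_address (Ms := Ms) (x := x) (ro := ro) (W := W) (B := B) (n := n) (k := k)
      (g := g) (m := m) (v := v) (h := g + v * v) (w := w) (a := bitsVal c.addr) d
      (by omega) (simMem vm true (graphReg n k g m v (g + v * v) w) id c f) rfl
    rw [← bitsVal_append_singleton] at this
    exact Trans.update_vm this rfl rfl rfl rfl
  · obtain ⟨f', hf⟩ := exists_trans_graphInput (x := x) (ro := ro) (W := W) (B := B)
      ((bitsVal_lt_two_pow hc).trans_le hB) hB'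
      (simMem vm true (graphReg n k g m v (g + v * v) w) id c f) rfl
      { c with fetched := y[bitsVal c.addr]?, addr := [] }
      (by simp [simMem]) (by simp [simMem]) (by simp [simMem]) (by rw [hy])
    simp only [simMem, Function.update_idem] at hf
    exact ⟨f', hf⟩
  · have ha := bitsVal_lt_two_pow hc
    have hmul : (bitsVal c.addr + w + 3) * (n + 1) ≤ (2 ^ L + w + 3) * (n + 1) :=
      Nat.mul_le_mul_right _ (by omega)
    obtain ⟨f', hf⟩ := exists_trans_graphRandom (x := x) (ro := ro) (W := W) (B := B)
      (g := g) (m := m) (w := w) (n := n) (by omega)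
      (simMem vm true (graphReg n k g m v (g + v * v) w) id c f) rfl
      { c with fetched := some (r (bitsVal c.addr)), addr := [] }
      (by simp [simMem]) (by simp [simMem]) (by simp [simMem]) (by rw [hr])
    simp only [simMem, Function.update_idem] at hf
    exact ⟨f', hf⟩
  · exact trans_emit d

theorem exists_trans_reduction {n k m L : ℕ} {l : List Bool} (hx : Parses x n k)
    (hdet : (Ms false).IsDeterministic)
    (hhalt₀ : ∃ j, (Ms false).instr
      ((Ms false).conf (x.take (n + k + 2)) ro (fun _ => false) j) = .halt)
    (hL₀ : ∀ j, ((Ms false).conf (x.take (n + k + 2)) ro (fun _ => false) j).addr.length ≤ L)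
    (hW₀ : ∀ j i,
      (((Ms false).conf (x.take (n + k + 2)) ro (fun _ => false) j).head i).natAbs ≤ W)
    (hl : (Ms false).Outputs (x.take (n + k + 2)) ro (fun _ => false) l)
    (hm : m = min (bitsVal l) n) {y : List Bool} (hy : y = subInput x (n + k + 2 - m) m (n - m))
    {r : ℕ → Bool} (hr : r = subRandom x n (n + k + 2) ((n - m).choose 2))
    (hhalt₁ : ∃ j, (Ms true).instr ((Ms true).conf y ro r j) = .halt)
    (hL₁ : ∀ j, ((Ms true).conf y ro r j).addr.length ≤ L)
    (hW₁ : ∀ j i, (((Ms true).conf y ro r j).head i).natAbs ≤ W)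
    (hB : 2 ^ L ≤ B) (hB₁ : n + (n + k + 2) + n * n ≤ B)
    (hB₂ : n + k + 2 - m + (n - m) * (n - m) + m +
      (n + k + 2 - m + (n - m) * (n - m) + 1) * m + (n + k + 2 - m) + (n - m) ≤ B)
    (hB₃ : n + k + 2 + (2 ^ L + (n - m).choose 2 + 3) * (n + 1) ≤ B) :
    ∃ μ N, Trans x ro W B reduction (startMem Ms) μ ∧
      (Ms true).instr ((Ms true).conf y ro r N) = .halt ∧
      μ.out = ((Ms true).conf y ro r N).out := by
  have hmn : m ≤ n := hm ▸ min_le_right _ _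
  obtain ⟨f₁, h₁⟩ := exists_trans_parse (W := W) (B := B) (ro := ro) hx (by omega)
    (startMem Ms) rfl
  obtain ⟨N₀, f₂, hN₀, h₂⟩ := exists_trans_simulate_pair (B := B) (n := n) (k := k)
    (fun b => (Ms b).init) hdet.1 hhalt₀ hL₀ hW₀ hB (by omega) (by omega) f₁
  have hout : ((Ms false).conf (x.take (n + k + 2)) ro (fun _ => false) N₀).out = l :=
    (RATM.outputs_iff_of_halt hN₀ l).1 hl
  have hcoins := hdet.coins_eq_zero (x.take (n + k + 2)) ro (fun _ => false) N₀
  generalize (Ms false).conf (x.take (n + k + 2)) ro (fun _ => false) N₀ = c at *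
  have h₃ := regTrans_prepare (Ms := Ms) (x := x) (ro := ro) (W := W) (B := B) (n := n) (k := k)
    (g := n + k + 2) (m := m) (a := bitsVal c.addr) (by omega) hmn
    (simMem (fun b => (Ms b).init) false (pairReg n k (n + k + 2)) (fun _ => []) c f₂)
    (by simp only [simMem, pairReg, hout, hm])
  obtain ⟨N₁, f₃, hN₁, h₄⟩ := exists_trans_simulate_graph (B := B) (n := n) (k := k)
    (g := n + k + 2 - m) (m := m) (v := n - m) (h := n + k + 2 - m + (n - m) * (n - m))
    (w := (n - m).choose 2) (Function.update (fun b => (Ms b).init) false c) hy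
    (by rw [hr, Nat.sub_add_cancel (by omega)]) rfl hhalt₁ hL₁ hW₁ hB hB₂
    (by rwa [Nat.sub_add_cancel (by omega)]) f₂
  have e₁ : simMem (fun b => (Ms b).init) false (pairReg n k (n + k + 2)) (fun _ => [])
      (Ms false).init f₁ = { startMem Ms with
        reg := file n k (n + k + 2) 0 0 0 0 0 0 0 0 0, fetched := f₁ } := by
    simp only [simMem, startMem, Function.update_eq_self]
    simp [RATM.init, pairReg, bitsVal]
  -- The memory at the handover, seen from the second simulation: its machine is still in the
  -- initial configuration, and the coin count is zero by determinism of the first.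
  have e₂ : simMem (Function.update (fun b => (Ms b).init) false c) true
      (graphReg n k (n + k + 2 - m) m (n - m) (n + k + 2 - m + (n - m) * (n - m))
        ((n - m).choose 2)) id (Ms true).init f₂ =
      { simMem (fun b => (Ms b).init) false (pairReg n k (n + k + 2)) (fun _ => []) c f₂ with
        reg := file n k (n + k + 2 - m) m (n - m) (n + k + 2 - m + (n - m) * (n - m))
          ((n - m).choose 2) 0 0 0 0 0 } := by
    have hu : Function.update (Function.update (fun b => (Ms b).init) false c) true
        (Ms true).init = Function.update (fun b => (Ms b).init) false c := by
      rw [Function.update_eq_self_iff]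
      simp
    simp only [simMem, hu, hcoins]
    simp [RATM.init, graphReg, bitsVal]
  rw [e₁] at h₂
  rw [e₂] at h₄
  exact ⟨_, N₁, Trans.seq h₁ (Trans.seq h₂ (Trans.seq h₃ h₄)), hN₁, rfl⟩

end SimFrag

open SimFrag in
-- The description of the outputs is needed only where `D` yields a valid `m`, but halting, the
-- space bound and the single output bit are needed on all strings.
theorem exists_reduction {D S : RATM} (hdet : D.IsDeterministic) (hD : D.RunsInLogspace)
    (hS : S.IsMultipleAccessRandomizedLogspace) :
    ∃ A : RATM, A.IsRandomizedLogspace ∧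
      ∀ (x : List Bool) (n k m : ℕ), Parses x n k → m ≤ n →
      (∀ ro ma, ∃ l, D.Outputs (x.take (n + k + 2)) ro ma l ∧ bitsVal l = m) →
      ∀ ro ma l, A.Outputs x ro ma l ↔ S.Outputs (subInput x (n + k + 2 - m) m (n - m)) ro
        (subRandom x n (n + k + 2) ((n - m).choose 2)) l := by
  have hDhalt := hD.exists_halt
  have hShalt := hS.1.exists_halt
  obtain ⟨C₀, hC₀⟩ := hD
  obtain ⟨C₁, hC₁⟩ := hS.1
  let Ms : Bool → RATM := fun b => bif b then S else D
  have hfin : ∀ b, Finite (Ms b).State := fun b => (Ms b).finite_state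
  let A : Frag (SimTape Ms Counter) (SimCtl Ms) := reduction
  let f₀ : SimCtl Ms := fun b => ((Ms b).start, none)
  -- With `e = log |x| + 1`, the simulated input has length below `2 ^ (2e + 2)`, so its own `log +
  -- 1` is at most `4e`. The last summand pays for counters of `L + 3e + 7` digits and one more
  -- cell, as `e ≥ 1`.
  set K := C₀ + 4 * C₁ + 11 with hK
  -- For an arbitrary string the analysis runs with `min (bitsVal l) n` in the place of `m`, where
  -- `l` is whatever `D` outputs.
  have key : ∀ x n k, Parses x n k → ∀ ro ma l,
      D.Outputs (x.take (n + k + 2)) ro (fun _ => false) l →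
      ∃ μ : Mem Ms Counter, ∃ N N',
        (A.toRATM f₀).conf x ro ma N = A.toConfig f₀ (none, μ.toStore) ∧
        (∀ j < N, ∃ c : Option A.Q × Store _ _, c.2.Fits (K * (Nat.log 2 x.length + 1)) ∧
          (A.toRATM f₀).conf x ro ma j = A.toConfig f₀ c) ∧
        μ.toStore.Fits (K * (Nat.log 2 x.length + 1)) ∧
        S.instr (S.conf (subInput x (n + k + 2 - min (bitsVal l) n) (min (bitsVal l) n)
          (n - min (bitsVal l) n)) ro (subRandom x n (n + k + 2)
          ((n - min (bitsVal l) n).choose 2)) N') = .halt ∧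
        μ.out = (S.conf (subInput x (n + k + 2 - min (bitsVal l) n) (min (bitsVal l) n)
          (n - min (bitsVal l) n)) ro (subRandom x n (n + k + 2)
          ((n - min (bitsVal l) n).choose 2)) N').out := by
    intro x n k hx ro ma l hl
    obtain ⟨m, hm⟩ : ∃ m, m = min (bitsVal l) n := ⟨_, rfl⟩
    have hmn : m ≤ n := hm ▸ min_le_right _ _
    rw [← hm]
    obtain ⟨hn, hk⟩ := hx.le_length
    obtain ⟨e, he⟩ : ∃ e, e = Nat.log 2 x.length + 1 := ⟨_, rfl⟩
    have he1 : 1 ≤ e := by omega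
    have hE : x.length < 2 ^ e := he ▸ Nat.lt_pow_succ_log_self (by norm_num) _
    have hE2 : 2 ≤ 2 ^ e := by
      calc 2 = 2 ^ 1 := rfl
        _ ≤ 2 ^ e := Nat.pow_le_pow_right (by norm_num) he1
    obtain ⟨v, hv⟩ : ∃ v, v = n - m := ⟨_, rfl⟩
    have hw : v.choose 2 ≤ v * v := by
      rw [Nat.choose_two_right]
      exact (Nat.div_le_self _ _).trans (Nat.mul_le_mul_left v (Nat.sub_le _ _))
    have hlog : Nat.log 2 (subInput x (n + k + 2 - m) m (n - m)).length + 1 ≤ 4 * e := by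
      have hlt : (subInput x (n + k + 2 - m) m (n - m)).length < 2 ^ (2 * e + 2) := by
        rw [subInput, List.length_ofFn, ← hv, show 2 * e + 2 = e + e + 2 by ring, pow_add, pow_add]
        have h1 : v * v ≤ 2 ^ e * 2 ^ e := Nat.mul_le_mul (by omega) (by omega)
        have h2 : 2 ^ e ≤ 2 ^ e * 2 ^ e := Nat.le_mul_self _
        omega
      have := Nat.log_lt_of_lt_pow' (b := 2) (by omega) hlt
      omega
    have hlog' : Nat.log 2 (x.take (n + k + 2)).length + 1 ≤ e := by
      rw [he]
      exact Nat.succ_le_succ (Nat.log_mono_right (by simp))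
    obtain ⟨L, hL⟩ : ∃ L, L = (C₀ + 4 * C₁) * e := ⟨_, rfl⟩
    have hL₀ : C₀ * (Nat.log 2 (x.take (n + k + 2)).length + 1) ≤ L := by
      rw [hL]
      exact (Nat.mul_le_mul_left _ hlog').trans (Nat.mul_le_mul_right _ (by omega))
    have hL₁ : C₁ * (Nat.log 2 (subInput x (n + k + 2 - m) m (n - m)).length + 1) ≤ L := by
      rw [hL]
      calc _ ≤ C₁ * (4 * e) := Nat.mul_le_mul_left _ hlog
        _ = (4 * C₁) * e := by ring
        _ ≤ _ := Nat.mul_le_mul_right _ (by omega)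
    have hW : K * e = L + 11 * e := by rw [hK, hL]; ring
    have hA : 1 ≤ 2 ^ L := Nat.one_le_two_pow
    have hBval : 2 ^ (L + 3 * e + 6) = 64 * (2 ^ L * (2 ^ e * 2 ^ e * 2 ^ e)) := by
      rw [show L + 3 * e + 6 = L + (e + e + e) + 6 by ring, pow_add, pow_add, pow_add, pow_add]
      ring
    -- The largest counter values are of the order of `(2 ^ L + n ^ 2) * n`, with `n < 2 ^ e`.
    obtain ⟨B, hB⟩ : ∃ B, B = 2 ^ (L + 3 * e + 6) := ⟨_, rfl⟩
    have hsize : B.size + 1 ≤ K * e := by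
      rw [hW, hB, Nat.size_pow]
      omega
    rw [hBval] at hB
    obtain ⟨a, ha⟩ : ∃ a, a = 2 ^ L := ⟨_, rfl⟩
    obtain ⟨E, hE'⟩ : ∃ E, E = 2 ^ e := ⟨_, rfl⟩
    rw [← hE'] at hE hE2
    rw [← hE', ← ha] at hB
    rw [← ha] at hA
    have hEE : E ≤ E * E := Nat.le_mul_self E
    have hEEE : E * E ≤ E * E * E := Nat.le_mul_of_pos_right _ (by omega)
    have haE : a ≤ a * (E * E * E) := Nat.le_mul_of_pos_right _ (by positivity)
    have haE' : E * E * E ≤ a * (E * E * E) := Nat.le_mul_of_pos_left _ hA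
    have hvv : v * v ≤ E * E := Nat.mul_le_mul (by omega) (by omega)
    have hnn : n * n ≤ E * E := Nat.mul_le_mul (by omega) (by omega)
    obtain ⟨μ, N', hT, hN', hout⟩ := exists_trans_reduction (Ms := Ms) (x := x) (ro := ro)
      (W := K * e) (B := B) (L := L) hx hdet (hDhalt _ _ _)
      (fun j => (((hC₀ _ _ _).2 j).2).trans hL₀)
      (fun j i => (((hC₀ _ _ _).2 j).1 i).trans (hL₀.trans (by omega))) hl hm rfl rfl
      (hShalt _ _ _) (fun j => (((hC₁ _ _ _).2 j).2).trans hL₁)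
      (fun j i => (((hC₁ _ _ _).2 j).1 i).trans (hL₁.trans (by omega)))
      (by omega) (by omega)
      (by
        rw [← hv]
        have : (n + k + 2 - m + v * v + 1) * m ≤ (3 * (E * E)) * E :=
          Nat.mul_le_mul (by
            have := Nat.mul_le_mul_right E hE2
            omega) (by omega)
        have h3 : 3 * (E * E) * E = 3 * (E * E * E) := by ring
        omega)
      (by
        rw [← hv, ← ha]
        have : (a + v.choose 2 + 3) * (n + 1) ≤ (a + E * E + 3) * E :=
          Nat.mul_le_mul (by omega) (by omega)
        have h3 : (a + E * E + 3) * E = a * E + E * E * E + 3 * E := by ring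
        have h4 : a * E ≤ a * (E * E * E) := Nat.mul_le_mul_left _ (by omega)
        omega)
    have hgood : (startMem Ms).Good (K * e) B :=
      ⟨hsize, by simp [startMem, RATM.init], by simp [startMem]⟩
    have hrun := (hT hgood).1
    rw [startMem_toStore] at hrun
    obtain ⟨N, hN, hlt⟩ := hrun.exists_conf ma
    exact ⟨μ, N, N', hN, he ▸ hlt, he ▸ (hT hgood).2.fits, hN', hout⟩
  have houtD : ∀ x ro, ∃ l, D.Outputs x ro (fun _ => false) l := by
    intro x ro
    obtain ⟨j, hj⟩ := hDhalt x ro fun _ => false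
    exact ⟨_, j, hj, rfl⟩
  have hNMA := A.toRATM_noMultipleAccess f₀
  refine ⟨A.toRATM f₀, ⟨hNMA, RATM.runsInLogspace_of_halts hNMA K ?_ ?_, ?_⟩, ?_⟩
  · intro x ro ma
    obtain ⟨n, k, hx⟩ := exists_parses x
    obtain ⟨l, hl⟩ := houtD (x.take (n + k + 2)) ro
    obtain ⟨μ, N, -, hN, -⟩ := key x n k hx ro ma l hl
    exact ⟨N, hN ▸ rfl⟩
  · intro x ro ma j
    obtain ⟨n, k, hx⟩ := exists_parses x
    obtain ⟨l, hl⟩ := houtD (x.take (n + k + 2)) ro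
    obtain ⟨μ, N, -, hN, hlt, hfit, -⟩ := key x n k hx ro ma l hl
    have : ∃ c : Option A.Q × Store _ _, c.2.Fits (K * (Nat.log 2 x.length + 1)) ∧
        (A.toRATM f₀).conf x ro ma j = A.toConfig f₀ c := by
      rcases lt_or_ge j N with h | h
      · exact hlt j h
      · exact ⟨(none, μ.toStore), hfit, by rw [RATM.conf_of_halt (hN ▸ rfl) h, hN]⟩
    obtain ⟨c, hc, hj⟩ := this
    rw [hj]
    exact ⟨fun i => hc.1 _, hc.2⟩
  · intro x ro ma
    obtain ⟨n, k, hx⟩ := exists_parses x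
    obtain ⟨l, hl⟩ := houtD (x.take (n + k + 2)) ro
    obtain ⟨μ, N, N', hN, -, -, hN', hout⟩ := key x n k hx ro ma l hl
    obtain ⟨b, hb⟩ := hS.2 (subInput x (n + k + 2 - min (bitsVal l) n) (min (bitsVal l) n)
          (n - min (bitsVal l) n)) ro (subRandom x n (n + k + 2)
          ((n - min (bitsVal l) n).choose 2))
    rw [RATM.outputs_iff_of_halt hN', ← hout] at hb
    refine ⟨b, (RATM.outputs_iff_of_halt (i := N) (hN ▸ rfl) _).2 ?_⟩
    rw [hN]
    exact hb
  · intro x n k m hx hmn hm ro ma l'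
    obtain ⟨l, hl, hlm⟩ := hm ro fun _ => false
    obtain ⟨μ, N, N', hN, -, -, hN', hout⟩ := key x n k hx ro ma l hl
    rw [hlm, min_eq_left hmn] at hN' hout
    rw [RATM.outputs_iff_of_halt hN', ← hout, RATM.outputs_iff_of_halt (i := N) (hN ▸ rfl), hN]
    rfl

/-! ### Encodings of instances -/

theorem length_encodePair (n k : ℕ) : (encodePair n k).length = n + k + 2 := by
  simp [encodePair]
  omega

theorem getElem?_encodePair {n k p : ℕ} (hp : p < n + k + 2) :
    (encodePair n k)[p]? = some (decide (p ≠ n ∧ p ≠ n + k + 1)) := by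
  simp only [encodePair, List.append_assoc, List.getElem?_append, List.length_replicate,
    List.getElem?_replicate, List.length_singleton, List.getElem?_singleton]
  split_ifs
  all_goals first
    | omega
    | simp only [Option.some.injEq, eq_comm (a := true), eq_comm (a := false), decide_eq_true_eq,
        decide_eq_false_iff_not]
      omega

theorem take_encodeInstance (n k : ℕ) (G : SimpleGraph (Fin n)) :
    (encodeInstance n k G).take (n + k + 2) = encodePair n k := by
  rw [encodeInstance, ← length_encodePair n k, List.take_left]

theorem getElem?_encodeInstance_left {n k p : ℕ} (G : SimpleGraph (Fin n))
    (hp : p < n + k + 2) :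
    (encodeInstance n k G)[p]? = some (decide (p ≠ n ∧ p ≠ n + k + 1)) := by
  rw [encodeInstance, List.getElem?_append_left (by rwa [length_encodePair]),
    getElem?_encodePair hp]

open Classical in
theorem getElem?_encodeInstance_right {n k : ℕ} (G : SimpleGraph (Fin n)) (i j : Fin n) :
    (encodeInstance n k G)[n + k + 2 + i * n + j]? = some (decide (G.Adj i j)) := by
  have hlt := (finProdFinEquiv (i, j)).isLt
  have hval : (finProdFinEquiv (i, j) : ℕ) = i * n + j := by
    simp [finProdFinEquiv_apply_val, mul_comm, add_comm]
  rw [encodeInstance, List.getElem?_append_right (by rw [length_encodePair]; omega),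
    length_encodePair, show n + k + 2 + i * n + j - (n + k + 2) = i * n + j by omega, ← hval,
    List.getElem?_ofFn, dif_pos hlt, Fin.eta, Equiv.symm_apply_apply]

theorem parses_encodeInstance (n k : ℕ) (G : SimpleGraph (Fin n)) :
    SimFrag.Parses (encodeInstance n k G) n k where
  ones_left i hi := by
    rw [getElem?_encodeInstance_left G (by omega)]
    simp
    omega
  sep_left := by
    rw [getElem?_encodeInstance_left G (by omega)]
    simp
  ones_right i hi := by
    rw [getElem?_encodeInstance_left G (by omega)]
    simp
    omega
  sep_right := by
    rw [getElem?_encodeInstance_left G (by omega)]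
    simp
    omega

/-- Dropping the first `m` ones of the header turns the encoding of `(n, k)` into that of `(n - m,
k)`. In the matrix, the row stride `n` exceeds the stride `n - m` by `m`, which accounts for the
extra shift by `m` per row. -/
theorem subInput_encodeInstance {n k m : ℕ} (hm : m ≤ n) (G : SimpleGraph (Fin n)) :
    subInput (encodeInstance n k G) (n + k + 2 - m) m (n - m) =
      encodeInstance (n - m) k (G.comap (Fin.castLE (Nat.sub_le n m))) := by
  obtain ⟨v, hv⟩ : ∃ v, v = n - m := ⟨_, rfl⟩
  have hg : n + k + 2 - m = v + k + 2 := by omega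
  refine List.ext_getElem? fun a => ?_
  rw [subInput, hg, List.getElem?_ofFn]
  subst hv
  split_ifs with ha
  · simp only
    rcases lt_or_ge a (n - m + k + 2) with h | h
    · rw [getElem?_encodeInstance_left _ h, Nat.sub_eq_zero_of_le h.le, Nat.zero_div, zero_mul,
        add_zero, getElem?_encodeInstance_left _ (by omega), Option.getD_some, Option.some.injEq,
        decide_eq_decide]
      omega
    · obtain ⟨b, rfl⟩ := Nat.exists_eq_add_of_le h
      have hb : b < (n - m) * (n - m) := by omega
      have hv : 0 < n - m := Nat.pos_of_mul_pos_left (by omega : 0 < (n - m) * (n - m))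
      have hi : b / (n - m) < n - m := Nat.div_lt_of_lt_mul hb
      have hj : b % (n - m) < n - m := Nat.mod_lt _ hv
      have hdiv := Nat.div_add_mod b (n - m)
      have hn : (b / (n - m)) * n = (b / (n - m)) * (n - m) + (b / (n - m)) * m := by
        rw [← mul_add, Nat.sub_add_cancel hm]
      rw [mul_comm] at hdiv
      have e1 : n - m + k + 2 + b + m + (n - m + k + 2 + b - (n - m + k + 2)) / (n - m) * m =
          n + k + 2 + (b / (n - m)) * n + b % (n - m) := by
        rw [Nat.add_sub_cancel_left, hn]
        omega
      have e2 : n - m + k + 2 + b =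
          n - m + k + 2 + (b / (n - m)) * (n - m) + b % (n - m) := by omega
      have r1 := getElem?_encodeInstance_right (k := k) G ⟨b / (n - m), by omega⟩
        ⟨b % (n - m), by omega⟩
      have r2 := getElem?_encodeInstance_right (k := k) (G.comap (Fin.castLE (Nat.sub_le n m)))
        ⟨b / (n - m), hi⟩ ⟨b % (n - m), hj⟩
      simp only at r1 r2
      rw [e1, r1, e2, r2]
      simp
  · rw [eq_comm, List.getElem?_eq_none]
    rw [encodeInstance, List.length_append, length_encodePair, List.length_ofFn]
    omega

theorem tri_lt {t n : ℕ} (h : t < n.choose 2) : (tri t).1 < n := by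
  by_contra hn
  have := Nat.choose_le_choose 2 (not_lt.1 hn)
  have := (tri_spec t).2
  omega

/-- From number `C(v,2)` on, the larger vertex of the pair lies outside the first `v`. -/
theorem le_tri {t v : ℕ} (h : v.choose 2 ≤ t) : v ≤ (tri t).1 := by
  by_contra hv
  have h1 := Nat.choose_le_choose 2 (Nat.succ_le_of_lt (not_le.1 hv))
  have h2 := Nat.choose_succ_succ (tri t).1 1
  simp only [Nat.choose_one_right, Nat.succ_eq_add_one, Nat.reduceAdd] at h1 h2
  have := tri_spec t
  omega

theorem tri_injective : Function.Injective tri := fun s t h => by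
  rw [← (tri_spec s).2, ← (tri_spec t).2, h]

open Classical in
theorem subRandom_encodeInstance {n k w a : ℕ} (h : a + w < n.choose 2)
    (G : SimpleGraph (Fin n)) :
    subRandom (encodeInstance n k G) n (n + k + 2) w a =
      decide (G.Adj ⟨(tri (a + w)).1, tri_lt h⟩
        ⟨(tri (a + w)).2, (tri_spec _).1.trans (tri_lt h)⟩) := by
  have := getElem?_encodeInstance_right (k := k) G ⟨(tri (a + w)).1, tri_lt h⟩
    ⟨(tri (a + w)).2, (tri_spec _).1.trans (tri_lt h)⟩
  simp only at this
  rw [subRandom, this]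
  rfl

/-! ### Averages over random bits -/

open scoped BigOperators

/-- Extend a bit string by zeros. -/
def extendBits {N : ℕ} (ρ : Fin N → Bool) (i : ℕ) : Bool :=
  if h : i < N then ρ ⟨i, h⟩ else false

theorem extendBits_apply {N : ℕ} (ρ : Fin N → Bool) (i : Fin N) : extendBits ρ i = ρ i := by
  simp [extendBits]

instance : MeasureTheory.IsProbabilityMeasure coinMeasure := by
  unfold coinMeasure
  infer_instance

theorem coinMeasure_real_cylinder {N : ℕ} (ρ : Fin N → Bool) :
    coinMeasure.real ((fun (r : ℕ → Bool) (i : Fin N) => r i) ⁻¹' {ρ}) = (2 ^ N : ℝ)⁻¹ := by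
  have h : (fun (r : ℕ → Bool) (i : Fin N) => r i) ⁻¹' {ρ} =
      Set.pi (Finset.range N) fun i => {extendBits ρ i} := by
    ext r
    simp only [Set.mem_preimage, Set.mem_singleton_iff, funext_iff, Set.mem_pi, Finset.coe_range,
      Set.mem_Iio]
    refine ⟨fun h i hi => ?_, fun h i => ?_⟩
    · rw [h ⟨i, hi⟩, ← extendBits_apply ρ ⟨i, hi⟩]
    · rw [h i i.isLt, extendBits_apply]
  rw [h, coinMeasure, MeasureTheory.measureReal_def, MeasureTheory.Measure.infinitePi_pi _
    fun _ _ => MeasurableSet.of_discrete]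
  simp

open Classical in
/-- The probability of an event that only depends on finitely many random bits. -/
theorem coinMeasure_prod_real {T B : ℕ} {p : (ℕ → Bool) → (ℕ → Bool) → Prop}
    (hp : ∀ r r' s s', (∀ i < T, r i = r' i) → (∀ i < B, s i = s' i) → p r s → p r' s') :
    (coinMeasure.prod coinMeasure).real {r | p r.1 r.2} =
      𝔼 ρ : Fin T → Bool, 𝔼 β : Fin B → Bool,
        if p (extendBits ρ) (extendBits β) then (1 : ℝ) else 0 := by
  let φ : (ℕ → Bool) × (ℕ → Bool) → (Fin T → Bool) × (Fin B → Bool) :=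
    fun r => (fun i => r.1 i, fun i => r.2 i)
  -- The event is a finite union of cylinders, each of probability `2 ^ (-T) * 2 ^ (-B)`.
  have hset : {r : (ℕ → Bool) × (ℕ → Bool) | p r.1 r.2} =
      φ ⁻¹' ((Finset.univ.filter fun z : (Fin T → Bool) × (Fin B → Bool) =>
        p (extendBits z.1) (extendBits z.2) : Finset _) : Set _) := by
    ext r
    simp only [Set.mem_ofPred_eq, Finset.coe_filter, Finset.mem_univ, true_and, Set.mem_preimage]
    refine ⟨hp _ _ _ _ (fun i hi => ?_) fun i hi => ?_, hp _ _ _ _ (fun i hi => ?_) fun i hi => ?_⟩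
    all_goals simp [φ, extendBits, hi]
  have hφ : ∀ z, φ ⁻¹' {z} = ((fun r i => r (i : ℕ)) ⁻¹' {z.1}) ×ˢ
      ((fun r i => r (i : ℕ)) ⁻¹' {z.2}) := by
    intro z
    ext r
    simp [φ, Prod.ext_iff]
  have hmeas : ∀ {N : ℕ} (ρ : Fin N → Bool),
      MeasurableSet ((fun (r : ℕ → Bool) (i : Fin N) => r i) ⁻¹' {ρ}) := fun ρ =>
    (measurable_pi_lambda _ fun i => measurable_pi_apply _) (MeasurableSet.singleton ρ)
  rw [hset, ← MeasureTheory.sum_measureReal_preimage_singleton _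
    fun z _ => by rw [hφ]; exact (hmeas _).prod (hmeas _)]
  simp only [hφ, MeasureTheory.measureReal_prod_prod, coinMeasure_real_cylinder]
  rw [← Finset.univ_product_univ, Finset.sum_filter, Finset.sum_product,
    Fintype.expect_eq_sum_div_card]
  simp only [Fintype.expect_eq_sum_div_card]
  simp only [Fintype.card_pi_const, Fintype.card_bool, Nat.cast_pow, Nat.cast_ofNat]
  rw [← Finset.sum_div, div_div, div_eq_mul_inv, Finset.sum_mul]
  refine Finset.sum_congr rfl fun ρ _ => ?_
  rw [Finset.sum_mul]
  refine Finset.sum_congr rfl fun β _ => ?_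
  split_ifs
  · rw [one_mul, mul_inv, mul_comm]
  · rw [zero_mul]

/-- Averages over bit strings may be restricted to the bits that matter. -/
theorem expect_comp_injective {ι κ : Type*} [Fintype ι] [Fintype κ] [DecidableEq ι]
    [DecidableEq κ] {φ : ι → κ} (hφ : Function.Injective φ) (g : (ι → Bool) → ℝ) :
    𝔼 e : κ → Bool, g (e ∘ φ) = 𝔼 d : ι → Bool, g d := by
  have hcard : Fintype.card {y // y ∈ Set.range φ} = Fintype.card ι :=
    Fintype.card_congr (Equiv.ofInjective φ hφ).symm
  -- Separates the bits at the positions in the range of `φ` from all the others, which `g (e ∘ φ)`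
  -- ignores.
  let E : (κ → Bool) ≃ (ι → Bool) × ({y // y ∉ Set.range φ} → Bool) :=
    (Equiv.piEquivPiSubtypeProd (fun y => y ∈ Set.range φ) fun _ => Bool).trans
      (Equiv.prodCongr ((Equiv.ofInjective φ hφ).symm.arrowCongr (Equiv.refl Bool))
        (Equiv.refl _))
  rw [Fintype.expect_equiv E (fun e => g (e ∘ φ)) (fun z => g z.1) fun e => rfl,
    ← Finset.univ_product_univ, Finset.expect_product]
  simp

/-! ### Output probabilities -/

namespace RATM

variable (M : RATM) (b : Bool)

theorem outProb_nonneg (x : List Bool) : 0 ≤ M.outProb x b := MeasureTheory.measureReal_nonneg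

theorem outProb_le_one (x : List Bool) : M.outProb x b ≤ 1 := MeasureTheory.measureReal_le_one

theorem summable_outProb (P : PMF (List Bool)) :
    Summable fun x => (P x).toReal * M.outProb x b :=
  Summable.of_nonneg_of_le (fun x => mul_nonneg ENNReal.toReal_nonneg (M.outProb_nonneg b x))
    (fun x => mul_le_of_le_one_right ENNReal.toReal_nonneg (M.outProb_le_one b x))
    (ENNReal.summable_toReal P.tsum_coe_ne_top)

theorem outProbOn_pure (x : List Bool) : M.outProbOn (PMF.pure x) b = M.outProb x b := by
  rw [outProbOn, tsum_eq_single x fun y hy => by simp [PMF.pure_apply, hy]]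
  simp

theorem outProbOn_bind {α : Type} [Fintype α] (P : PMF α) (Q : α → PMF (List Bool)) :
    M.outProbOn (P.bind Q) b = ∑ a, (P a).toReal * M.outProbOn (Q a) b := by
  have h : ∀ x, ((P.bind Q) x).toReal * M.outProb x b =
      ∑ a, (P a).toReal * ((Q a x).toReal * M.outProb x b) := by
    intro x
    rw [PMF.bind_apply, tsum_fintype, ENNReal.toReal_sum fun a _ =>
      ENNReal.mul_ne_top (P.apply_ne_top a) ((Q a).apply_ne_top x), Finset.sum_mul]
    exact Finset.sum_congr rfl fun a _ => by rw [ENNReal.toReal_mul, mul_assoc]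
  simp only [outProbOn, h]
  rw [Summable.tsum_finsetSum fun a _ => (M.summable_outProb b (Q a)).mul_left _]
  exact Finset.sum_congr rfl fun a _ => tsum_mul_left

theorem outProbOn_map_uniformOfFintype {α : Type} [Fintype α] [Nonempty α]
    (f : α → List Bool) :
    M.outProbOn ((PMF.uniformOfFintype α).map f) b = 𝔼 a, M.outProb (f a) b := by
  rw [PMF.map, outProbOn_bind, Fintype.expect_eq_sum_div_card, Finset.sum_div]
  refine Finset.sum_congr rfl fun a _ => ?_
  rw [Function.comp_apply, outProbOn_pure, PMF.uniformOfFintype_apply, ENNReal.toReal_inv,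
    ENNReal.toReal_natCast, div_eq_inv_mul]

end RATM

/-! ### The planted clique distributions -/

/-- The graph given by the bits `e`, with a clique planted at `K`. -/
def plantedGraph {n : ℕ} (K : Finset (Fin n)) (e : Sym2 (Fin n) → Bool) : SimpleGraph (Fin n) :=
  SimpleGraph.fromEdgeSet {s | (∀ v ∈ s, v ∈ K) ∨ e s = true}

theorem plantedGraph_adj {n : ℕ} {K : Finset (Fin n)} {e : Sym2 (Fin n) → Bool} {i j : Fin n} :
    (plantedGraph K e).Adj i j ↔ ((i ∈ K ∧ j ∈ K) ∨ e s(i, j) = true) ∧ i ≠ j := by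
  simp [plantedGraph]

/-- The null hypothesis is the case of an empty planted set, so one computation for fixed `K` serves
both hypotheses. -/
theorem outProbOn_nullInput (M : RATM) (b : Bool) (n k : ℕ) :
    M.outProbOn (nullInput n k) b =
      𝔼 e : Sym2 (Fin n) → Bool, M.outProb (encodeInstance n k (plantedGraph ∅ e)) b := by
  rw [nullInput, erdosRenyi, edgeBits, PMF.map_comp, RATM.outProbOn_map_uniformOfFintype]
  refine Finset.expect_congr rfl fun e _ => ?_
  have hG : plantedGraph ∅ e = SimpleGraph.fromEdgeSet {s | e s = true} := by
    ext i j
    simp [plantedGraph_adj]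
  rw [hG]
  rfl

/-- The condition `k ≤ n` excludes the default value of `uniformSubset`. -/
theorem outProbOn_plantedInput (M : RATM) (b : Bool) {n k : ℕ} (hk : k ≤ n) :
    M.outProbOn (plantedInput n k) b =
      (∑ K ∈ (Finset.univ : Finset (Fin n)).powersetCard k, 𝔼 e : Sym2 (Fin n) → Bool,
        M.outProb (encodeInstance n k (plantedGraph K e)) b) / n.choose k := by
  classical
  have hne : (Finset.univ.powersetCard k : Finset (Finset (Fin n))).Nonempty := by
    rw [Finset.powersetCard_nonempty]
    simpa using hk
  rw [plantedInput, plantedClique, PMF.map_bind, RATM.outProbOn_bind, uniformSubset, dif_pos hne,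
    ← Finset.sum_subset (Finset.subset_univ _) fun K _ hK => by
      rw [PMF.uniformOfFinset_apply_of_notMem _ hK]; simp, Finset.sum_div]
  refine Finset.sum_congr rfl fun K hK => ?_
  rw [PMF.uniformOfFinset_apply_of_mem _ hK, edgeBits, PMF.map_comp,
    RATM.outProbOn_map_uniformOfFintype, Finset.card_powersetCard, Finset.card_univ,
    Fintype.card_fin, ENNReal.toReal_inv, ENNReal.toReal_natCast, div_eq_inv_mul]
  rfl

/-- At most `T` read-once bits are consumed in `T` steps, so the output depends on finitely many
bits and `coinMeasure_prod_real` applies. -/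
theorem RATM.UsesAtMostRandomBits.outputs {M : RATM} {x : List Bool} {T B : ℕ} {l : List Bool}
    (hB : M.UsesAtMostRandomBits x B) (hT : ∀ ro ma, M.instr (M.conf x ro ma T) = .halt)
    (ro ro' ma ma' : ℕ → Bool) (hro : ∀ i < T, ro i = ro' i) (hma : ∀ i < B, ma i = ma' i)
    (h : M.Outputs x ro ma l) : M.Outputs x ro' ma' l := by
  have hc : M.conf x ro' ma' T = M.conf x ro ma T :=
    conf_congr (fun c hc => hro c (hc.trans_le (coins_le x ro ma T)))
      fun j _ q hq => hma _ (hB ro ma j q hq)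
  rw [outputs_iff_of_halt (hT _ _)] at h ⊢
  rw [hc, h]

theorem comap_plantedGraph {v n : ℕ} (hv : v ≤ n) (K : Finset (Fin v))
    (e : Sym2 (Fin n) → Bool) :
    (plantedGraph (K.map (Fin.castLEEmb hv)) e).comap (Fin.castLE hv) =
      plantedGraph K (e ∘ Sym2.map (Fin.castLE hv)) := by
  ext i j
  have hmem : ∀ i : Fin v, Fin.castLE hv i ∈ K.map (Fin.castLEEmb hv) ↔ i ∈ K := fun i =>
    Finset.mem_map' (Fin.castLEEmb hv)
  simp [plantedGraph_adj, hmem]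

/-! ### Inner and outer pairs of vertices, and transfer of the output law -/

/-- The pairs of vertices that are not contained in the first `v` vertices. -/
def outerPair (n v : ℕ) (a : Fin (n.choose 2 - v.choose 2)) : Sym2 (Fin n) :=
  s(⟨(tri (a + v.choose 2)).1, tri_lt (by omega)⟩,
    ⟨(tri (a + v.choose 2)).2, (tri_spec _).1.trans (tri_lt (by omega))⟩)

theorem outerPair_injective (n v : ℕ) : Function.Injective (outerPair n v) := by
  intro a a' h
  have ht := (tri_spec (a + v.choose 2)).1
  have ht' := (tri_spec (a' + v.choose 2)).1
  simp only [outerPair, Sym2.eq_iff, Fin.mk.injEq] at h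
  have : tri (a + v.choose 2) = tri (a' + v.choose 2) := Prod.ext (by omega) (by omega)
  have := tri_injective this
  exact Fin.ext (by omega)

theorem outerPair_ne {n v : ℕ} (hv : v ≤ n) (a : Fin (n.choose 2 - v.choose 2))
    (s : Sym2 (Fin v)) : Sym2.map (Fin.castLE hv) s ≠ outerPair n v a := by
  induction s with
  | _ i j =>
    have ht := le_tri (Nat.le_add_left (v.choose 2) a)
    simp only [outerPair, Sym2.map_mk, ne_eq, Sym2.eq_iff, Fin.ext_iff, Fin.val_castLE]
    omega

/-- The pairs of vertices, split into those among the first `v` vertices and the others. -/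
theorem sumElim_outerPair_injective {n v : ℕ} (hv : v ≤ n) :
    Function.Injective (Sum.elim (Sym2.map (Fin.castLE hv)) (outerPair n v)) :=
  (Sym2.map.injective (Fin.castLE_injective hv)).sumElim (outerPair_injective n v)
    fun s a => outerPair_ne hv a s

/-- The larger vertex of an outer pair is at least `v`, hence outside a clique planted among the
first `v` vertices. The adjacency bit is thus the original fair bit. -/
theorem subRandom_plantedGraph {n v k : ℕ} (hv : v ≤ n) (K : Finset (Fin v))
    (e : Sym2 (Fin n) → Bool) (a : Fin (n.choose 2 - v.choose 2)) :
    subRandom (encodeInstance n k (plantedGraph (K.map (Fin.castLEEmb hv)) e)) n (n + k + 2)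
      (v.choose 2) a = e (outerPair n v a) := by
  classical
  have hlt : (a : ℕ) + v.choose 2 < n.choose 2 := by omega
  have ht := (tri_spec (a + v.choose 2)).1
  have hle := le_tri (Nat.le_add_left (v.choose 2) a)
  rw [subRandom_encodeInstance hlt, Bool.eq_iff_iff, decide_eq_true_eq, plantedGraph_adj]
  have hK : ⟨(tri (a + v.choose 2)).1, tri_lt hlt⟩ ∉ K.map (Fin.castLEEmb hv) := by
    simp only [Finset.mem_map, not_exists, not_and]
    intro i _ hi
    have := congrArg Fin.val hi
    simp only [Fin.castLEEmb_apply, Fin.val_castLE] at this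
    omega
  simp only [hK, false_and, false_or, ne_eq, Fin.mk.injEq, outerPair]
  exact and_iff_left ht.ne'

theorem length_encodeInstance (n k : ℕ) (G : SimpleGraph (Fin n)) :
    (encodeInstance n k G).length = n + k + 2 + n * n := by
  rw [encodeInstance, List.length_append, length_encodePair, List.length_ofFn]

/-- The reduction turns a planted graph on `n` vertices, all of whose planted vertices are among
the first `v`, into a planted graph on `v` vertices and independent fair bits. -/
theorem expect_outProb_eq {A S : RATM} {n v k : ℕ} (hv : v ≤ n) (hS : S.RunsInLogspace)
    (hA : ∀ (G : SimpleGraph (Fin n)) ro ma l, A.Outputs (encodeInstance n k G) ro ma l ↔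
      S.Outputs (encodeInstance v k (G.comap (Fin.castLE hv))) ro
        (subRandom (encodeInstance n k G) n (n + k + 2) (v.choose 2)) l)
    (hB : ∀ G, S.UsesAtMostRandomBits (encodeInstance v k G) (n.choose 2 - v.choose 2))
    (K : Finset (Fin v)) (b : Bool) :
    𝔼 e, A.outProb (encodeInstance n k (plantedGraph (K.map (Fin.castLEEmb hv)) e)) b =
      𝔼 e, S.outProb (encodeInstance v k (plantedGraph K e)) b := by
  classical
  obtain ⟨C, hC⟩ := hS
  -- All instances with the same parameters have the same length, so one time bound serves for every
  -- graph.
  obtain ⟨T, hT⟩ : ∃ T, ∀ G ro ma,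
      S.instr (S.conf (encodeInstance v k G) ro ma T) = .halt :=
    ⟨C * ((v + k + 2 + v * v) ^ C + 1), fun G ro ma => by
      have := (hC (encodeInstance v k G) ro ma).1
      rwa [length_encodeInstance] at this⟩
  -- The output probability over the read-once bits alone, given the bits of the inner pairs (the
  -- graph) and of the outer pairs (the multiple access string).
  let F : (Sym2 (Fin v) ⊕ Fin (n.choose 2 - v.choose 2) → Bool) → ℝ := fun d =>
    𝔼 ρ : Fin T → Bool, if S.Outputs (encodeInstance v k (plantedGraph K (d ∘ Sum.inl)))
      (extendBits ρ) (extendBits (d ∘ Sum.inr)) [b] then 1 else 0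
  have hleft : ∀ e, A.outProb (encodeInstance n k (plantedGraph (K.map (Fin.castLEEmb hv)) e)) b =
      F (e ∘ Sum.elim (Sym2.map (Fin.castLE hv)) (outerPair n v)) := by
    intro e
    simp only [RATM.outProb, hA, comap_plantedGraph]
    -- By `hA` the outputs of `A` do not depend on its own multiple access string, so none of those
    -- bits is needed.
    rw [coinMeasure_prod_real (T := T) (B := 0) fun ro ro' _ _ hro _ =>
      (hB _).outputs (hT _) ro ro' _ _ hro fun _ _ => rfl]
    refine Finset.expect_congr rfl fun ρ _ => ?_
    rw [Fintype.expect_const]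
    have hloc := (hB (plantedGraph K (e ∘ Sym2.map (Fin.castLE hv)))).outputs (l := [b])
      (hT _) (extendBits ρ) (extendBits ρ)
    have hR : ∀ a < n.choose 2 - v.choose 2, subRandom (encodeInstance n k
        (plantedGraph (K.map (Fin.castLEEmb hv)) e)) n (n + k + 2) (v.choose 2) a =
        extendBits (e ∘ outerPair n v) a := by
      intro a ha
      rw [extendBits, dif_pos ha]
      exact subRandom_plantedGraph hv K e ⟨a, ha⟩
    exact if_congr ⟨hloc _ _ (fun _ _ => rfl) hR,
      hloc _ _ (fun _ _ => rfl) fun a ha => (hR a ha).symm⟩ rfl rfl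
  have hright : ∀ e, S.outProb (encodeInstance v k (plantedGraph K e)) b =
      𝔼 β, F (Sum.elim e β) := by
    intro e
    rw [RATM.outProb, coinMeasure_prod_real (T := T) fun ro ro' ma ma' hro hma =>
      (hB _).outputs (hT _) ro ro' ma ma' hro hma, Finset.expect_comm]
    rfl
  simp only [hleft, hright]
  -- Injectivity is enough: the only bits left out are those of the degenerate pairs `{u, u}` with
  -- `u` not among the first `v` vertices, and these are ignored.
  rw [expect_comp_injective (sumElim_outerPair_injective hv),
    Fintype.expect_equiv (Equiv.sumArrowEquivProdArrow _ _ Bool) F (fun z => F (Sum.elim z.1 z.2))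
      fun d => by congr 1; funext i; cases i <;> rfl,
    ← Finset.univ_product_univ, Finset.expect_product]

theorem outProbOn_nullInput_eq {A S : RATM} {n v k : ℕ} (b : Bool) (hv : v ≤ n)
    (h : ∀ K : Finset (Fin v),
      𝔼 e, A.outProb (encodeInstance n k (plantedGraph (K.map (Fin.castLEEmb hv)) e)) b =
        𝔼 e, S.outProb (encodeInstance v k (plantedGraph K e)) b) :
    A.outProbOn (nullInput n k) b = S.outProbOn (nullInput v k) b := by
  rw [outProbOn_nullInput, outProbOn_nullInput, ← h ∅, Finset.map_empty]

/-- With probability `C(v, k) / C(n, k)` all planted vertices are among the first `v`. -/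
theorem mul_outProbOn_plantedInput_le {A S : RATM} {n v k : ℕ} (b : Bool) (hv : v ≤ n)
    (hk : k ≤ v) (h : ∀ K : Finset (Fin v),
      𝔼 e, A.outProb (encodeInstance n k (plantedGraph (K.map (Fin.castLEEmb hv)) e)) b =
        𝔼 e, S.outProb (encodeInstance v k (plantedGraph K e)) b) :
    v.choose k / n.choose k * S.outProbOn (plantedInput v k) b ≤
      A.outProbOn (plantedInput n k) b := by
  have hpos : (0 : ℝ) < v.choose k := by exact_mod_cast Nat.choose_pos hk
  rw [outProbOn_plantedInput _ _ hk, outProbOn_plantedInput _ _ (hk.trans hv),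
    div_mul_div_comm, mul_comm (n.choose k : ℝ), mul_div_mul_left _ _ hpos.ne']
  refine div_le_div_of_nonneg_right ?_ (by positivity)
  simp only [← h]
  refine (Finset.sum_map ((Finset.univ : Finset (Fin v)).powersetCard k)
    (Finset.mapEmbedding (Fin.castLEEmb hv)).toEmbedding
    fun K => 𝔼 e, A.outProb (encodeInstance n k (plantedGraph K e)) b).symm.trans_le ?_
  -- The cliques that leave the first `v` vertices are dropped; nothing but nonnegativity is used
  -- about them.
  refine Finset.sum_le_sum_of_subset_of_nonneg ?_ fun K _ _ =>
    Finset.expect_nonneg fun e _ => A.outProb_nonneg _ _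
  intro K hK
  obtain ⟨K', hK', rfl⟩ := Finset.mem_map.1 hK
  rw [Finset.mem_powersetCard] at hK' ⊢
  exact ⟨Finset.subset_univ _, by simpa using hK'.2⟩

/-! ### Asymptotics -/

/-- Union bound: a `k`-set avoids the `m` removed points or contains one of them. For `k = 2` it
bounds the number of outer pairs. -/
theorem choose_le_choose_sub_add (n m : ℕ) {k : ℕ} (hk : 0 < k) :
    n.choose k ≤ (n - m).choose k + m * (n - 1).choose (k - 1) := by
  obtain ⟨k, rfl⟩ := Nat.exists_eq_add_of_lt hk
  simp only [zero_add, Nat.add_sub_cancel]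
  induction m with
  | zero => simp
  | succ m ih =>
    refine ih.trans ?_
    -- Pascal's rule needs a point left to remove; once the truncated difference is `0` it no longer
    -- changes.
    rcases Nat.eq_zero_or_pos (n - m) with h | h
    · rw [h, show n - (m + 1) = 0 by omega, Nat.succ_mul]
      omega
    · have h1 := Nat.choose_succ_succ (n - (m + 1)) k
      rw [Nat.succ_eq_add_one, show n - (m + 1) + 1 = n - m by omega] at h1
      have h2 : (n - (m + 1)).choose k ≤ (n - 1).choose k := Nat.choose_le_choose k (by omega)
      rw [Nat.succ_mul, h1, Nat.succ_eq_add_one]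
      omega

/-- A given point lies in a random `k`-set with probability `C(n-1,k-1) / C(n,k) = k / n`, so some
removed point does with probability at most `mk / n`. -/
theorem one_sub_le_choose_div {n m k : ℕ} (hk : 0 < k) (hkn : k ≤ n) :
    1 - (m * k : ℝ) / n ≤ (n - m).choose k / n.choose k := by
  have hn : (0 : ℝ) < n := by exact_mod_cast hk.trans_le hkn
  have hpos : (0 : ℝ) < n.choose k := by exact_mod_cast Nat.choose_pos hkn
  have h1 : (n.choose k : ℝ) ≤ (n - m).choose k + m * (n - 1).choose (k - 1) := by
    exact_mod_cast choose_le_choose_sub_add n m hk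
  have h2 : (n : ℝ) * (n - 1).choose (k - 1) = n.choose k * k := by
    have := Nat.add_one_mul_choose_eq (n - 1) (k - 1)
    rw [Nat.sub_add_cancel (hk.trans_le hkn),
      Nat.sub_add_cancel hk] at this
    exact_mod_cast this
  have h3 : ((n - 1).choose (k - 1) : ℝ) = n.choose k * k / n := by
    rw [← h2, mul_div_cancel_left₀ _ hn.ne']
  rw [le_div_iff₀ hpos, sub_mul, one_mul, sub_le_iff_le_add]
  rw [h3] at h1
  exact h1.trans (le_of_eq (by ring))

theorem RATM.outProbOn_le_one (M : RATM) (b : Bool) (P : PMF (List Bool)) :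
    M.outProbOn P b ≤ 1 := by
  have h1 : ∑' x, (P x).toReal = 1 := by
    rw [← ENNReal.tsum_toReal_eq P.apply_ne_top, P.tsum_coe, ENNReal.toReal_one]
  rw [outProbOn, ← h1]
  exact (M.summable_outProb b P).tsum_le_tsum
    (fun x => mul_le_of_le_one_right ENNReal.toReal_nonneg (M.outProb_le_one b x))
    (ENNReal.summable_toReal P.tsum_coe_ne_top)

/-- There are at most `m * n` outer pairs, and `m = o(n / k)`. -/
theorem isLittleO_choose_sub {n k m : ℕ → ℕ}
    (hm : (fun i => (m i : ℝ)) =o[Filter.atTop] fun i => (n i : ℝ) / (k i : ℝ)) :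
    (fun i => (((n i).choose 2 - (n i - m i).choose 2 : ℕ) : ℝ))
      =o[Filter.atTop] fun i => (n i : ℝ) ^ 2 / (k i : ℝ) := by
  have h := hm.mul_isBigO (Asymptotics.isBigO_refl (fun i => (n i : ℝ)) Filter.atTop)
  refine (Asymptotics.IsBigO.of_bound' (Filter.Eventually.of_forall fun i => ?_)).trans_isLittleO
    (h.congr_right fun i => by ring)
  have h1 := choose_le_choose_sub_add (n i) (m i) two_pos
  rw [show 2 - 1 = 1 from rfl, Nat.choose_one_right] at h1
  have h2 : m i * (n i - 1) ≤ m i * n i := Nat.mul_le_mul_left _ (Nat.sub_le _ _)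
  rw [Real.norm_of_nonneg (by positivity), Real.norm_of_nonneg (by positivity)]
  exact_mod_cast (by omega : (n i).choose 2 - (n i - m i).choose 2 ≤ m i * n i)

/-! ### Comparison of the success sums and conclusion -/

/-- A multiple access algorithm on the first `n - m` vertices, where the bits of the other pairs
are the multiple access random bits, is a randomized logspace algorithm. -/
theorem exists_isRandomizedLogspace {n k m : ℕ → ℕ} (hcomp : LogspaceComputable n k m)
    {S : RATM} (hS : S.IsMultipleAccessRandomizedLogspace) :
    ∃ A : RATM, A.IsRandomizedLogspace ∧ ∀ i, m i ≤ n i → 0 < k i → k i ≤ n i - m i →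
      (∀ G : SimpleGraph (Fin (n i - m i)),
        S.UsesAtMostRandomBits (encodeInstance (n i - m i) (k i) G)
          ((n i).choose 2 - (n i - m i).choose 2)) →
      S.outProbOn (nullInput (n i - m i) (k i)) false +
          S.outProbOn (plantedInput (n i - m i) (k i)) true ≤
        A.outProbOn (nullInput (n i) (k i)) false +
          A.outProbOn (plantedInput (n i) (k i)) true + (m i * k i : ℝ) / n i := by
  obtain ⟨D, hdet, hD, hDm⟩ := hcomp
  obtain ⟨A, hA, h⟩ := exists_reduction hdet hD hS
  refine ⟨A, hA, fun i hmn hk hkv hB => ?_⟩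
  have hv := Nat.sub_le (n i) (m i)
  have hred := expect_outProb_eq (A := A) (k := k i) hv hS.1 (fun G ro ma l => by
    rw [h _ _ _ _ (parses_encodeInstance _ _ _) hmn (fun ro ma => by
      rw [take_encodeInstance]
      exact hDm i ro ma), subInput_encodeInstance hmn]) hB
  have h1 := outProbOn_nullInput_eq false hv fun K => hred K false
  have h2 := mul_outProbOn_plantedInput_le true hv hkv fun K => hred K true
  have h3 := one_sub_le_choose_div (m := m i) hk (hkv.trans hv)
  have h4 := S.outProbOn_le_one true (plantedInput (n i - m i) (k i))
  have h5 : 0 ≤ S.outProbOn (plantedInput (n i - m i) (k i)) true :=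
    tsum_nonneg fun x => mul_nonneg ENNReal.toReal_nonneg (S.outProb_nonneg _ x)
  have h6 := mul_le_mul_of_nonneg_right h3 h5
  have h7 : (m i * k i : ℝ) / n i * S.outProbOn (plantedInput (n i - m i) (k i)) true ≤
      (m i * k i : ℝ) / n i := mul_le_of_le_one_right (by positivity) h4
  rw [sub_mul, one_mul] at h6
  linarith

/-- Both hypotheses are simple, so each infimum ranges over a single distribution. -/
theorem RATM.solves_PCD_iff {S : RATM} {n k : ℕ → ℕ} :
    S.Solves (PCD n k) ↔ ∃ c : ℝ, 0 < c ∧ ∀ᶠ i in Filter.atTop,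
      1 + c ≤ S.outProbOn (nullInput (n i) (k i)) false +
        S.outProbOn (plantedInput (n i) (k i)) true := by
  have h : ∀ (P : PMF (List Bool)) (b : Bool),
      (⨅ Q : ({P} : Set (PMF (List Bool))), S.outProbOn Q.1 b) = S.outProbOn P b := fun P b =>
    ciInf_unique
  simp only [Solves, PCD, h]

theorem mainTheorem8 (n k m : ℕ → ℕ)
    (hn_mono : Monotone n) (hk_mono : Monotone k) (hm_mono : Monotone m)
    (hn_pos : ∀ i, 0 < n i) (hk_pos : ∀ i, 0 < k i) (hm_pos : ∀ i, 0 < m i)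
    (hn : Filter.Tendsto n Filter.atTop Filter.atTop)
    (hm : (fun i => (m i : ℝ)) =o[Filter.atTop] fun i => (n i : ℝ) / (k i : ℝ))
    (hk : ∃ d : ℝ, 0 < d ∧
      (fun i => (k i : ℝ)) =O[Filter.atTop] fun i => (n i : ℝ) ^ (1 / 2 - d : ℝ))
    (hcomp : LogspaceComputable n k m) :
    ((fun i => (((n i).choose 2 - (n i - m i).choose 2 : ℕ) : ℝ))
        =o[Filter.atTop] fun i => (n i : ℝ) ^ 2 / (k i : ℝ)) ∧
    (PCConjSpace →
      ∀ S : RATM, S.IsMultipleAccessRandomizedLogspace →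
        (∀ᶠ i in Filter.atTop, ∀ G : SimpleGraph (Fin (n i - m i)),
          S.UsesAtMostRandomBits (encodeInstance (n i - m i) (k i) G)
            ((n i).choose 2 - (n i - m i).choose 2)) →
        ¬ S.Solves (PCD (fun i => n i - m i) k)) := by
  refine ⟨isLittleO_choose_sub hm, fun hconj S hS hB hsolves => ?_⟩
  obtain ⟨A, hA, hle⟩ := exists_isRandomizedLogspace hcomp hS
  obtain ⟨c, hc, hsum⟩ := RATM.solves_PCD_iff.1 hsolves
  have hlim := hconj A hA n k hn_mono hk_mono hn_pos hk_pos hn hk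
  have hratio : Filter.Tendsto (fun i => (m i * k i : ℝ) / n i) Filter.atTop (nhds 0) :=
    hm.tendsto_div_nhds_zero.congr fun i => by rw [div_div_eq_mul_div]
  have hsmall : ∀ ε > 0, ∀ᶠ i in Filter.atTop, (m i * k i : ℝ) / n i < ε := fun ε hε =>
    hratio.eventually_lt_const hε
  -- A single large index suffices: the sum of `S` is at least `1 + c`, that of `A` is below `1 + c
  -- / 2`, and the loss `mk / n` is below `c / 2`.
  obtain ⟨i, hBi, hsumi, hlimi, hci, hhalf⟩ := (hB.and (hsum.and
    ((hlim.eventually_lt_const (show (1 : ℝ) < 1 + c / 2 by linarith)).and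
      ((hsmall (c / 2) (by positivity)).and (hsmall (1 / 2) (by norm_num)))))).exists
  have hmk : 2 * (m i * k i) < n i := by
    have hni : (0 : ℝ) < n i := by exact_mod_cast hn_pos i
    rw [div_lt_iff₀ hni] at hhalf
    have : (2 * (m i * k i) : ℝ) < n i := by linarith
    exact_mod_cast this
  -- By positivity `m + k ≤ 2mk < n`; this gives `m ≤ n` and `k ≤ n - m`, so the clique fits into
  -- the smaller graph.
  have h1 : m i ≤ m i * k i := Nat.le_mul_of_pos_right _ (hk_pos i)
  have h2 : k i ≤ m i * k i := Nat.le_mul_of_pos_left _ (hm_pos i)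
  have := hle i (by omega) (hk_pos i) (by omega) hBi
  linarith
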